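/- Let $\mathfrak g=\mathfrak{sl}(3,\mathbb C)$, the complexified Lie algebra of $G=SU(2,1)=\{g\in SL(3,\mathbb C): g^*\gamma g=\gamma\}$ with $\gamma=\mathrm{diag}(1,1,-1)$, let $K=S(U(2)\times U(1))$ be the maximal compact subgroup of unitary matrices in $G$, and let $\mathfrak g=\mathfrak k\oplus\mathfrak p$ be the decomposition of $\mathfrak g$ into the $(+1)$- and $(-1)$-eigenspaces of $X\mapsto\gamma X\gamma$. With $e_{ij}$ the matrix units, put $$H_1=\tfrac13(2e_{11}-e_{22}-e_{33}),\quad H_2=\tfrac13(-e_{11}+2e_{22}-e_{33}),\quad H=H_1-H_2,$$ $$E=e_{12},\quad F=e_{21},\quad E_1=e_{13},\quad E_2=e_{23},\quad F_1=e_{31},\quad F_2=e_{32},$$ so that $\mathfrak k=\mathrm{span}\{H_1,H_2,E,F\}$ and $\mathfrak p=\mathrm{span}\{E_1,E_2,F_1,F_2\}$. Let $U(\mathfrak g)$ and $U(\mathfrak k)$ be the universal enveloping algebras, $Z(\mathfrak k)$ the center of $U(\mathfrak k)$, and $C(\mathfrak p)$ the Clifford algebra of $\mathfrak p$ with respect to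 the trace form $B(X,Y)=\operatorname{tr}(XY)$, with relations $vw+wv=-2B(v,w)$ for $v,w\in\mathfrak p$. The group $K$ acts on $U(\mathfrak g)$ and on $C(\mathfrak p)$ by the algebra automorphisms extending the adjoint action on $\mathfrak g$ and $\mathfrak p$, and on the tensor product algebra $U(\mathfrak g)\otimes C(\mathfrak p)$ (with product $(u\otimes c)(u'\otimes c')=uu'\otimes cc'$) by $\mathrm{Ad}\otimes\mathrm{Ad}$; a superscript $K$ denotes the subalgebra of $K$-invariants. Define in $U(\mathfrak g)\otimes C(\mathfrak p)$ $$\tilde a=(H_1+H_2)\otimes1,\qquad \tilde b=(H^2+2(EF+FE))\otimes1,\qquad \tilde g=1\otimes(E_1F_1+E_2F_2),$$ $$D=E_1\otimes F_1+E_2\otimes F_2+F_1\otimes E_1+F_2\otimes E_2,$$ $$D^{\mathfrak k}=E\otimes\alpha(F)+\tfrac12(H_1-H_2)\otimes\alpha(H_1-H_2)+\tfrac32(H_1+H_2)\otimes\alpha(H_1+H_2)+F\otimes\alpha(E),$$ where $\alpha:\mathfrak k\to C(\mathfrak p)$ is the action map $\mathfrak k\to\mathfrak{so}(\mathfrak p)$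 followed by $\mathfrak{so}(\mathfrak p)\cong\bigwedge^2(\mathfrak p)\hookrightarrow C(\mathfrak p)$, that is, $\alpha(X)=-\frac18\sum_i\big([X,b_i]\,d_i-d_i\,[X,b_i]\big)$ for the basis $(b_i)=(E_1,E_2,F_1,F_2)$ of $\mathfrak p$ and its $B$-dual basis $(d_i)=(F_1,F_2,E_1,E_2)$; it satisfies $\alpha(X)v-v\alpha(X)=[X,v]$ in $C(\mathfrak p)$ for all $X\in\mathfrak k$ and $v\in\mathfrak p$. Then: 1. the unital complex algebra $(U(\mathfrak g)\otimes C(\mathfrak p))^K$ is generated by the five elements $\tilde a,\tilde b,\tilde g,D,D^{\mathfrak k}$; 2. $\tilde a$ and $\tilde b$ are the images, under the natural homomorphism $U(\mathfrak k)\to U(\mathfrak g)\otimes C(\mathfrak p)$, of the elements $H_1+H_2$ and $H^2+2(EF+FE)$ of $U(\mathfrak k)$, and these two elements generate $Z(\mathfrak k)$ as a unital complex algebra; 3. $\tilde g$ is the image, under the natural homomorphism $C(\mathfrak p)\to U(\mathfrak g)\otimes C(\mathfrak p)$, of the element $E_1F_1+E_2F_2$ of $C(\mathfrak p)$, and this element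 generates $C(\mathfrak p)^K$ as a unital complex algebra. -/

import Mathlib

open scoped TensorProduct Matrix

namespace SU21

attribute [local instance 100] LieRing.ofAssociativeRing

noncomputable section

/-! ### The group `G = SU(2,1)`, its maximal compact subgroup `K`, and the Cartan decomposition -/

/-- Complex `3 × 3` matrices. -/
abbrev Mat := Matrix (Fin 3) (Fin 3) ℂ

/-- The group `SL(3, ℂ)`. -/
abbrev SL3 := Matrix.SpecialLinearGroup (Fin 3) ℂ

/-- The complex Lie algebra `𝔤 = 𝔰𝔩(3, ℂ)`. -/
abbrev sl3 := LieAlgebra.SpecialLinear.sl (Fin 3) ℂ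

/-- The matrix `γ = diag(1, 1, -1)`. -/
def gam : Mat := Matrix.diagonal ![1, 1, -1]

theorem gam_mul_gam : gam * gam = 1 := by
  ext i j
  fin_cases i <;> fin_cases j <;> simp [gam]

/-- The group `SU(2,1)`, a subgroup of `SL(3, ℂ)`. -/
def G : Subgroup SL3 where
  carrier := {g | (g : Mat)ᴴ * gam * (g : Mat) = gam}
  one_mem' := by simp
  mul_mem' := by
    intro a b ha hb
    simp only [Set.mem_ofPred_eq, Matrix.SpecialLinearGroup.coe_mul,
      Matrix.conjTranspose_mul] at *
    calc _ = (b : Mat)ᴴ * ((a : Mat)ᴴ * gam * (a : Mat)) * (b : Mat) := by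
          simp only [mul_assoc]
      _ = gam := by rw [ha, hb]
  inv_mem' := by
    intro a ha
    simp only [Set.mem_ofPred_eq] at *
    have h1 : (a : Mat) * ((a⁻¹ : SL3) : Mat) = 1 := by
      rw [← Matrix.SpecialLinearGroup.coe_mul, mul_inv_cancel,
        Matrix.SpecialLinearGroup.coe_one]
    have h2 : ((a⁻¹ : SL3) : Mat)ᴴ * (a : Mat)ᴴ = 1 := by
      rw [← Matrix.conjTranspose_mul, h1, Matrix.conjTranspose_one]
    calc _ = ((a⁻¹ : SL3) : Mat)ᴴ * ((a : Mat)ᴴ * gam * (a : Mat)) * ((a⁻¹ : SL3) : Mat) := by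
          rw [ha]
      _ = (((a⁻¹ : SL3) : Mat)ᴴ * (a : Mat)ᴴ) * gam * ((a : Mat) * ((a⁻¹ : SL3) : Mat)) := by
          simp only [mul_assoc]
      _ = gam := by rw [h1, h2, one_mul, mul_one]

/-- The maximal compact subgroup `K = S(U(2) × U(1))` of `SU(2,1)`: the unitary matrices in
`SU(2,1)`, i.e. the fixed points of the Cartan involution `g ↦ (gᴴ)⁻¹`.  The block form of its
elements is `mem_K_iff` below. -/
def K : Subgroup SL3 where
  carrier := {g | g ∈ G ∧ (g : Mat)ᴴ * (g : Mat) = 1}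
  one_mem' := ⟨G.one_mem, by simp⟩
  mul_mem' := by
    rintro a b ⟨ha, ha'⟩ ⟨hb, hb'⟩
    refine ⟨G.mul_mem ha hb, ?_⟩
    simp only [Matrix.SpecialLinearGroup.coe_mul, Matrix.conjTranspose_mul]
    calc _ = (b : Mat)ᴴ * ((a : Mat)ᴴ * (a : Mat)) * (b : Mat) := by
          simp only [mul_assoc]
      _ = 1 := by rw [ha', mul_one, hb']
  inv_mem' := by
    rintro a ⟨ha, ha'⟩
    refine ⟨G.inv_mem ha, ?_⟩
    have h1 : (a : Mat) * ((a⁻¹ : SL3) : Mat) = 1 := by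
      rw [← Matrix.SpecialLinearGroup.coe_mul, mul_inv_cancel,
        Matrix.SpecialLinearGroup.coe_one]
    have h3 : ((a⁻¹ : SL3) : Mat) = (a : Mat)ᴴ := by
      calc _ = (a : Mat)ᴴ * (a : Mat) * ((a⁻¹ : SL3) : Mat) := by rw [ha', one_mul]
        _ = _ := by rw [mul_assoc, h1, mul_one]
    rw [h3] at h1
    rw [h3, Matrix.conjTranspose_conjTranspose, h1]

theorem gam_comm_of_mem_K {g : SL3} (hg : g ∈ K) : gam * (g : Mat) = (g : Mat) * gam := by
  obtain ⟨h, h'⟩ := hg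
  have h'' : (g : Mat) * (g : Mat)ᴴ = 1 := mul_eq_one_comm.mp h'
  have h : (g : Mat)ᴴ * gam * (g : Mat) = gam := h
  calc gam * (g : Mat) = ((g : Mat) * (g : Mat)ᴴ) * (gam * (g : Mat)) := by rw [h'', one_mul]
    _ = (g : Mat) * ((g : Mat)ᴴ * gam * (g : Mat)) := by simp only [mul_assoc]
    _ = _ := by rw [h]

/-- `K` consists of the unitary matrices of determinant one which are block diagonal with blocks
of sizes `2` and `1`. -/
theorem mem_K_iff (g : SL3) : g ∈ K ↔ (g : Mat)ᴴ * (g : Mat) = 1 ∧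
    (g : Mat) 0 2 = 0 ∧ (g : Mat) 1 2 = 0 ∧ (g : Mat) 2 0 = 0 ∧ (g : Mat) 2 1 = 0 := by
  constructor
  · intro hg
    have hc := gam_comm_of_mem_K hg
    refine ⟨hg.2, ?_, ?_, ?_, ?_⟩
    · have := congrFun (congrFun hc 0) 2
      simp [gam] at this
      linear_combination (1 / 2) * this
    · have := congrFun (congrFun hc 1) 2
      simp [gam] at this
      linear_combination (1 / 2) * this
    · have := congrFun (congrFun hc 2) 0
      simp [gam] at this
      linear_combination (-1 / 2) * this
    · have := congrFun (congrFun hc 2) 1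
      simp [gam] at this
      linear_combination (-1 / 2) * this
  · rintro ⟨h, h1, h2, h3, h4⟩
    have hc : gam * (g : Mat) = (g : Mat) * gam := by
      ext i j
      fin_cases i <;> fin_cases j <;> simp [gam, h1, h2, h3, h4]
    refine ⟨?_, h⟩
    change (g : Mat)ᴴ * gam * (g : Mat) = gam
    rw [mul_assoc, hc, ← mul_assoc, h, one_mul]

/-- `𝔨`, the `+1`-eigenspace in `𝔤` of the complexified Cartan involution `X ↦ γ X γ`
(which is `X ↦ -Xᴴ` on the real form `𝔰𝔲(2,1)`). -/
def kk : LieSubalgebra ℂ sl3 where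
  carrier := {X | gam * (X : Mat) * gam = (X : Mat)}
  zero_mem' := by simp
  add_mem' := by
    intro X Y hX hY
    simp only [Set.mem_ofPred_eq] at *
    simp [mul_add, add_mul, hX, hY]
  smul_mem' := by
    intro c X hX
    simp only [Set.mem_ofPred_eq] at *
    simp [hX]
  lie_mem' := by
    intro X Y hX hY
    simp only [Set.mem_ofPred_eq] at *
    change gam * (X.1 * Y.1 - Y.1 * X.1) * gam = X.1 * Y.1 - Y.1 * X.1
    have key : ∀ A B : Mat, gam * (A * B) * gam = (gam * A * gam) * (gam * B * gam) := by
      intro A B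
      calc gam * (A * B) * gam = gam * A * 1 * B * gam := by simp only [mul_assoc, one_mul]
        _ = _ := by rw [← gam_mul_gam]; simp only [mul_assoc]
    rw [mul_sub, sub_mul, key, key, hX, hY]

/-- `𝔭`, the `-1`-eigenspace in `𝔤` of the complexified Cartan involution `X ↦ γ X γ`. -/
def pp : Submodule ℂ sl3 where
  carrier := {X | gam * (X : Mat) * gam = -(X : Mat)}
  zero_mem' := by simp
  add_mem' := by
    intro X Y hX hY
    simp only [Set.mem_ofPred_eq] at *
    simp [mul_add, add_mul, hX, hY, add_comm]
  smul_mem' := by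
    intro c X hX
    simp only [Set.mem_ofPred_eq] at *
    simp [hX]

theorem lie_mem_pp (X : kk) (v : pp) : ⁅(X : sl3), (v : sl3)⁆ ∈ pp := by
  obtain ⟨X, hX⟩ := X
  obtain ⟨Y, hY⟩ := v
  change gam * (X.1 * Y.1 - Y.1 * X.1) * gam = -(X.1 * Y.1 - Y.1 * X.1)
  have hX : gam * (X : Mat) * gam = (X : Mat) := hX
  have hY : gam * (Y : Mat) * gam = -(Y : Mat) := hY
  have key : ∀ A B : Mat, gam * (A * B) * gam = (gam * A * gam) * (gam * B * gam) := by
    intro A B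
    calc gam * (A * B) * gam = gam * A * 1 * B * gam := by simp only [mul_assoc, one_mul]
      _ = _ := by rw [← gam_mul_gam]; simp only [mul_assoc]
  rw [mul_sub, sub_mul, key, key, hX, hY]
  simp only [mul_neg, neg_mul]
  abel

/-! ### The standard basis of `𝔤` -/

/-- The matrix unit `e_{ij}`, `i ≠ j`, as an element of `𝔤`. -/
abbrev unit (i j : Fin 3) (h : i ≠ j) : sl3 := LieAlgebra.SpecialLinear.single i j h (1 : ℂ)

/-- `H₁ = (2 e₁₁ - e₂₂ - e₃₃) / 3`. -/
def H1 : sl3 := ⟨Matrix.diagonal ![2 / 3, -1 / 3, -1 / 3], by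
  change Matrix.trace (_ : Mat) = 0
  rw [Matrix.trace_diagonal, Fin.sum_univ_three]
  simp
  norm_num⟩

/-- `H₂ = (-e₁₁ + 2 e₂₂ - e₃₃) / 3`. -/
def H2 : sl3 := ⟨Matrix.diagonal ![-1 / 3, 2 / 3, -1 / 3], by
  change Matrix.trace (_ : Mat) = 0
  rw [Matrix.trace_diagonal, Fin.sum_univ_three]
  simp
  norm_num⟩

/-- `E = e₁₂`. -/
def E : sl3 := unit 0 1 (by decide)
/-- `F = e₂₁`. -/
def F : sl3 := unit 1 0 (by decide)
/-- `E₁ = e₁₃`. -/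
def E1 : sl3 := unit 0 2 (by decide)
/-- `E₂ = e₂₃`. -/
def E2 : sl3 := unit 1 2 (by decide)
/-- `F₁ = e₃₁`. -/
def F1 : sl3 := unit 2 0 (by decide)
/-- `F₂ = e₃₂`. -/
def F2 : sl3 := unit 2 1 (by decide)

theorem H1_mem : H1 ∈ kk := by
  change gam * H1.1 * gam = H1.1
  ext i j
  fin_cases i <;> fin_cases j <;> simp [gam, H1]

theorem H2_mem : H2 ∈ kk := by
  change gam * H2.1 * gam = H2.1
  ext i j
  fin_cases i <;> fin_cases j <;> simp [gam, H2]

theorem E_mem : E ∈ kk := by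
  change gam * E.1 * gam = E.1
  ext i j
  fin_cases i <;> fin_cases j <;> simp [gam, E]

theorem F_mem : F ∈ kk := by
  change gam * F.1 * gam = F.1
  ext i j
  fin_cases i <;> fin_cases j <;> simp [gam, F]

theorem E1_mem : E1 ∈ pp := by
  change gam * E1.1 * gam = -E1.1
  ext i j
  fin_cases i <;> fin_cases j <;> simp [gam, E1]

theorem E2_mem : E2 ∈ pp := by
  change gam * E2.1 * gam = -E2.1
  ext i j
  fin_cases i <;> fin_cases j <;> simp [gam, E2]

theorem F1_mem : F1 ∈ pp := by
  change gam * F1.1 * gam = -F1.1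
  ext i j
  fin_cases i <;> fin_cases j <;> simp [gam, F1]

theorem F2_mem : F2 ∈ pp := by
  change gam * F2.1 * gam = -F2.1
  ext i j
  fin_cases i <;> fin_cases j <;> simp [gam, F2]

/-- `H₁` as an element of `𝔨`. -/
def kH1 : kk := ⟨H1, H1_mem⟩
/-- `H₂` as an element of `𝔨`. -/
def kH2 : kk := ⟨H2, H2_mem⟩
/-- `E` as an element of `𝔨`. -/
def kE : kk := ⟨E, E_mem⟩
/-- `F` as an element of `𝔨`. -/
def kF : kk := ⟨F, F_mem⟩
/-- `E₁` as an element of `𝔭`. -/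
def pE1 : pp := ⟨E1, E1_mem⟩
/-- `E₂` as an element of `𝔭`. -/
def pE2 : pp := ⟨E2, E2_mem⟩
/-- `F₁` as an element of `𝔭`. -/
def pF1 : pp := ⟨F1, F1_mem⟩
/-- `F₂` as an element of `𝔭`. -/
def pF2 : pp := ⟨F2, F2_mem⟩

/-- `𝔨` is spanned by `H₁, H₂, E, F`. -/
theorem kk_eq_span : kk.toSubmodule = Submodule.span ℂ {H1, H2, E, F} := by
  apply le_antisymm
  · intro X hX
    have hX' : gam * X.1 * gam = X.1 := hX
    have h02 := congrFun (congrFun hX' 0) 2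
    have h12 := congrFun (congrFun hX' 1) 2
    have h20 := congrFun (congrFun hX' 2) 0
    have h21 := congrFun (congrFun hX' 2) 1
    simp [gam] at h02 h12 h20 h21
    replace h02 : X.1 0 2 = 0 := by linear_combination (-1 / 2) * h02
    replace h12 : X.1 1 2 = 0 := by linear_combination (-1 / 2) * h12
    replace h20 : X.1 2 0 = 0 := by linear_combination (-1 / 2) * h20
    replace h21 : X.1 2 1 = 0 := by linear_combination (-1 / 2) * h21
    have htr : Matrix.trace X.1 = 0 := X.2
    rw [Matrix.trace_fin_three] at htr
    simp only [Submodule.mem_span_insert, Submodule.mem_span_singleton]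
    refine ⟨X.1 0 0 - X.1 2 2, _, ⟨X.1 1 1 - X.1 2 2, _, ⟨X.1 0 1, _, ⟨X.1 1 0, rfl⟩, rfl⟩,
      rfl⟩, ?_⟩
    apply Subtype.ext
    ext i j
    fin_cases i <;> fin_cases j <;> simp [H1, H2, E, F, h02, h12, h20, h21]
    · linear_combination (1 / 3) * htr
    · linear_combination (1 / 3) * htr
    · linear_combination (1 / 3) * htr
  · rw [Submodule.span_le]
    rintro _ (rfl | rfl | rfl | rfl)
    exacts [H1_mem, H2_mem, E_mem, F_mem]

/-- `𝔭` is spanned by `E₁, E₂, F₁, F₂`. -/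
theorem pp_eq_span : pp = Submodule.span ℂ {E1, E2, F1, F2} := by
  apply le_antisymm
  · intro X hX
    have hX' : gam * X.1 * gam = -X.1 := hX
    have h00 := congrFun (congrFun hX' 0) 0
    have h01 := congrFun (congrFun hX' 0) 1
    have h10 := congrFun (congrFun hX' 1) 0
    have h11 := congrFun (congrFun hX' 1) 1
    have h22 := congrFun (congrFun hX' 2) 2
    simp [gam] at h00 h01 h10 h11 h22
    replace h00 : X.1 0 0 = 0 := by linear_combination (1 / 2) * h00
    replace h01 : X.1 0 1 = 0 := by linear_combination (1 / 2) * h01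
    replace h10 : X.1 1 0 = 0 := by linear_combination (1 / 2) * h10
    replace h11 : X.1 1 1 = 0 := by linear_combination (1 / 2) * h11
    replace h22 : X.1 2 2 = 0 := by linear_combination (1 / 2) * h22
    simp only [Submodule.mem_span_insert, Submodule.mem_span_singleton]
    refine ⟨X.1 0 2, _, ⟨X.1 1 2, _, ⟨X.1 2 0, _, ⟨X.1 2 1, rfl⟩, rfl⟩, rfl⟩, ?_⟩
    apply Subtype.ext
    ext i j
    fin_cases i <;> fin_cases j <;> simp [E1, E2, F1, F2, h00, h01, h10, h11, h22]
  · rw [Submodule.span_le]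
    rintro _ (rfl | rfl | rfl | rfl)
    exacts [E1_mem, E2_mem, F1_mem, F2_mem]

/-! ### The algebras `U(𝔤)`, `U(𝔨)`, `C(𝔭)` and `U(𝔤) ⊗ C(𝔭)` -/

/-- `U(𝔤)`. -/
abbrev Ug := UniversalEnvelopingAlgebra ℂ sl3

/-- `U(𝔨)`. -/
abbrev Uk := UniversalEnvelopingAlgebra ℂ kk

/-- The trace form `B(X, Y) = tr(XY)` on `𝔭`. -/
def B : LinearMap.BilinForm ℂ pp :=
  LinearMap.mk₂ ℂ (fun v w => Matrix.trace (((v : sl3) : Mat) * ((w : sl3) : Mat)))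
    (by intro a b c; simp [add_mul]) (by intro a b c; simp)
    (by intro a b c; simp [mul_add]) (by intro a b c; simp)

theorem B_apply (v w : pp) : B v w = Matrix.trace (v.1.1 * w.1.1) := rfl

theorem B_comm (v w : pp) : B v w = B w v := by
  rw [B_apply, B_apply, Matrix.trace_mul_comm]

/-- The quadratic form `v ↦ -B(v, v)` on `𝔭`. -/
def Q : QuadraticForm ℂ pp := -(LinearMap.BilinMap.toQuadraticMap B)

/-- The Clifford algebra `C(𝔭)` of the trace form, with the relations
`v w + w v = -2 B(v, w)` for `v, w ∈ 𝔭`. -/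
abbrev Cp := CliffordAlgebra Q

/-- `U(𝔤) ⊗ C(𝔭)`, with the product `(u ⊗ c) (u' ⊗ c') = u u' ⊗ c c'`. -/
abbrev UC := Ug ⊗[ℂ] Cp

/-- The inclusion `𝔤 → U(𝔤)`. -/
abbrev u : sl3 →ₗ⁅ℂ⁆ Ug := UniversalEnvelopingAlgebra.ι ℂ

/-- The inclusion `𝔨 → U(𝔨)`. -/
abbrev uk : kk →ₗ⁅ℂ⁆ Uk := UniversalEnvelopingAlgebra.ι ℂ

/-- The inclusion `𝔭 → C(𝔭)`. -/
abbrev cl : pp →ₗ[ℂ] Cp := CliffordAlgebra.ι Q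

theorem cl_mul_add_mul_cl (v w : pp) :
    cl v * cl w + cl w * cl v = algebraMap ℂ Cp (-2 * B v w) := by
  have hs := B_comm w v
  rw [CliffordAlgebra.ι_mul_ι_add_swap]
  congr 1
  simp only [QuadraticMap.polar, Q, neg_apply,
    LinearMap.BilinMap.toQuadraticMap_apply, map_add, LinearMap.add_apply, hs]
  ring

/-- The inclusion of `U(𝔨)` into `U(𝔤) ⊗ C(𝔭)`, `x ↦ x ⊗ 1`. -/
def UkToUC : Uk →ₐ[ℂ] UC :=
  (Algebra.TensorProduct.includeLeft : Ug →ₐ[ℂ] UC).comp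
    (UniversalEnvelopingAlgebra.lift ℂ (u.comp kk.incl))

/-- The inclusion of `C(𝔭)` into `U(𝔤) ⊗ C(𝔭)`, `x ↦ 1 ⊗ x`. -/
def CpToUC : Cp →ₐ[ℂ] UC := Algebra.TensorProduct.includeRight

/-! ### The adjoint action of `K` and the algebras of invariants -/

/-- The adjoint action of `SL(3, ℂ)` on `𝔤`: `Ad(g) X = g X g⁻¹`. -/
def Ad (g : SL3) : sl3 →ₗ⁅ℂ⁆ sl3 where
  toFun X := ⟨(g : Mat) * (X : Mat) * ((g⁻¹ : SL3) : Mat), by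
    change Matrix.trace (_ : Mat) = 0
    have hX : Matrix.trace (X : Mat) = 0 := X.2
    rw [Matrix.trace_mul_comm, ← mul_assoc, ← Matrix.SpecialLinearGroup.coe_mul,
      inv_mul_cancel, Matrix.SpecialLinearGroup.coe_one, one_mul, hX]⟩
  map_add' X Y := by
    apply Subtype.ext
    simp [mul_add, add_mul]
  map_smul' c X := by
    apply Subtype.ext
    simp
  map_lie' := by
    intro X Y
    apply Subtype.ext
    change (g : Mat) * (X.1 * Y.1 - Y.1 * X.1) * ((g⁻¹ : SL3) : Mat) =
      ((g : Mat) * X.1 * ((g⁻¹ : SL3) : Mat)) * ((g : Mat) * Y.1 * ((g⁻¹ : SL3) : Mat)) -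
      ((g : Mat) * Y.1 * ((g⁻¹ : SL3) : Mat)) * ((g : Mat) * X.1 * ((g⁻¹ : SL3) : Mat))
    have h : ((g⁻¹ : SL3) : Mat) * (g : Mat) = 1 := by
      rw [← Matrix.SpecialLinearGroup.coe_mul, inv_mul_cancel,
        Matrix.SpecialLinearGroup.coe_one]
    have key : ∀ A C : Mat, ((g : Mat) * A * ((g⁻¹ : SL3) : Mat)) *
        ((g : Mat) * C * ((g⁻¹ : SL3) : Mat)) = (g : Mat) * (A * C) * ((g⁻¹ : SL3) : Mat) := by
      intro A C
      calc _ = (g : Mat) * A * (((g⁻¹ : SL3) : Mat) * (g : Mat)) * C * ((g⁻¹ : SL3) : Mat) := by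
            simp only [mul_assoc]
        _ = _ := by rw [h]; simp only [mul_assoc, one_mul]
    rw [key, key, mul_sub, sub_mul]

theorem Ad_mem_pp (g : K) {X : sl3} (hX : X ∈ pp) : Ad g.1 X ∈ pp := by
  have hX : gam * X.1 * gam = -X.1 := hX
  change gam * ((g.1 : Mat) * X.1 * ((g.1⁻¹ : SL3) : Mat)) * gam =
    -((g.1 : Mat) * X.1 * ((g.1⁻¹ : SL3) : Mat))
  have h1 := gam_comm_of_mem_K g.2
  have h2 := gam_comm_of_mem_K (K.inv_mem g.2)
  calc _ = (gam * (g.1 : Mat)) * X.1 * (((g.1⁻¹ : SL3) : Mat) * gam) := by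
        simp only [mul_assoc]
    _ = (g.1 : Mat) * (gam * X.1 * gam) * ((g.1⁻¹ : SL3) : Mat) := by
        rw [h1, ← h2]; simp only [mul_assoc]
    _ = _ := by rw [hX]; simp only [mul_neg, neg_mul]

/-- The adjoint action of `K` on `𝔭`, an isometry. -/
def AdP (g : K) : Q →qᵢ Q where
  toLinearMap := ((Ad g.1 : sl3 →ₗ⁅ℂ⁆ sl3) : sl3 →ₗ[ℂ] sl3).restrict (fun _ hX => Ad_mem_pp g hX)
  map_app' := by
    rintro ⟨X, hX⟩
    change -Matrix.trace (((g.1 : Mat) * X.1 * ((g.1⁻¹ : SL3) : Mat)) *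
      ((g.1 : Mat) * X.1 * ((g.1⁻¹ : SL3) : Mat))) = -Matrix.trace (X.1 * X.1)
    have h : ((g.1⁻¹ : SL3) : Mat) * (g.1 : Mat) = 1 := by
      rw [← Matrix.SpecialLinearGroup.coe_mul, inv_mul_cancel,
        Matrix.SpecialLinearGroup.coe_one]
    have key : ((g.1 : Mat) * X.1 * ((g.1⁻¹ : SL3) : Mat)) *
        ((g.1 : Mat) * X.1 * ((g.1⁻¹ : SL3) : Mat)) =
        ((g.1 : Mat) * (X.1 * X.1)) * ((g.1⁻¹ : SL3) : Mat) := by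
      calc _ = (g.1 : Mat) * X.1 * (((g.1⁻¹ : SL3) : Mat) * (g.1 : Mat)) * X.1 *
            ((g.1⁻¹ : SL3) : Mat) := by
            simp only [mul_assoc]
        _ = _ := by rw [h]; simp only [mul_assoc, one_mul]
    rw [key, Matrix.trace_mul_comm, ← mul_assoc, h, one_mul]

/-- The action of `K` on `U(𝔤)` by algebra automorphisms extending `Ad`. -/
def actU (g : K) : Ug →ₐ[ℂ] Ug := UniversalEnvelopingAlgebra.lift ℂ (u.comp (Ad g.1))

/-- The action of `K` on `C(𝔭)` by algebra automorphisms extending `Ad`. -/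
def actC (g : K) : Cp →ₐ[ℂ] Cp := CliffordAlgebra.map (AdP g)

/-- The action `Ad ⊗ Ad` of `K` on `U(𝔤) ⊗ C(𝔭)`. -/
def actUC (g : K) : UC →ₐ[ℂ] UC := Algebra.TensorProduct.map (actU g) (actC g)

/-- The algebra of invariants `C(𝔭)^K`. -/
def CpInv : Subalgebra ℂ Cp := ⨅ g : K, AlgHom.equalizer (actC g) (AlgHom.id ℂ Cp)

/-- The algebra of invariants `(U(𝔤) ⊗ C(𝔭))^K`. -/
def UCInv : Subalgebra ℂ UC := ⨅ g : K, AlgHom.equalizer (actUC g) (AlgHom.id ℂ UC)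

theorem mem_CpInv (x : Cp) : x ∈ CpInv ↔ ∀ g : K, actC g x = x := by
  simp [CpInv, Algebra.mem_iInf, AlgHom.mem_equalizer]

theorem mem_UCInv (x : UC) : x ∈ UCInv ↔ ∀ g : K, actUC g x = x := by
  simp [UCInv, Algebra.mem_iInf, AlgHom.mem_equalizer]

/-! ### The generators -/

/-- `H₁ + H₂ ∈ U(𝔨)`. -/
def aK : Uk := uk (kH1 + kH2)

/-- `H² + 2 (E F + F E) ∈ U(𝔨)`, where `H = H₁ - H₂`. -/
def bK : Uk := uk (kH1 - kH2) ^ 2 + 2 * (uk kE * uk kF + uk kF * uk kE)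

/-- `E₁ F₁ + E₂ F₂ ∈ C(𝔭)`. -/
def gC : Cp := cl pE1 * cl pF1 + cl pE2 * cl pF2

/-- `ã = (H₁ + H₂) ⊗ 1`. -/
def aTilde : UC := u (H1 + H2) ⊗ₜ 1

/-- `b̃ = (H² + 2 (E F + F E)) ⊗ 1`, where `H = H₁ - H₂`. -/
def bTilde : UC := (u (H1 - H2) ^ 2 + 2 * (u E * u F + u F * u E)) ⊗ₜ 1

/-- `g̃ = 1 ⊗ (E₁ F₁ + E₂ F₂)`. -/
def gTilde : UC := 1 ⊗ₜ (cl pE1 * cl pF1 + cl pE2 * cl pF2)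

/-- The Dirac operator `D = E₁ ⊗ F₁ + E₂ ⊗ F₂ + F₁ ⊗ E₁ + F₂ ⊗ E₂`. -/
def D : UC := u E1 ⊗ₜ cl pF1 + u E2 ⊗ₜ cl pF2 + u F1 ⊗ₜ cl pE1 + u F2 ⊗ₜ cl pE2

/-- The basis `(E₁, E₂, F₁, F₂)` of `𝔭`. -/
def pBasis : Fin 4 → pp := ![pE1, pE2, pF1, pF2]

/-- The dual basis `(F₁, F₂, E₁, E₂)` of `𝔭` with respect to `B`. -/
def pDual : Fin 4 → pp := ![pF1, pF2, pE1, pE2]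

theorem B_pBasis_pDual (i j : Fin 4) : B (pBasis i) (pDual j) = if i = j then 1 else 0 := by
  change Matrix.trace ((pBasis i).1.1 * (pDual j).1.1) = _
  fin_cases i <;> fin_cases j <;>
    simp [pBasis, pDual, pE1, pE2, pF1, pF2, E1, E2, F1, F2]

/-- The action of `𝔨` on `𝔭`, `v ↦ [X, v]`. -/
def adP (X : kk) (v : pp) : pp := ⟨⁅(X : sl3), (v : sl3)⁆, lie_mem_pp X v⟩

/-- The map `α : 𝔨 → 𝔰𝔬(𝔭) ≅ ⋀²(𝔭) → C(𝔭)`.  For dual bases `b_i`, `d_i` of `𝔭` the element of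
`⋀²(𝔭)` corresponding to `ad X ∈ 𝔰𝔬(𝔭)` is `-(1/4) ∑ [X, b_i] ∧ d_i`, and the Chevalley map sends
`v ∧ w` to `(1/2) (v w - w v)`.  The normalization is the one for which
`α(X) v - v α(X) = [X, v]` in `C(𝔭)`, see `alpha_commutator`. -/
def alpha (X : kk) : Cp :=
  -((1 / 8 : ℂ) • ∑ i, (cl (adP X (pBasis i)) * cl (pDual i) -
      cl (pDual i) * cl (adP X (pBasis i))))

theorem exists_coords (v : pp) :
    ∃ x y z t : ℂ, v = x • pE1 + y • pE2 + z • pF1 + t • pF2 := by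
  obtain ⟨v, hv⟩ := v
  have hv' := hv
  rw [pp_eq_span] at hv'
  simp only [Submodule.mem_span_insert, Submodule.mem_span_singleton] at hv'
  obtain ⟨x, _, ⟨y, _, ⟨z, _, ⟨t, rfl⟩, rfl⟩, rfl⟩, h⟩ := hv'
  refine ⟨x, y, z, t, Subtype.ext ?_⟩
  simp [h, pE1, pE2, pF1, pF2, add_assoc]

theorem sum_B_pDual (v : pp) : ∑ i, B (pDual i) v • pBasis i = v := by
  have h : ∀ i j, B (pDual i) (pBasis j) = if j = i then 1 else 0 := fun i j => by
    rw [B_comm, B_pBasis_pDual]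
  obtain ⟨x, y, z, t, rfl⟩ := exists_coords v
  have h0 : pE1 = pBasis 0 := rfl
  have h1 : pE2 = pBasis 1 := rfl
  have h2 : pF1 = pBasis 2 := rfl
  have h3 : pF2 = pBasis 3 := rfl
  rw [h0, h1, h2, h3]
  simp [Fin.sum_univ_four, h]

theorem sum_B_pBasis (v : pp) : ∑ i, B (pBasis i) v • pDual i = v := by
  obtain ⟨x, y, z, t, rfl⟩ := exists_coords v
  have h0 : pE1 = pDual 2 := rfl
  have h1 : pE2 = pDual 3 := rfl
  have h2 : pF1 = pDual 0 := rfl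
  have h3 : pF2 = pDual 1 := rfl
  rw [h0, h1, h2, h3]
  simp [Fin.sum_univ_four, B_pBasis_pDual]
  abel

theorem B_adP (X : kk) (v w : pp) : B (adP X v) w = -B v (adP X w) := by
  change Matrix.trace ((X.1.1 * v.1.1 - v.1.1 * X.1.1) * w.1.1) =
    -Matrix.trace (v.1.1 * (X.1.1 * w.1.1 - w.1.1 * X.1.1))
  rw [sub_mul, mul_sub, Matrix.trace_sub, Matrix.trace_sub, mul_assoc X.1.1,
    Matrix.trace_mul_comm X.1.1]
  simp only [mul_assoc]
  ring

/-- `adP X` as a linear map. -/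
def adPLin (X : kk) : pp →ₗ[ℂ] pp where
  toFun := adP X
  map_add' v w := Subtype.ext (by simp [adP])
  map_smul' c v := Subtype.ext (by simp [adP])

theorem alpha_commutator (X : kk) (v : pp) :
    alpha X * cl v - cl v * alpha X = cl (adP X v) := by
  have key : ∀ x y : pp, (cl x * cl y - cl y * cl x) * cl v - cl v * (cl x * cl y - cl y * cl x) =
      (-4 * B y v) • cl x + (4 * B x v) • cl y := by
    intro x y
    have hx := cl_mul_add_mul_cl x v
    have hy := cl_mul_add_mul_cl y v
    calc _ = cl x * (cl y * cl v + cl v * cl y) - (cl x * cl v + cl v * cl x) * cl y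
          - cl y * (cl x * cl v + cl v * cl x) + (cl y * cl v + cl v * cl y) * cl x := by
          noncomm_ring
      _ = _ := by
          rw [hx, hy, ← Algebra.commutes, ← Algebra.commutes]
          simp only [← Algebra.smul_def]
          module
  have h1 : ∑ i, B (pDual i) v • cl (adP X (pBasis i)) = cl (adP X v) := by
    have := congrArg (fun w => cl (adPLin X w)) (sum_B_pDual v)
    simp only [map_sum, map_smul] at this
    exact this
  have h2 : ∑ i, B (adP X (pBasis i)) v • cl (pDual i) = -cl (adP X v) := by
    have := congrArg (fun w => -cl w) (sum_B_pBasis (adP X v))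
    simp only [map_sum, map_smul] at this
    simp only [B_adP, neg_smul, Finset.sum_neg_distrib]
    exact this
  have h3 : alpha X * cl v - cl v * alpha X = -((1 / 8 : ℂ) •
      ∑ i, ((-4 * B (pDual i) v) • cl (adP X (pBasis i)) +
        (4 * B (adP X (pBasis i)) v) • cl (pDual i))) := by
    simp only [← key, Finset.sum_sub_distrib, ← Finset.sum_mul, ← Finset.mul_sum]
    simp only [alpha, Finset.sum_sub_distrib]
    simp only [neg_mul, mul_neg, smul_mul_assoc, mul_smul_comm]
    module
  rw [h3]
  simp only [mul_smul, Finset.sum_add_distrib, ← Finset.smul_sum, h1, h2]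
  module

/-- The `𝔨`-version of the Dirac operator, `D^𝔨 = ∑ x_i ⊗ α(y_i)` for the basis
`(E, F, H₁ - H₂, H₁ + H₂)` of `𝔨` and its dual `(F, E, (H₁ - H₂)/2, 3 (H₁ + H₂)/2)` with respect
to the trace form. -/
def Dk : UC :=
  u E ⊗ₜ alpha kF + ((1 / 2 : ℂ) • u (H1 - H2)) ⊗ₜ alpha (kH1 - kH2) +
    ((3 / 2 : ℂ) • u (H1 + H2)) ⊗ₜ alpha (kH1 + kH2) + u F ⊗ₜ alpha kE

end

end SU21

/-!
All three parts are instances of one first fundamental theorem for `K`. Under `𝔨 ≅ 𝔤𝔩(2)` the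
generators of the algebras form a `2 × 2` matrix `X` (a basis of `𝔨`), columns `x`, `ξ` (the basis
`E₁, E₂` of `𝔭⁺` in `U(𝔤)` and in `C(𝔭)`) and rows `y`, `η` (the basis `F₁, F₂` of `𝔭⁻`). They
commute or anticommute up to shorter words (`SuperComm`), so an invariant can be analysed one
degree at a time modulo shorter words, and no Poincaré–Birkhoff–Witt theorem is needed.

A central element of `K` of infinite order shows that an invariant is a combination of words with
as many columns as rows (`IsAdjointAction.mem_balanced`). Such words are entries of products of
the matrices `X` and `column * row`, so in leading degree the invariant is the contraction of a
tensor `t` on `(ℂ²)^{⊗ N}` with such entries. The tensor can be chosen equivariant: one takes the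
component orthogonal to the tensors which contract to shorter words (`exists_invariant_lift`), and
differentiates paths in `U(2)` to pass from the group to `𝔤𝔩(2)` (`isEquivariant_of_group`). An
equivariant tensor is `t = C (C⁻¹ t)` for the Casimir element `C`, which is invertible, and moving
one factor of `C` to the other side writes `t` as a sum of contractions of a row index with a
column index (`IsEquivariant.exists_casimir`). Each of these splits off a trace or multiplies two
of the matrices, so by induction on `N` (`pairing_good`) only traces of products remain; by the
Cayley–Hamilton identity for `X` they are polynomials in `tr X`, `tr X²`, `⟨row, column⟩` and
`⟨row, X column⟩` up to shorter words (`trace_wmat_good`). Hence a subalgebra of invariants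
containing these basic contractions contains all invariants (`mem_of_invariant`).

For `C(𝔭)` only `⟨η, ξ⟩ = -(E₁ F₁ + E₂ F₂) - 4` is nonzero, and for `Z(𝔨)`, where the action of
`K` is replaced by commutators (`IsLieAction.mem_of_central`), only `tr X = 3 (H₁ + H₂)` and `tr
X²`. In `U(𝔤) ⊗ C(𝔭)` the Dirac operator is `⟨η, x⟩ + ⟨y, ξ⟩`, and `D^𝔨 = (⟨η, X ξ⟩ + tr X) / 2`
(`Dk_eq`). Commutators with `g̃` separate the two summands of `D`, and their products and
commutators with `⟨η, X ξ⟩` produce the remaining contractions (`DiracRelations.hasContractions`).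
-/

namespace SU21

attribute [local instance 100] LieRing.ofAssociativeRing

/-! ### Tensor powers of the standard representation of `𝔤𝔩(2)` -/

section

/-- Index set of the standard basis of the `N`-th tensor power of `ℂ²`. -/
abbrev Idx (N : ℕ) := Fin N → Fin 2

/-- Complex `2 × 2` matrices. -/
abbrev Mat2 := Matrix (Fin 2) (Fin 2) ℂ

/-- The matrix of `Y₀ ⊗ ⋯ ⊗ Y_{N-1}` on `(ℂ²)^{⊗ N}`. -/
def tens {N : ℕ} (Y : Fin N → Mat2) : Matrix (Idx N) (Idx N) ℂ :=
  Matrix.of fun I J => ∏ k, Y k (I k) (J k)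

theorem tens_mul {N : ℕ} (Y Z : Fin N → Mat2) : tens Y * tens Z = tens (Y * Z) := by
  ext I J
  simp only [tens, Matrix.mul_apply, Matrix.of_apply, Pi.mul_apply]
  rw [Finset.prod_univ_sum, Fintype.piFinset_univ]
  exact Finset.sum_congr rfl fun K _ => Finset.prod_mul_distrib.symm

theorem tens_conjTranspose {N : ℕ} (Y : Fin N → Mat2) : (tens Y)ᴴ = tens fun k => (Y k)ᴴ := by
  ext I J
  simp [tens, Matrix.conjTranspose_apply]

theorem tens_one {N : ℕ} : tens (1 : Fin N → Mat2) = 1 := by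
  ext I J
  simp only [tens, Matrix.of_apply, Pi.one_apply, Matrix.one_apply, funext_iff,
    Finset.prod_ite_zero, Finset.prod_const_one, Finset.mem_univ, forall_true_left]

/-- The matrix `Y` acting on the `p`-th tensor factor. -/
def slot {N : ℕ} (p : Fin N) (Y : Mat2) : Matrix (Idx N) (Idx N) ℂ := tens (Pi.mulSingle p Y)

theorem slot_mul {N : ℕ} (p : Fin N) (Y Z : Mat2) : slot p Y * slot p Z = slot p (Y * Z) := by
  rw [slot, slot, tens_mul, ← Pi.mulSingle_mul]; rfl

theorem slot_comm {N : ℕ} {p q : Fin N} (h : p ≠ q) (Y Z : Mat2) :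
    slot p Y * slot q Z = slot q Z * slot p Y := by
  rw [slot, slot, tens_mul, tens_mul]
  exact congrArg tens (Pi.mulSingle_commute (f := fun _ => Mat2) h Y Z).eq

theorem slot_apply {N : ℕ} (p : Fin N) (Y : Mat2) (I J : Idx N) :
    slot p Y I J = if ∀ k, k ≠ p → I k = J k then Y (I p) (J p) else 0 := by
  simp only [slot, tens, Matrix.of_apply]
  rw [← Finset.mul_prod_erase _ _ (Finset.mem_univ p)]
  have : ∏ k ∈ Finset.univ.erase p, (Pi.mulSingle p Y : Fin N → Mat2) k (I k) (J k) =
      ∏ k ∈ Finset.univ.erase p, if I k = J k then (1 : ℂ) else 0 := by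
    refine Finset.prod_congr rfl fun k hk => ?_
    rw [Pi.mulSingle_eq_of_ne (Finset.ne_of_mem_erase hk), Matrix.one_apply]
  rw [this, Finset.prod_ite_zero, Pi.mulSingle_eq_same]
  simp

/-- The action of `Y ∈ 𝔤𝔩(2)` on `(ℂ²)^{⊗ N}`. -/
def tot (N : ℕ) (Y : Mat2) : Matrix (Idx N) (Idx N) ℂ := ∑ p, slot p Y

theorem slot_add {N : ℕ} (p : Fin N) (Y Z : Mat2) : slot p (Y + Z) = slot p Y + slot p Z := by
  ext I J
  simp only [slot_apply, Matrix.add_apply]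
  split_ifs <;> simp

theorem slot_smul {N : ℕ} (p : Fin N) (c : ℂ) (Y : Mat2) : slot p (c • Y) = c • slot p Y := by
  ext I J
  simp only [slot_apply, Matrix.smul_apply]
  split_ifs <;> simp

theorem tot_add (N : ℕ) (Y Z : Mat2) : tot N (Y + Z) = tot N Y + tot N Z := by
  simp only [tot, slot_add, Finset.sum_add_distrib]

theorem tot_smul (N : ℕ) (c : ℂ) (Y : Mat2) : tot N (c • Y) = c • tot N Y := by
  simp only [tot, slot_smul, Finset.smul_sum]

theorem tot_sub (N : ℕ) (Y Z : Mat2) : tot N (Y - Z) = tot N Y - tot N Z := by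
  rw [sub_eq_add_neg, ← neg_one_smul ℂ Z, tot_add, tot_smul, neg_one_smul, sub_eq_add_neg]

theorem tot_zero (N : ℕ) : tot N 0 = 0 := by
  have := tot_smul N 0 0
  simpa using this

theorem tot_one (N : ℕ) : tot N 1 = (N : ℂ) • 1 := by
  have : ∀ p : Fin N, slot p (1 : Mat2) = 1 := fun p => by
    rw [slot, Pi.mulSingle_one, tens_one]
  simp [tot, this, Nat.cast_smul_eq_nsmul]

theorem tot_conjTranspose (N : ℕ) (Y : Mat2) : (tot N Y)ᴴ = tot N Yᴴ := by
  rw [tot, Matrix.conjTranspose_sum, tot]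
  refine Finset.sum_congr rfl fun p _ => ?_
  rw [slot, tens_conjTranspose, slot]
  congr 1
  ext1 k
  by_cases h : k = p
  · subst h; simp
  · simp [Pi.mulSingle_eq_of_ne h]

theorem tot_lie (N : ℕ) (Y Z : Mat2) :
    tot N Y * tot N Z - tot N Z * tot N Y = tot N (Y * Z - Z * Y) := by
  simp only [tot, Finset.sum_mul_sum]
  rw [Finset.sum_comm (f := fun p q => slot p Z * slot q Y), ← Finset.sum_sub_distrib]
  refine Finset.sum_congr rfl fun p _ => ?_
  rw [← Finset.sum_sub_distrib, Finset.sum_eq_single p]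
  · rw [slot_mul, slot_mul, sub_eq_add_neg, sub_eq_add_neg, slot_add, ← neg_one_smul ℂ (Z * Y),
      slot_smul, neg_one_smul]
  · intro q _ hq
    rw [slot_comm hq, sub_self]
  · simp

/-- The matrix unit `e_{ab}` of size `2`. -/
abbrev mu (a b : Fin 2) : Mat2 := Matrix.single a b 1

/-- The Casimir element of `𝔤𝔩(2)` acting on `(ℂ²)^{⊗ N}`. -/
def casimir (N : ℕ) : Matrix (Idx N) (Idx N) ℂ := ∑ a, ∑ b, tot N (mu a b) * tot N (mu b a)

theorem casimir_comm (N : ℕ) (c d : Fin 2) :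
    casimir N * tot N (mu c d) = tot N (mu c d) * casimir N := by
  have br : ∀ a b, tot N (mu a b) * tot N (mu c d) = tot N (mu c d) * tot N (mu a b) +
      ((if b = c then tot N (mu a d) else 0) - if d = a then tot N (mu c b) else 0) := by
    intro a b
    have h := tot_lie N (mu a b) (mu c d)
    rw [sub_eq_iff_eq_add, tot_sub, add_comm] at h
    rw [h]
    congr 2
    · split_ifs with h
      · subst h; simp
      · rw [Matrix.single_mul_single_of_ne (h := h), tot_zero]
    · split_ifs with h
      · subst h; simp
      · rw [Matrix.single_mul_single_of_ne (h := h), tot_zero]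
  have e : ∀ a b, tot N (mu a b) * tot N (mu b a) * tot N (mu c d) =
      tot N (mu c d) * (tot N (mu a b) * tot N (mu b a)) +
      ((if b = c then tot N (mu a d) * tot N (mu b a) else 0) -
        (if d = a then tot N (mu c b) * tot N (mu b a) else 0) +
      ((if a = c then tot N (mu a b) * tot N (mu b d) else 0) -
        if d = b then tot N (mu a b) * tot N (mu c a) else 0)) := by
    intro a b
    rw [mul_assoc, br, mul_add, ← mul_assoc, br]
    simp only [add_mul, sub_mul, mul_sub, ite_mul, mul_ite, zero_mul, mul_zero, mul_assoc]
    abel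
  simp only [casimir, Finset.sum_mul, Finset.mul_sum, e]
  simp only [Finset.sum_add_distrib, Finset.sum_sub_distrib, Finset.sum_ite_eq,
    Finset.sum_ite_eq', Finset.mem_univ, if_true]
  rw [Finset.sum_comm (f := fun a b => if d = a then tot N (mu c b) * tot N (mu b a) else 0),
    Finset.sum_comm (f := fun a b => if a = c then tot N (mu a b) * tot N (mu b d) else 0)]
  simp

open scoped ComplexOrder in
/-- The Casimir element is invertible on a nontrivial tensor power: it is the sum of the
`Y Yᴴ`, where `Y` runs over the action of the matrix units, and its kernel is killed by the action
of the identity matrix, which is the scalar `N`. -/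
theorem casimir_isUnit {N : ℕ} (hN : N ≠ 0) : IsUnit (casimir N) := by
  rw [← Matrix.mulVec_injective_iff_isUnit]
  refine (injective_iff_map_eq_zero (casimir N).mulVecLin).mpr fun v hv => ?_
  replace hv : casimir N *ᵥ v = 0 := hv
  have h0 : ∑ a, ∑ b, star (tot N (mu b a) *ᵥ v) ⬝ᵥ (tot N (mu b a) *ᵥ v) = 0 := by
    have : star v ⬝ᵥ (casimir N *ᵥ v) = 0 := by rw [hv, dotProduct_zero]
    rw [← this]
    simp only [casimir, Matrix.sum_mulVec, dotProduct_sum]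
    refine Finset.sum_congr rfl fun a _ => Finset.sum_congr rfl fun b _ => ?_
    rw [Matrix.star_mulVec, tot_conjTranspose, ← Matrix.dotProduct_mulVec, Matrix.mulVec_mulVec]
    simp [mu]
  have hnn : ∀ w : Idx N → ℂ, 0 ≤ star w ⬝ᵥ w := fun w => dotProduct_star_self_nonneg w
  have h1 : ∀ a, tot N (mu a a) *ᵥ v = 0 := by
    intro a
    rw [Finset.sum_eq_zero_iff_of_nonneg
      (fun a _ => Finset.sum_nonneg fun b _ => hnn _)] at h0
    have h2 := h0 a (Finset.mem_univ _)
    rw [Finset.sum_eq_zero_iff_of_nonneg (fun b _ => hnn _)] at h2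
    exact dotProduct_star_self_eq_zero.mp (h2 a (Finset.mem_univ _))
  have h2 : tot N 1 *ᵥ v = 0 := by
    have : (1 : Mat2) = mu 0 0 + mu 1 1 := by
      ext i j; fin_cases i <;> fin_cases j <;> simp [mu]
    rw [this, tot_add, Matrix.add_mulVec, h1, h1, add_zero]
  rw [tot_one, Matrix.smul_mulVec, Matrix.one_mulVec] at h2
  exact (smul_eq_zero.mp h2).resolve_left (by exact_mod_cast hN)

/-- `t` is a `𝔤𝔩(2)`-equivariant endomorphism of `(ℂ²)^{⊗ N}`. -/
def IsEquivariant {N : ℕ} (t : Matrix (Idx N) (Idx N) ℂ) : Prop :=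
  ∀ a b, tot N (mu a b) * t = t * tot N (mu a b)

/-- The contraction of the row index of `t` in position `p` with its column index in
position `q`, multiplied by the invariant tensor in these two positions. -/
def contract {N : ℕ} (p q : Fin N) (t : Matrix (Idx N) (Idx N) ℂ) : Matrix (Idx N) (Idx N) ℂ :=
  ∑ a, ∑ b, slot p (mu a b) * t * slot q (mu b a)

/-- Every equivariant endomorphism is a combination of contractions: `t = C (C⁻¹ t)`, and by
equivariance the second factor of the Casimir element `C` can be moved to the other side. -/
theorem IsEquivariant.exists_casimir {N : ℕ} (hN : N ≠ 0) {t : Matrix (Idx N) (Idx N) ℂ}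
    (ht : IsEquivariant t) : ∃ t₁, IsEquivariant t₁ ∧ t = ∑ p, ∑ q, contract p q t₁ := by
  obtain ⟨C, hC⟩ := casimir_isUnit hN
  have h1 : IsEquivariant (((C⁻¹ : _ˣ) : Matrix (Idx N) (Idx N) ℂ) * t) := by
    intro a b
    have : Commute (C : Matrix (Idx N) (Idx N) ℂ) (tot N (mu a b)) := by
      rw [hC]; exact casimir_comm N a b
    rw [← mul_assoc, ← this.units_inv_left.eq, mul_assoc, ht, mul_assoc]
  refine ⟨_, h1, ?_⟩
  have h2 : t = casimir N * (((C⁻¹ : _ˣ) : Matrix (Idx N) (Idx N) ℂ) * t) := by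
    rw [← hC, ← mul_assoc, Units.mul_inv, one_mul]
  generalize (((C⁻¹ : _ˣ) : Matrix (Idx N) (Idx N) ℂ) * t) = t₁ at h1 h2
  rw [h2, casimir]
  unfold contract
  simp only [Finset.sum_mul, mul_assoc, h1 _ _]
  simp only [tot, Finset.sum_mul, Finset.mul_sum]
  rw [Finset.sum_comm (s := Finset.univ (α := Fin N))]
  simp only [Finset.sum_comm (s := Finset.univ (α := Fin N)) (t := Finset.univ (α := Fin 2))]

end

/-! ### Partial traces and permutations of tensors -/

theorem sum_idx_succ {N : ℕ} {M : Type*} [AddCommMonoid M] (f : Idx (N + 1) → M) :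
    ∑ I, f I = ∑ b, ∑ I' : Idx N, f (Fin.cons b I') := by
  rw [← Fintype.sum_prod_type']
  exact ((Fin.consEquiv fun _ : Fin (N + 1) => Fin 2).sum_comp f).symm

theorem slot_succ_cons {N : ℕ} (p : Fin N) (Y : Mat2) (b c : Fin 2) (I J : Idx N) :
    slot p.succ Y (Fin.cons b I) (Fin.cons c J) = if b = c then slot p Y I J else 0 := by
  rw [slot_apply, slot_apply]
  simp only [Fin.forall_fin_succ, Fin.cons_zero, Fin.cons_succ, ne_eq, Fin.succ_inj,
    (Fin.succ_ne_zero p).symm, not_false_eq_true, forall_true_left]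
  split_ifs <;> simp_all

theorem slot_zero_cons {N : ℕ} (Y : Mat2) (b c : Fin 2) (I J : Idx N) :
    slot 0 Y (Fin.cons b I) (Fin.cons c J) = if I = J then Y b c else 0 := by
  rw [slot_apply]
  simp [Fin.forall_fin_succ, funext_iff]

theorem tot_cons {N : ℕ} (Y : Mat2) (b c : Fin 2) (I J : Idx N) :
    tot (N + 1) Y (Fin.cons b I) (Fin.cons c J) =
      (if I = J then Y b c else 0) + if b = c then tot N Y I J else 0 := by
  rw [tot, Fin.sum_univ_succ, Matrix.add_apply, slot_zero_cons, Matrix.sum_apply]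
  simp only [slot_succ_cons, tot, Matrix.sum_apply]
  split_ifs <;> simp

/-- The partial trace over the first tensor factor. -/
def ptr {N : ℕ} (t : Matrix (Idx (N + 1)) (Idx (N + 1)) ℂ) : Matrix (Idx N) (Idx N) ℂ :=
  Matrix.of fun I J => ∑ b, t (Fin.cons b I) (Fin.cons b J)

theorem IsEquivariant.ptr {N : ℕ} {t : Matrix (Idx (N + 1)) (Idx (N + 1)) ℂ}
    (ht : IsEquivariant t) : IsEquivariant (ptr t) := by
  intro a b
  ext I J
  have h : ∀ c, (tot (N + 1) (mu a b) * t) (Fin.cons c I) (Fin.cons c J) =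
    (t * tot (N + 1) (mu a b)) (Fin.cons c I) (Fin.cons c J) := fun c => by rw [ht]
  simp only [Matrix.mul_apply, sum_idx_succ (N := N), tot_cons, add_mul, mul_add, ite_mul,
    mul_ite, zero_mul, mul_zero, Finset.sum_add_distrib, Finset.sum_ite_eq, Finset.sum_ite_eq',
    Finset.mem_univ, if_true] at h
  have h' := Finset.sum_congr (rfl : (Finset.univ : Finset (Fin 2)) = _) fun c _ => h c
  simp only [Finset.sum_add_distrib] at h'
  rw [Finset.sum_comm] at h'
  simp only [mul_comm (mu a b _ _)] at h'
  have h'' := add_left_cancel h'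
  simp only [SU21.ptr, Matrix.mul_apply, Matrix.of_apply, Finset.mul_sum, Finset.sum_mul]
  rw [Finset.sum_comm, Finset.sum_comm (γ := Fin 2)]
  convert h'' using 2 with c _ c _
  · rw [Finset.sum_comm]
    simp
  · rw [Finset.sum_comm]
    simp

theorem slot_mul_apply {N : ℕ} (p : Fin N) (a b : Fin 2) (t : Matrix (Idx N) (Idx N) ℂ)
    (I J : Idx N) :
    (slot p (mu a b) * t) I J = if I p = a then t (Function.update I p b) J else 0 := by
  rw [Matrix.mul_apply, Finset.sum_eq_single (Function.update I p b)]
  · rw [slot_apply]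
    simp +contextual [mu, Matrix.single_apply, eq_comm]
  · intro K _ hK
    rw [slot_apply]
    split_ifs with h
    · have : K p ≠ b := fun h' => hK (by
        ext1 k
        by_cases hk : k = p
        · subst hk; simp [h']
        · simp [hk, h k hk])
      simp [mu, this.symm]
    · simp
  · simp

theorem mul_slot_apply {N : ℕ} (q : Fin N) (a b : Fin 2) (t : Matrix (Idx N) (Idx N) ℂ)
    (I J : Idx N) :
    (t * slot q (mu b a)) I J = if J q = a then t I (Function.update J q b) else 0 := by
  have h := slot_mul_apply q a b tᴴ J I
  rw [slot, ← Matrix.conjTranspose_conjTranspose (tens _ * _), Matrix.conjTranspose_mul,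
    Matrix.conjTranspose_conjTranspose, Matrix.conjTranspose_apply, tens_conjTranspose] at h
  have e : (fun k => ((Pi.mulSingle q (mu a b) : Fin N → Mat2) k)ᴴ) = Pi.mulSingle q (mu b a) := by
    ext1 k
    by_cases hk : k = q
    · subst hk; simp [mu]
    · simp [Pi.mulSingle_eq_of_ne hk]
  rw [e] at h
  rw [slot, ← star_inj, h]
  split_ifs <;> simp [Matrix.conjTranspose_apply]

theorem contract_apply {N : ℕ} (p q : Fin N) (t : Matrix (Idx N) (Idx N) ℂ) (I J : Idx N) :
    contract p q t I J =
      if I p = J q then ∑ b, t (Function.update I p b) (Function.update J q b) else 0 := by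
  simp only [contract, Matrix.sum_apply, mul_slot_apply, slot_mul_apply]
  rw [Finset.sum_comm]
  simp only [← ite_and]
  split_ifs with h
  · refine Finset.sum_congr rfl fun b _ => ?_
    rw [Finset.sum_eq_single (J q)] <;> simp +contextual [h, eq_comm]
  · refine Finset.sum_eq_zero fun b _ => Finset.sum_eq_zero fun a _ => if_neg ?_
    rintro ⟨rfl, h'⟩
    exact h h'

/-- Permutation of the positions of a multi-index. -/
def permIdx {N : ℕ} (σ : Equiv.Perm (Fin N)) : Equiv.Perm (Idx N) where
  toFun I := I ∘ σ
  invFun I := I ∘ σ.symm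
  left_inv I := by ext; simp
  right_inv I := by ext; simp

theorem slot_permIdx {N : ℕ} (σ : Equiv.Perm (Fin N)) (p : Fin N) (Y : Mat2) :
    (slot p Y).submatrix (permIdx σ) (permIdx σ) = slot (σ p) Y := by
  ext I J
  simp only [Matrix.submatrix_apply, slot_apply, permIdx, Equiv.coe_fn_mk, Function.comp]
  congr 1
  rw [← σ.forall_congr_right (q := fun k => k ≠ σ p → I k = J k)]
  simp

theorem tot_permIdx {N : ℕ} (σ : Equiv.Perm (Fin N)) (Y : Mat2) :
    (tot N Y).submatrix (permIdx σ) (permIdx σ) = tot N Y := by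
  have h : (tot N Y).submatrix (permIdx σ) (permIdx σ) =
      ∑ p, (slot p Y).submatrix (permIdx σ) (permIdx σ) := by
    ext I J
    simp [tot, Matrix.sum_apply]
  simp only [h, slot_permIdx]
  exact Equiv.sum_comp σ fun p => slot p Y

theorem IsEquivariant.submatrix {N : ℕ} {t : Matrix (Idx N) (Idx N) ℂ} (ht : IsEquivariant t)
    (σ τ : Equiv.Perm (Fin N)) : IsEquivariant (t.submatrix (permIdx σ) (permIdx τ)) := by
  intro a b
  nth_rw 1 [← tot_permIdx σ]
  nth_rw 2 [← tot_permIdx τ]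
  rw [Matrix.submatrix_mul_equiv, Matrix.submatrix_mul_equiv, ht]

theorem contract_submatrix {N : ℕ} (σ : Equiv.Perm (Fin N)) (p q : Fin N)
    (t : Matrix (Idx N) (Idx N) ℂ) :
    (contract p q t).submatrix (permIdx σ) (permIdx σ) =
      contract (σ p) (σ q) (t.submatrix (permIdx σ) (permIdx σ)) := by
  have : ∀ a b, slot (σ p) (mu a b) * t.submatrix (permIdx σ) (permIdx σ) * slot (σ q) (mu b a) =
      (slot p (mu a b) * t * slot q (mu b a)).submatrix (permIdx σ) (permIdx σ) := by
    intro a b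
    rw [← slot_permIdx, ← slot_permIdx, Matrix.submatrix_mul_equiv, Matrix.submatrix_mul_equiv]
  unfold contract
  simp only [this]
  ext I J
  simp only [Matrix.submatrix_apply, Matrix.sum_apply]

/-! ### Words in supercommuting generators -/

section

/-- Labels for the generators: `X i j` for the basis of `𝔨 ≅ 𝔤𝔩(2)`, and `col s i`, `row s i` for
the bases of `𝔭⁺` and `𝔭⁻`, inside the enveloping algebra for `s = false` and inside the Clifford
algebra for `s = true`. -/
inductive Gen
  | X (i j : Fin 2)
  | col (s : Bool) (i : Fin 2)
  | row (s : Bool) (i : Fin 2)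

/-- The parity of a generator: `1` for the generators of the Clifford algebra. -/
def Gen.odd : Gen → ℕ
  | X _ _ => 0
  | col s _ => s.toNat
  | row s _ => s.toNat

/-- The charge of a generator, its weight under the center of `𝔨`. -/
def Gen.charge : Gen → ℤ
  | X _ _ => 0
  | col _ _ => 1
  | row _ _ => -1

variable {R : Type*} [Ring R] (val : Gen → R)

/-- The product of the values of a word in the generators. -/
def wprod (l : List Gen) : R := (l.map val).prod

theorem wprod_append (l l' : List Gen) : wprod val (l ++ l') = wprod val l * wprod val l' := by
  simp [wprod]

variable [Algebra ℂ R]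

/-- The number of odd letters of a word. -/
def wodd (l : List Gen) : ℕ := (l.map Gen.odd).sum

/-- The total charge of a word. -/
def wcharge (l : List Gen) : ℤ := (l.map Gen.charge).sum

/-- The span of the words of length less than `n`. -/
def Low (n : ℕ) : Submodule ℂ R :=
  Submodule.span ℂ {x | ∃ l : List Gen, l.length < n ∧ wprod val l = x}

/-- The span of the words of length `d` with `p` odd letters. -/
def Hom (d p : ℕ) : Submodule ℂ R :=
  Submodule.span ℂ {x | ∃ l : List Gen, l.length = d ∧ wodd l = p ∧ wprod val l = x}

variable {val}

theorem wprod_mem_low {l : List Gen} {n : ℕ} (h : l.length < n) : wprod val l ∈ Low val n :=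
  Submodule.subset_span ⟨l, h, rfl⟩

theorem wprod_mem_hom (l : List Gen) : wprod val l ∈ Hom val l.length (wodd l) :=
  Submodule.subset_span ⟨l, rfl, rfl, rfl⟩

theorem val_mem_hom (g : Gen) : val g ∈ Hom val 1 g.odd := by
  simpa [wprod, wodd] using wprod_mem_hom (val := val) [g]

theorem X_mem_hom (i j : Fin 2) : val (.X i j) ∈ Hom val 1 0 := val_mem_hom (val := val) (.X i j)

theorem col_mem_hom (s : Bool) (i : Fin 2) : val (.col s i) ∈ Hom val 1 s.toNat :=
  val_mem_hom (val := val) (.col s i)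

theorem row_mem_hom (s : Bool) (i : Fin 2) : val (.row s i) ∈ Hom val 1 s.toNat :=
  val_mem_hom (val := val) (.row s i)

theorem low_mono {m n : ℕ} (h : m ≤ n) : Low val m ≤ Low val n :=
  Submodule.span_mono fun _ ⟨l, hl, hx⟩ => ⟨l, hl.trans_le h, hx⟩

theorem hom_le_low {d p n : ℕ} (h : d < n) : Hom val d p ≤ Low val n :=
  Submodule.span_mono fun _ ⟨l, hl, _, hx⟩ => ⟨l, hl ▸ h, hx⟩

theorem low_mul_low {a b n : ℕ} {x y : R} (hx : x ∈ Low val (a + 1)) (hy : y ∈ Low val b)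
    (h : a + b = n := by omega) : x * y ∈ Low val n := by
  have h := Submodule.mul_mem_mul hx hy
  rw [Low, Low, Submodule.span_mul_span] at h
  refine Submodule.span_mono ?_ h
  rintro _ ⟨_, ⟨l, hl, rfl⟩, _, ⟨l', hl', rfl⟩, rfl⟩
  exact ⟨l ++ l', by simp; omega, wprod_append _ _ _⟩

theorem low_mul_low' {a b n : ℕ} {x y : R} (hx : x ∈ Low val a) (hy : y ∈ Low val (b + 1))
    (h : a + b = n := by omega) : x * y ∈ Low val n := by
  have h := Submodule.mul_mem_mul hx hy
  rw [Low, Low, Submodule.span_mul_span] at h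
  refine Submodule.span_mono ?_ h
  rintro _ ⟨_, ⟨l, hl, rfl⟩, _, ⟨l', hl', rfl⟩, rfl⟩
  exact ⟨l ++ l', by simp; omega, wprod_append _ _ _⟩

theorem hom_mul_low {a b p n : ℕ} {x y : R} (hx : x ∈ Hom val a p) (hy : y ∈ Low val b)
    (h : a + b = n := by omega) : x * y ∈ Low val n :=
  low_mul_low (hom_le_low a.lt_succ_self hx) hy h

theorem low_mul_hom {a b p n : ℕ} {x y : R} (hx : x ∈ Low val a) (hy : y ∈ Hom val b p)
    (h : a + b = n := by omega) : x * y ∈ Low val n :=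
  low_mul_low' hx (hom_le_low b.lt_succ_self hy) h

theorem hom_mul_hom {d p d' p' n q : ℕ} {x y : R} (hx : x ∈ Hom val d p) (hy : y ∈ Hom val d' p')
    (hn : d + d' = n := by rfl) (hq : p + p' = q := by rfl) : x * y ∈ Hom val n q := by
  have h := Submodule.mul_mem_mul hx hy
  rw [Hom, Hom, Submodule.span_mul_span] at h
  refine Submodule.span_mono ?_ h
  rintro _ ⟨_, ⟨l, hl, hp, rfl⟩, _, ⟨l', hl', hp', rfl⟩, rfl⟩
  exact ⟨l ++ l', by simp [hl, hl', hn], by simp [wodd, ← hp, ← hp', ← hq], wprod_append _ _ _⟩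

theorem one_mem_hom : (1 : R) ∈ Hom val 0 0 := by
  simpa [wprod, wodd] using wprod_mem_hom (val := val) []

variable (val) in
/-- The generators supercommute up to words of length at most one. -/
def SuperComm : Prop :=
  ∀ g h : Gen, val g * val h - (-1 : ℂ) ^ (g.odd * h.odd) • (val h * val g) ∈ Low val 2

/-- Homogeneous elements supercommute up to shorter words. -/
theorem SuperComm.hom_comm (hc : SuperComm val) {d p d' p' n : ℕ} {x y : R} (hx : x ∈ Hom val d p)
    (hy : y ∈ Hom val d' p') (hn : d + d' = n := by rfl) :
    x * y - (-1 : ℂ) ^ (p * p') • (y * x) ∈ Low val n := by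
  subst hn
  have h1 : ∀ (g : Gen) (l : List Gen), val g * wprod val l -
      (-1 : ℂ) ^ (g.odd * wodd l) • (wprod val l * val g) ∈ Low val (l.length + 1) := by
    intro g l
    induction l with
    | nil => simp [wprod, wodd]
    | cons k l ih =>
      have e : val g * wprod val (k :: l) -
          (-1 : ℂ) ^ (g.odd * wodd (k :: l)) • (wprod val (k :: l) * val g) =
          (val g * val k - (-1 : ℂ) ^ (g.odd * k.odd) • (val k * val g)) * wprod val l +
          (-1 : ℂ) ^ (g.odd * k.odd) • (val k * (val g * wprod val l -
            (-1 : ℂ) ^ (g.odd * wodd l) • (wprod val l * val g))) := by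
        simp only [wprod, wodd, List.map_cons, List.prod_cons, List.sum_cons, mul_add, pow_add,
          sub_mul, mul_sub, smul_sub, mul_smul_comm, smul_mul_assoc, mul_assoc, mul_smul]
        abel
      rw [e, List.length_cons]
      refine add_mem ?_ (Submodule.smul_mem _ _ ?_)
      · exact low_mul_hom (hc g k) (wprod_mem_hom l)
      · exact hom_mul_low (val_mem_hom k) ih
  have h2 : ∀ l l' : List Gen, wprod val l * wprod val l' -
      (-1 : ℂ) ^ (wodd l * wodd l') • (wprod val l' * wprod val l) ∈
        Low val (l.length + l'.length) := by
    intro l l'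
    induction l with
    | nil => simp [wprod, wodd]
    | cons k l ih =>
      have e : wprod val (k :: l) * wprod val l' -
          (-1 : ℂ) ^ (wodd (k :: l) * wodd l') • (wprod val l' * wprod val (k :: l)) =
          val k * (wprod val l * wprod val l' -
            (-1 : ℂ) ^ (wodd l * wodd l') • (wprod val l' * wprod val l)) +
          (-1 : ℂ) ^ (wodd l * wodd l') • ((val k * wprod val l' -
            (-1 : ℂ) ^ (k.odd * wodd l') • (wprod val l' * val k)) * wprod val l) := by
        have : wodd (k :: l) * wodd l' = wodd l * wodd l' + k.odd * wodd l' := by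
          simp [wodd]; ring
        rw [this]
        simp only [wprod, List.map_cons, List.prod_cons, pow_add,
          sub_mul, mul_sub, smul_sub, mul_smul_comm, smul_mul_assoc, mul_assoc, mul_smul]
        abel
      rw [e, List.length_cons]
      refine add_mem ?_ (Submodule.smul_mem _ _ ?_)
      · exact hom_mul_low (val_mem_hom k) ih
      · exact low_mul_hom (h1 k l') (wprod_mem_hom l)
  induction hx using Submodule.span_induction with
  | zero => simp
  | add x x' _ _ hx hx' =>
    convert add_mem hx hx' using 1
    simp only [add_mul, mul_add, smul_add]; abel
  | smul c x _ hx =>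
    convert Submodule.smul_mem _ c hx using 1
    rw [smul_mul_assoc, mul_smul_comm, smul_sub, smul_comm]
  | mem x hx =>
    obtain ⟨l, rfl, rfl, rfl⟩ := hx
    induction hy using Submodule.span_induction with
    | zero => simp
    | add x x' _ _ hx hx' =>
      convert add_mem hx hx' using 1
      simp only [add_mul, mul_add, smul_add]; abel
    | smul c x _ hx =>
      convert Submodule.smul_mem _ c hx using 1
      rw [smul_mul_assoc, mul_smul_comm, smul_sub, smul_comm]
    | mem x hx =>
      obtain ⟨l', rfl, rfl, rfl⟩ := hx
      exact h2 l l'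

theorem prod_mem_hom {κ : Type*} {dg pr : κ → ℕ} {f : κ → R} (hf : ∀ k, f k ∈ Hom val (dg k) (pr k))
    (l : List κ) : (l.map f).prod ∈ Hom val (l.map dg).sum (l.map pr).sum := by
  induction l with
  | nil => simpa using one_mem_hom
  | cons k l ih => simpa using hom_mul_hom (hf k) ih

/-- Permuting homogeneous factors changes a product by a sign, up to shorter words; the sign does
not depend on the factors but only on their parities. -/
theorem SuperComm.perm (hc : SuperComm val) {κ : Type*} (dg pr : κ → ℕ) {l₁ l₂ : List κ}
    (h : l₁.Perm l₂) : ∃ s : ℂ, ∀ f : κ → R, (∀ k, f k ∈ Hom val (dg k) (pr k)) →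
      (l₁.map f).prod - s • (l₂.map f).prod ∈ Low val (l₁.map dg).sum := by
  induction h with
  | nil => exact ⟨1, by simp⟩
  | @cons k l₁ l₂ _ ih =>
    obtain ⟨s, hs⟩ := ih
    refine ⟨s, fun f hf => ?_⟩
    have := hom_mul_low (hf k) (hs f hf) rfl
    simpa [mul_sub] using this
  | swap x y l =>
    refine ⟨(-1) ^ (pr y * pr x), fun f hf => ?_⟩
    have := low_mul_hom (hc.hom_comm (hf y) (hf x)) (prod_mem_hom hf l) rfl
    simpa [sub_mul, mul_assoc, add_assoc] using this
  | @trans l₁ l₂ l₃ h₁ _ ih₁ ih₂ =>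
    obtain ⟨s, hs⟩ := ih₁
    obtain ⟨s', hs'⟩ := ih₂
    refine ⟨s * s', fun f hf => ?_⟩
    have h2 := hs' f hf
    rw [← (h₁.map dg).sum_eq] at h2
    convert add_mem (hs f hf) (Submodule.smul_mem _ s h2) using 1
    rw [smul_sub, mul_smul]; abel

end

/-! ### Traces of products of basic matrices -/

section

variable {R : Type*} [Ring R] {val : Gen → R}

/-- The types of the basic `2 × 2` matrices over `R` on which `K` acts by conjugation: the matrix
`X` of generators of `𝔨`, and the products of a column and a row. -/
inductive Letter
  | X
  | pair (c r : Bool)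

/-- The degree of the entries of a basic matrix. -/
def Letter.deg : Letter → ℕ
  | X => 1
  | pair _ _ => 2

/-- The parity of the entries of a basic matrix. -/
def Letter.odd : Letter → ℕ
  | X => 0
  | pair c r => c.toNat + r.toNat

variable (val) in
/-- The basic matrix of a given type. -/
def lmat : Letter → Matrix (Fin 2) (Fin 2) R
  | .X => Matrix.of fun i j => val (.X i j)
  | .pair c r => Matrix.of fun i j => val (.col c i) * val (.row r j)

variable (val) in
/-- A product of basic matrices. -/
def wmat (w : List Letter) : Matrix (Fin 2) (Fin 2) R := (w.map (lmat val)).prod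

/-- The degree of the entries of a product of basic matrices. -/
def wdeg (w : List Letter) : ℕ := (w.map Letter.deg).sum

/-- The parity of the entries of a product of basic matrices. -/
def wpar (w : List Letter) : ℕ := (w.map Letter.odd).sum

theorem wmat_append (v w : List Letter) : wmat val (v ++ w) = wmat val v * wmat val w := by
  simp [wmat]

theorem wmat_cons (a : Letter) (w : List Letter) : wmat val (a :: w) = lmat val a * wmat val w := by
  simp [wmat]

theorem wdeg_append (v w : List Letter) : wdeg (v ++ w) = wdeg v + wdeg w := by
  simp [wdeg]

theorem wdeg_cons (a : Letter) (w : List Letter) : wdeg (a :: w) = a.deg + wdeg w := by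
  simp [wdeg]

variable [Algebra ℂ R]

theorem lmat_mem_hom (a : Letter) (i j : Fin 2) : lmat val a i j ∈ Hom val a.deg a.odd := by
  cases a with
  | X => exact X_mem_hom i j
  | pair c r => exact hom_mul_hom (val := val) (col_mem_hom c i) (row_mem_hom r j)

theorem wmat_mem_hom (w : List Letter) (i j : Fin 2) :
    wmat val w i j ∈ Hom val (wdeg w) (wpar w) := by
  induction w generalizing i with
  | nil =>
    simp only [wmat, wdeg, wpar, List.map_nil, List.prod_nil, List.sum_nil, Matrix.one_apply]
    split_ifs
    exacts [one_mem_hom, zero_mem _]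
  | cons a w ih =>
    rw [wmat_cons, Matrix.mul_apply]
    refine Submodule.sum_mem _ fun k _ => ?_
    simpa [wdeg, wpar] using hom_mul_hom (lmat_mem_hom a i k) (ih k)

variable (val) in
/-- The elements of degree at most `d` which lie in the subalgebra `A` up to elements of lower
degree. -/
def Good (A : Subalgebra ℂ R) (d : ℕ) : Submodule ℂ R :=
  (Subalgebra.toSubmodule A ⊓ Low val (d + 1)) ⊔ Low val d

variable {A : Subalgebra ℂ R}

theorem low_le_good {d : ℕ} : Low val d ≤ Good val A d := le_sup_right

theorem good_le_low {d : ℕ} : Good val A d ≤ Low val (d + 1) :=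
  sup_le inf_le_right (low_mono d.le_succ)

theorem mem_good {x : R} {d : ℕ} (h : x ∈ A) (h' : x ∈ Low val (d + 1)) : x ∈ Good val A d :=
  Submodule.mem_sup_left ⟨h, h'⟩

theorem good_of_sub_mem {x y : R} {d : ℕ} (h : x - y ∈ Low val d) (hy : y ∈ Good val A d) :
    x ∈ Good val A d := by
  simpa using add_mem (low_le_good h) hy

theorem good_mul_good {a b : ℕ} {x y : R} (hx : x ∈ Good val A a) (hy : y ∈ Good val A b) :
    x * y ∈ Good val A (a + b) := by
  obtain ⟨x₁, ⟨hx₁, hx₂⟩, x₃, hx₃, rfl⟩ := Submodule.mem_sup.mp hx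
  obtain ⟨y₁, ⟨hy₁, hy₂⟩, y₃, hy₃, rfl⟩ := Submodule.mem_sup.mp hy
  have e : (x₁ + x₃) * (y₁ + y₃) = x₁ * y₁ + (x₁ * y₃ + x₃ * (y₁ + y₃)) := by
    noncomm_ring
  rw [e]
  refine Submodule.add_mem_sup ⟨A.mul_mem hx₁ hy₁, by
      exact low_mul_low hx₂ hy₂⟩
    (add_mem (low_mul_low hx₂ hy₃) (low_mul_low' hx₃ (good_le_low hy)))

variable (val) in
/-- The trace of the matrix `X`. -/
def trX : R := ∑ i, val (.X i i)

variable (val) in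
/-- The trace of the matrix `X * X`. -/
def trXX : R := ∑ i, ∑ j, val (.X i j) * val (.X j i)

variable (val) in
/-- The contraction of a row and a column. -/
def rowCol (r c : Bool) : R := ∑ i, val (.row r i) * val (.col c i)

variable (val) in
/-- The contraction of a row, the matrix `X` and a column. -/
def rowXCol (r c : Bool) : R := ∑ i, ∑ j, val (.row r i) * val (.X i j) * val (.col c j)

variable (val) in
/-- The subalgebra `A` contains the basic contractions of the generators. -/
structure HasContractions (A : Subalgebra ℂ R) : Prop where
  trX : trX val ∈ A
  trXX : trXX val ∈ A
  rowCol : ∀ r c, rowCol val r c ∈ A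
  rowXCol : ∀ r c, rowXCol val r c ∈ A

theorem trX_mem_hom : trX val ∈ Hom val 1 0 :=
  Submodule.sum_mem _ fun i _ => X_mem_hom i i

theorem trXX_mem_hom : trXX val ∈ Hom val 2 0 :=
  Submodule.sum_mem _ fun i _ => Submodule.sum_mem _ fun j _ =>
    hom_mul_hom (X_mem_hom i j) (X_mem_hom j i)

theorem rowCol_mem_hom (r c : Bool) : rowCol val r c ∈ Hom val 2 (r.toNat + c.toNat) :=
  Submodule.sum_mem _ fun i _ => hom_mul_hom (row_mem_hom r i) (col_mem_hom c i)

theorem rowXCol_mem_hom (r c : Bool) : rowXCol val r c ∈ Hom val 3 (r.toNat + 0 + c.toNat) :=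
  Submodule.sum_mem _ fun i _ => Submodule.sum_mem _ fun j _ =>
    hom_mul_hom (hom_mul_hom (row_mem_hom r i) (X_mem_hom i j)) (col_mem_hom c j)

variable (val) in
/-- The determinant of the matrix `X`, up to terms of lower degree. -/
noncomputable def detX : R := (1 / 2 : ℂ) • (trX val * trX val - trXX val)

theorem detX_mem_hom : detX val ∈ Hom val 2 0 :=
  Submodule.smul_mem _ _ (sub_mem (hom_mul_hom trX_mem_hom trX_mem_hom) trXX_mem_hom)

theorem HasContractions.trX_good (hA : HasContractions val A) : SU21.trX val ∈ Good val A 1 :=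
  mem_good hA.trX (hom_le_low one_lt_two trX_mem_hom)

theorem HasContractions.detX_good (hA : HasContractions val A) : detX val ∈ Good val A 2 :=
  mem_good (A.smul_mem (A.sub_mem (A.mul_mem hA.trX hA.trX) hA.trXX) _)
    (hom_le_low (by norm_num) detX_mem_hom)

theorem HasContractions.rowCol_good (hA : HasContractions val A) (r c : Bool) :
    SU21.rowCol val r c ∈ Good val A 2 :=
  mem_good (hA.rowCol r c) (hom_le_low (by norm_num) (rowCol_mem_hom r c))

theorem HasContractions.rowXCol_good (hA : HasContractions val A) (r c : Bool) :
    SU21.rowXCol val r c ∈ Good val A 3 :=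
  mem_good (hA.rowXCol r c) (hom_le_low (by norm_num) (rowXCol_mem_hom r c))

/-- The Cayley–Hamilton identity for `X`, up to terms of lower degree. -/
theorem SuperComm.cayley_hamilton (hc : SuperComm val) (i j : Fin 2) :
    ∑ k, val (.X i k) * val (.X k j) -
      (trX val * val (.X i j) - if i = j then detX val else 0) ∈ Low val 2 := by
  have h : ∀ i j k l, val (.X i j) * val (.X k l) - val (.X k l) * val (.X i j) ∈ Low val 2 := by
    intro i j k l
    simpa [Gen.odd] using hc (.X i j) (.X k l)
  fin_cases i <;> fin_cases j <;>
    simp only [trX, detX, trXX, Fin.sum_univ_two, Fin.zero_eta, Fin.mk_one, if_true, if_false,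
      one_ne_zero, zero_ne_one, sub_zero]
  · convert add_mem (Submodule.smul_mem _ (1 / 2 : ℂ) (h 0 1 1 0))
      (Submodule.smul_mem _ (1 / 2 : ℂ) (h 0 0 1 1)) using 1
    simp only [mul_add, add_mul]
    module
  · convert h 0 1 1 1 using 1
    noncomm_ring
  · convert h 1 0 0 0 using 1
    noncomm_ring
  · convert add_mem (Submodule.smul_mem _ (1 / 2 : ℂ) (h 1 0 0 1))
      (Submodule.smul_mem _ (1 / 2 : ℂ) (h 1 1 0 0)) using 1
    simp only [mul_add, add_mul]
    module

variable (val A) in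
/-- Row vectors which, up to terms of lower degree, are combinations of the rows `r` and `r X` with
coefficients in `A`. -/
inductive GoodRow : ℕ → (Fin 2 → R) → Prop
  | row (s : Bool) {d : ℕ} {a : R} (ha : a ∈ Good val A d) :
      GoodRow (d + 1) fun j => a * val (.row s j)
  | rowX (s : Bool) {d : ℕ} {a : R} (ha : a ∈ Good val A d) :
      GoodRow (d + 2) fun j => a * ∑ k, val (.row s k) * val (.X k j)
  | low {d : ℕ} {v : Fin 2 → R} (hv : ∀ j, v j ∈ Low val d) : GoodRow d v
  | add {d : ℕ} {v w : Fin 2 → R} (hv : GoodRow d v) (hw : GoodRow d w) : GoodRow d (v + w)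

theorem GoodRow.vecMul_X (hc : SuperComm val) (hA : HasContractions val A) {d : ℕ}
    {v : Fin 2 → R} (hv : GoodRow val A d v) : GoodRow val A (d + 1) (v ᵥ* lmat val .X) := by
  induction hv with
  | @row s d a ha =>
    convert GoodRow.rowX s ha using 1
    ext j
    simp only [Matrix.vecMul, dotProduct, lmat, Finset.mul_sum, mul_assoc, Matrix.of_apply]
  | @low d v hv =>
    refine GoodRow.low fun j => ?_
    simp only [Matrix.vecMul, dotProduct]
    exact Submodule.sum_mem _ fun k _ => low_mul_hom (hv k) (lmat_mem_hom .X k j) rfl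
  | add _ _ hv hw => rw [Matrix.add_vecMul]; exact hv.add hw
  | @rowX s d a ha =>
    have h1 := GoodRow.rowX s (good_mul_good ha hA.trX_good)
    have h2 := GoodRow.row s (good_mul_good ha ((Submodule.neg_mem_iff _).mpr hA.detX_good))
    -- Cayley–Hamilton: `r X² = tr X • r X - det X • r`, where the coefficients commute with `r`
    have key : ∀ j, ∑ k, val (.row s k) * (∑ l, val (.X k l) * val (.X l j)) -
        (trX val * (∑ k, val (.row s k) * val (.X k j)) - detX val * val (.row s j)) ∈
        Low val 3 := by
      intro j
      have e1 : ∀ k, val (.row s k) * (∑ l, val (.X k l) * val (.X l j) -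
        (trX val * val (.X k j) - if k = j then detX val else 0)) ∈ Low val 3 := fun k =>
        hom_mul_low (row_mem_hom s k) (hc.cayley_hamilton k j)
      have e2 : ∀ k, (val (.row s k) * trX val - trX val * val (.row s k)) * val (.X k j) ∈
          Low val 3 := fun k => by
        have := hc.hom_comm (row_mem_hom s k) trX_mem_hom rfl
        rw [mul_zero, pow_zero, one_smul] at this
        exact low_mul_hom this (X_mem_hom k j)
      have e3 : val (.row s j) * detX val - detX val * val (.row s j) ∈ Low val 3 := by
        have := hc.hom_comm (row_mem_hom s j) detX_mem_hom rfl
        rwa [mul_zero, pow_zero, one_smul] at this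
      have e4 := sub_mem (sum_mem fun k (_ : k ∈ Finset.univ) => add_mem (e1 k) (e2 k)) e3
      convert e4 using 1
      simp only [mul_sub, sub_mul, Finset.sum_add_distrib, Finset.sum_sub_distrib, mul_ite,
        mul_zero, Finset.sum_ite_eq', Finset.mem_univ, if_true, Finset.mul_sum, mul_assoc]
      abel
    have h3 : GoodRow val A (d + 2 + 1) fun j => a * (∑ k, val (.row s k) *
        (∑ l, val (.X k l) * val (.X l j)) -
        (trX val * (∑ k, val (.row s k) * val (.X k j)) - detX val * val (.row s j))) :=
      GoodRow.low fun j => low_mul_low (good_le_low ha) (key j)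
    convert h3.add (h1.add h2) using 1
    ext j
    simp only [Matrix.vecMul, dotProduct, lmat, Matrix.of_apply, Pi.add_apply, Finset.mul_sum,
      Finset.sum_mul, mul_sub, mul_neg, neg_mul, mul_assoc]
    rw [Finset.sum_comm]
    abel

theorem GoodRow.vecMul_pair (hA : HasContractions val A) (c r : Bool) {d : ℕ} {v : Fin 2 → R}
    (hv : GoodRow val A d v) : GoodRow val A (d + 2) (v ᵥ* lmat val (.pair c r)) := by
  induction hv with
  | @row s d a ha =>
    convert GoodRow.row r (good_mul_good ha (hA.rowCol_good s c)) using 1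
    ext j
    simp only [Matrix.vecMul, dotProduct, lmat, rowCol, Finset.mul_sum, Finset.sum_mul, mul_assoc,
      Matrix.of_apply]
  | @rowX s d a ha =>
    convert GoodRow.row r (good_mul_good ha (hA.rowXCol_good s c)) using 1
    ext j
    simp only [Matrix.vecMul, dotProduct, lmat, rowXCol, Finset.mul_sum, Finset.sum_mul, mul_assoc,
      Matrix.of_apply]
    rw [Finset.sum_comm]
  | @low d v hv =>
    refine GoodRow.low fun j => ?_
    simp only [Matrix.vecMul, dotProduct]
    exact Submodule.sum_mem _ fun k _ =>
      low_mul_hom (hv k) (lmat_mem_hom (.pair c r) k j) rfl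
  | add _ _ hv hw => rw [Matrix.add_vecMul]; exact hv.add hw

theorem GoodRow.vecMul_wmat (hc : SuperComm val) (hA : HasContractions val A) (w : List Letter)
    {d : ℕ} {v : Fin 2 → R} (hv : GoodRow val A d v) :
    GoodRow val A (d + wdeg w) (v ᵥ* wmat val w) := by
  induction w generalizing d v with
  | nil => simpa [wmat, wdeg] using hv
  | cons a w ih =>
    rw [wmat_cons, ← Matrix.vecMul_vecMul, wdeg_cons, ← add_assoc]
    cases a with
    | X => exact ih (hv.vecMul_X hc hA)
    | pair c r => exact ih (hv.vecMul_pair hA c r)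

theorem GoodRow.sum_mul_col (hA : HasContractions val A) (c : Bool) {d : ℕ} {v : Fin 2 → R}
    (hv : GoodRow val A d v) : ∑ j, v j * val (.col c j) ∈ Good val A (d + 1) := by
  induction hv with
  | @row s d a ha =>
    convert good_mul_good ha (hA.rowCol_good s c) using 1
    simp only [rowCol, Finset.mul_sum, mul_assoc]
  | @rowX s d a ha =>
    convert good_mul_good ha (hA.rowXCol_good s c) using 1
    simp only [rowXCol, Finset.mul_sum, Finset.sum_mul, mul_assoc]
    rw [Finset.sum_comm]
  | low hv =>
    exact low_le_good (Submodule.sum_mem _ fun k _ =>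
      low_mul_hom (hv k) (col_mem_hom c k))
  | add _ _ hv hw => simpa [add_mul, Finset.sum_add_distrib] using add_mem hv hw

variable (val A) in
/-- Matrices which, up to terms of lower degree, are combinations of `1` and `X` with coefficients
in `A`. -/
inductive GoodMat : ℕ → Matrix (Fin 2) (Fin 2) R → Prop
  | one {d : ℕ} {a : R} (ha : a ∈ Good val A d) :
      GoodMat d (Matrix.of fun i j => if i = j then a else 0)
  | X {d : ℕ} {a : R} (ha : a ∈ Good val A d) :
      GoodMat (d + 1) (Matrix.of fun i j => a * val (.X i j))
  | low {d : ℕ} {M : Matrix (Fin 2) (Fin 2) R} (hM : ∀ i j, M i j ∈ Low val d) : GoodMat d M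
  | add {d : ℕ} {M M' : Matrix (Fin 2) (Fin 2) R} (hM : GoodMat d M) (hM' : GoodMat d M') :
      GoodMat d (M + M')

theorem GoodMat.mul_X (hc : SuperComm val) (hA : HasContractions val A) {d : ℕ}
    {M : Matrix (Fin 2) (Fin 2) R} (hM : GoodMat val A d M) :
    GoodMat val A (d + 1) (M * lmat val .X) := by
  induction hM with
  | @one d a ha =>
    convert GoodMat.X ha using 1
    ext i j
    simp [Matrix.mul_apply, lmat]
  | @low d M hM =>
    refine GoodMat.low fun i j => ?_
    rw [Matrix.mul_apply]
    exact Submodule.sum_mem _ fun k _ => low_mul_hom (hM i k) (lmat_mem_hom .X k j) rfl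
  | add _ _ hv hw => rw [Matrix.add_mul]; exact hv.add hw
  | @X d a ha =>
    have h1 := GoodMat.X (good_mul_good ha hA.trX_good)
    have h2 := GoodMat.one (good_mul_good ha ((Submodule.neg_mem_iff _).mpr hA.detX_good))
    have h3 : GoodMat val A (d + 1 + 1) (Matrix.of fun i j =>
        a * (∑ k, val (.X i k) * val (.X k j) -
      (trX val * val (.X i j) - if i = j then detX val else 0))) :=
      GoodMat.low fun i j => low_mul_low (good_le_low ha) (hc.cayley_hamilton i j)
    convert h3.add (h1.add h2) using 1
    ext i j
    simp only [Matrix.mul_apply, lmat, Matrix.of_apply, Matrix.add_apply, Finset.mul_sum,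
      mul_sub, mul_neg, mul_assoc]
    split_ifs
    · abel
    · simp

theorem GoodMat.trace (hA : HasContractions val A) {d : ℕ}
    {M : Matrix (Fin 2) (Fin 2) R} (hM : GoodMat val A d M) : M.trace ∈ Good val A d := by
  induction hM with
  | one ha => simpa [Matrix.trace, two_mul] using add_mem ha ha
  | X ha =>
    convert good_mul_good ha hA.trX_good using 1
    simp only [Matrix.trace, SU21.trX, Finset.mul_sum, Matrix.diag_apply, Matrix.of_apply]
  | low hM => exact low_le_good (Submodule.sum_mem _ fun i _ => hM i i)
  | add _ _ h h' => rw [Matrix.trace_add]; exact add_mem h h'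

theorem goodMat_of_forall_X (hc : SuperComm val) (hA : HasContractions val A) {d : ℕ}
    {M : Matrix (Fin 2) (Fin 2) R} (hM : GoodMat val A d M) {w : List Letter}
    (hw : ∀ a ∈ w, a = .X) : GoodMat val A (d + wdeg w) (M * wmat val w) := by
  induction w generalizing d M with
  | nil => simpa [wmat, wdeg] using hM
  | cons a w ih =>
    obtain rfl := hw a (by simp)
    rw [wmat_cons, ← mul_assoc, wdeg_cons, ← add_assoc]
    exact ih (hM.mul_X hc hA) fun b hb => hw b (by simp [hb])

/-- The trace of a product of matrices is cyclic up to a sign and terms of lower degree. -/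
theorem trace_wmat_append (hc : SuperComm val) (v w : List Letter) :
    (wmat val (v ++ w)).trace - (-1 : ℂ) ^ (wpar v * wpar w) • (wmat val (w ++ v)).trace ∈
      Low val (wdeg v + wdeg w) := by
  have : (wmat val (v ++ w)).trace - (-1 : ℂ) ^ (wpar v * wpar w) • (wmat val (w ++ v)).trace =
      ∑ i, ∑ j, (wmat val v i j * wmat val w j i -
        (-1 : ℂ) ^ (wpar v * wpar w) • (wmat val w j i * wmat val v i j)) := by
    simp only [Finset.sum_sub_distrib, wmat_append, Matrix.trace, Matrix.diag_apply,
      Matrix.mul_apply, ← Finset.smul_sum]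
    congr 2
    rw [Finset.sum_comm]
  rw [this]
  exact Submodule.sum_mem _ fun i _ => Submodule.sum_mem _ fun j _ =>
    hc.hom_comm (wmat_mem_hom v i j) (wmat_mem_hom w j i)

/-- Traces of products of basic matrices lie in `A` up to terms of lower degree: by the
Cayley–Hamilton identity they reduce to the basic contractions. -/
theorem trace_wmat_good (hc : SuperComm val) (hA : HasContractions val A) (w : List Letter) :
    (wmat val w).trace ∈ Good val A (wdeg w) := by
  by_cases hw : ∀ a ∈ w, a = .X
  · have h1 : GoodMat val A 0 1 := by
      convert GoodMat.one (mem_good (d := 0) A.one_mem (hom_le_low one_pos one_mem_hom)) using 1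
      ext i j
      simp [Matrix.one_apply]
    simpa using (goodMat_of_forall_X hc hA h1 hw).trace hA
  · push Not at hw
    obtain ⟨a, ha, hX⟩ := hw
    obtain ⟨w₁, w₂, rfl⟩ := List.append_of_mem ha
    cases a with
    | X => exact absurd rfl hX
    | pair c r =>
      have e1 := trace_wmat_append hc w₁ (.pair c r :: w₂)
      rw [← wdeg_append] at e1
      refine good_of_sub_mem e1 (Submodule.smul_mem _ _ ?_)
      -- the trace of `c r W` is the contraction of the row `r W` with `c`, up to a sign
      set W := w₂ ++ w₁ with hW
      have hr : GoodRow val A (1 + wdeg W) ((fun j => val (.row r j)) ᵥ* wmat val W) := by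
        refine GoodRow.vecMul_wmat hc hA W ?_
        convert GoodRow.row r (mem_good (d := 0) A.one_mem (hom_le_low one_pos one_mem_hom)) using 2
        rw [one_mul]
      have hhom : ∀ j, ((fun j => val (.row r j)) ᵥ* wmat val W) j ∈
          Hom val (1 + wdeg W) (r.toNat + wpar W) := fun j =>
        Submodule.sum_mem (t := Finset.univ) _ fun k _ =>
          hom_mul_hom (row_mem_hom r k) (wmat_mem_hom W k j)
      have e2 : (wmat val (.pair c r :: w₂ ++ w₁)).trace =
          ∑ j, val (.col c j) * ((fun j => val (.row r j)) ᵥ* wmat val W) j := by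
        rw [List.cons_append, wmat_cons]
        simp [Matrix.trace, Matrix.mul_apply, lmat, Matrix.vecMul, dotProduct, mul_add,
          mul_assoc, hW]
      have hd : wdeg (w₁ ++ .pair c r :: w₂) = 1 + (1 + wdeg W) := by
        simp only [wdeg_append, wdeg_cons, hW, Letter.deg]; ring
      rw [e2, hd]
      have e3 := sum_mem (S := Low val (1 + (1 + wdeg W))) (t := Finset.univ) fun j _ =>
        hc.hom_comm (col_mem_hom (val := val) c j) (hhom j)
      rw [Finset.sum_sub_distrib] at e3
      refine good_of_sub_mem e3 ?_
      rw [← Finset.smul_sum, add_comm 1]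
      exact Submodule.smul_mem _ _ (hr.sum_mul_col hA c)

end

/-! ### Contractions with equivariant tensors -/

section

variable {R : Type*} [Ring R] [Algebra ℂ R] {val : Gen → R} {A : Subalgebra ℂ R}

variable (val) in
/-- The product of the entries at `(I k, J k)` of the matrices `w k`, in the order given by `l`. -/
def entryProd {N : ℕ} (w : Fin N → List Letter) (l : List (Fin N)) (I J : Idx N) : R :=
  (l.map fun k => wmat val (w k) (I k) (J k)).prod

variable (val) in
/-- The contraction of a tensor `t` with the products of the entries of the matrices `w k`. -/
def pairing {N : ℕ} (w : Fin N → List Letter) (l : List (Fin N)) :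
    Matrix (Idx N) (Idx N) ℂ →ₗ[ℂ] R where
  toFun t := ∑ I, ∑ J, t I J • entryProd val w l I J
  map_add' t t' := by simp only [Matrix.add_apply, add_smul, Finset.sum_add_distrib]
  map_smul' c t := by simp only [Matrix.smul_apply, smul_assoc, Finset.smul_sum, RingHom.id_apply]

theorem pairing_apply {N : ℕ} (w : Fin N → List Letter) (l : List (Fin N))
    (t : Matrix (Idx N) (Idx N) ℂ) :
    pairing val w l t = ∑ I, ∑ J, t I J • entryProd val w l I J := rfl

theorem entryProd_perm (hc : SuperComm val) {N : ℕ} (w : Fin N → List Letter)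
    {l l' : List (Fin N)} (hl : l.Perm (List.finRange N)) (h : l.Perm l') :
    ∃ s : ℂ, ∀ I J, entryProd val w l I J - s • entryProd val w l' I J ∈
      Low val (∑ k, wdeg (w k)) := by
  obtain ⟨s, hs⟩ := hc.perm (fun k => wdeg (w k)) (fun k => wpar (w k)) h
  refine ⟨s, fun I J => ?_⟩
  have h1 := hs (fun k => wmat val (w k) (I k) (J k)) fun k => wmat_mem_hom (w k) (I k) (J k)
  have h2 : (l.map fun k => wdeg (w k)).sum = ∑ k, wdeg (w k) := by
    rw [(hl.map _).sum_eq, ← List.ofFn_eq_map, List.sum_ofFn]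
  rwa [h2] at h1

/-- The induction step for `pairing_good`, for the contraction of the row index of the first
matrix with the column index in position `q`.  If `q` is the first position, the contraction
produces the trace of the first matrix; otherwise it produces the product of two matrices, which
replaces these two. -/
theorem contraction_good (hc : SuperComm val) (hA : HasContractions val A) {N : ℕ}
    (ih : ∀ (w : Fin N → List Letter) (l : List (Fin N)), l.Perm (List.finRange N) →
      ∀ t, IsEquivariant t →
        pairing val w l t ∈ Good val A (∑ k, wdeg (w k)))
    (w : Fin (N + 1) → List Letter) (l : List (Fin (N + 1))) (hl : l.Perm (List.finRange (N + 1)))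
    (t : Matrix (Idx (N + 1)) (Idx (N + 1)) ℂ) (ht : IsEquivariant t) (q : Fin (N + 1)) :
    pairing val w l (contract 0 q t) ∈
      Good val A (∑ k, wdeg (w k)) := by
  set σ := Equiv.swap 0 q with hσ
  set t' := ptr (t.submatrix (permIdx 1) (permIdx σ)) with ht'
  have htt' : IsEquivariant t' := (ht.submatrix 1 σ).ptr
  have e : pairing val w l (contract 0 q t) =
      ∑ I, ∑ J, t' I J • ∑ a,
        entryProd val w l (Fin.cons a I) ((Fin.cons a J : Idx (N + 1)) ∘ σ) := by
    have e1 : ∀ I (J : Idx (N + 1)), contract 0 q t I (J ∘ σ) =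
        if I 0 = J 0 then t' (Fin.tail I) (Fin.tail J) else 0 := by
      intro I J
      rw [contract_apply]
      simp only [Function.comp, hσ, Equiv.swap_apply_right]
      congr 1
      simp only [ht', ptr, Matrix.of_apply, Matrix.submatrix_apply]
      refine Finset.sum_congr rfl fun b _ => ?_
      congr 1
      · ext1 k
        refine Fin.cases ?_ (fun k => ?_) k <;> simp [permIdx, Fin.tail, Fin.succ_ne_zero]
      · ext1 k
        change _ = (Fin.cons b (Fin.tail J) : Idx (N + 1)) (σ k)
        by_cases hk : k = q
        · subst hk; simp [hσ]
        · have h0 : σ k ≠ 0 := fun h => hk (by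
            have := congrArg σ h
            simpa [hσ] using this)
          obtain ⟨m, hm⟩ := Fin.exists_succ_eq.mpr h0
          rw [Function.update_of_ne hk, ← hm, Fin.cons_succ]
          exact congrArg J hm.symm
    have e2 : ∀ I, ∑ J, contract 0 q t I J •
        entryProd val w l I J = ∑ J : Idx (N + 1), (if I 0 = J 0 then t' (Fin.tail I) (Fin.tail J)
          else 0) • entryProd val w l I (J ∘ σ) := by
      intro I
      rw [← Equiv.sum_comp (permIdx σ)]
      exact Finset.sum_congr rfl fun J _ => by rw [← e1]; rfl
    rw [pairing_apply]
    simp only [e2, sum_idx_succ (N := N), Fin.cons_zero, Fin.tail_cons, ite_smul, zero_smul,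
      Finset.smul_sum]
    rw [Finset.sum_comm]
    refine Finset.sum_congr rfl fun I _ => ?_
    rw [Finset.sum_comm (s := (Finset.univ : Finset (Idx N)))]
    refine Finset.sum_congr rfl fun a _ => ?_
    rw [Finset.sum_comm]
    refine Finset.sum_congr rfl fun J _ => ?_
    simp
  rw [e]
  refine Fin.cases (motive := fun q' => q = q' → _) (fun hq => ?_) (fun q' hq => ?_) q rfl
  -- the first matrix is moved to the front, where its trace splits off
  · have h1 : l.Perm (0 :: (List.finRange N).map Fin.succ) := by rwa [← List.finRange_succ]
    obtain ⟨s, hs⟩ := entryProd_perm hc w hl h1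
    have e1 : ∀ a (I J : Idx N), entryProd val w (0 :: (List.finRange N).map Fin.succ)
        (Fin.cons a I) ((Fin.cons a J : Idx (N + 1)) ∘ σ) =
        wmat val (w 0) a a * entryProd val (fun k => w k.succ) (List.finRange N) I J := by
      intro a I J
      simp [entryProd, hσ, hq, Function.comp_def]
    have e2 : s • ((wmat val (w 0)).trace * pairing val (fun k => w k.succ) (List.finRange N) t') =
        ∑ I, ∑ J, t' I J • ∑ a, s • entryProd val w (0 :: (List.finRange N).map Fin.succ)
        (Fin.cons a I) ((Fin.cons a J : Idx (N + 1)) ∘ σ) := by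
      simp only [pairing_apply, e1, Matrix.trace, Matrix.diag_apply, ← Finset.smul_sum,
        ← Finset.sum_mul, Finset.mul_sum, mul_smul_comm]
      simp only [Finset.smul_sum, smul_comm s]
    refine good_of_sub_mem (y := _) ?_ (e2 ▸ Submodule.smul_mem _ s ?_)
    · rw [← Finset.sum_sub_distrib]
      refine Submodule.sum_mem _ fun I _ => ?_
      rw [← Finset.sum_sub_distrib]
      refine Submodule.sum_mem _ fun J _ => ?_
      rw [← smul_sub, ← Finset.sum_sub_distrib]
      exact Submodule.smul_mem _ _ (Submodule.sum_mem _ fun a _ => hs _ _)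
    · rw [Fin.sum_univ_succ]
      exact good_mul_good (trace_wmat_good hc hA _) (ih _ _ (List.Perm.refl _) _ htt')
  -- the matrices in positions `q` and `0` are moved to the front, where they are multiplied
  · have hq' : q' ∈ List.finRange N := List.mem_finRange q'
    set rest := (List.finRange N).erase q' with hrest
    have hp : (List.finRange N).Perm (q' :: rest) := List.perm_cons_erase hq'
    have h1 : l.Perm (q'.succ :: 0 :: rest.map Fin.succ) := by
      refine hl.trans ?_
      rw [List.finRange_succ]
      exact ((hp.map Fin.succ).cons 0).trans (List.Perm.swap _ _ _)
    obtain ⟨s, hs⟩ := entryProd_perm hc w hl h1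
    set w' : Fin N → List Letter := Function.update (fun k => w k.succ) q' (w q'.succ ++ w 0)
      with hw'
    have e1 : ∀ I J : Idx N, ∑ a, entryProd val w (q'.succ :: 0 :: rest.map Fin.succ)
        (Fin.cons a I) ((Fin.cons a J : Idx (N + 1)) ∘ σ) = entryProd val w' (q' :: rest) I J := by
      intro I J
      have e3 : ∀ k ∈ rest, k ≠ q' := fun k hk => by
        rintro rfl
        exact (List.nodup_finRange N).not_mem_erase hk
      have e4 : ∀ a, (rest.map Fin.succ).map (fun k =>
          wmat val (w k) ((Fin.cons a I : Idx (N + 1)) k)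
          (((Fin.cons a J : Idx (N + 1)) ∘ σ) k)) =
          rest.map fun k => wmat val (w' k) (I k) (J k) := by
        intro a
        rw [List.map_map]
        refine List.map_congr_left fun k hk => ?_
        have hk' : k ≠ q' := e3 k hk
        have : Equiv.swap 0 q'.succ k.succ = k.succ :=
          Equiv.swap_apply_of_ne_of_ne (Fin.succ_ne_zero k) (by simpa using hk')
        simp [hσ, hq, this, hw', hk']
      simp only [entryProd, List.map_cons, List.prod_cons, e4, ← mul_assoc, ← Finset.sum_mul]
      congr 1
      simp [hw', wmat_append, Matrix.mul_apply, hσ, hq]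
    have e2 : s • pairing val w' (q' :: rest) t' =
        ∑ I, ∑ J, t' I J • ∑ a, s • entryProd val w (q'.succ :: 0 :: rest.map Fin.succ)
        (Fin.cons a I) ((Fin.cons a J : Idx (N + 1)) ∘ σ) := by
      simp only [pairing_apply, ← e1, ← Finset.smul_sum]
      simp only [Finset.smul_sum, smul_comm s]
    have hdeg : ∑ k, wdeg (w k) = ∑ k, wdeg (w' k) := by
      have h2 : ∀ k, wdeg (w' k) = wdeg (w k.succ) + if k = q' then wdeg (w 0) else 0 := by
        intro k
        by_cases hk : k = q'
        · subst hk; simp [hw', wdeg_append]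
        · simp [hw', hk]
      rw [Fin.sum_univ_succ]
      simp [h2, Finset.sum_add_distrib, add_comm]
    refine good_of_sub_mem (y := _) ?_ (e2 ▸ Submodule.smul_mem _ s ?_)
    · rw [← Finset.sum_sub_distrib]
      refine Submodule.sum_mem _ fun I _ => ?_
      rw [← Finset.sum_sub_distrib]
      refine Submodule.sum_mem _ fun J _ => ?_
      rw [← smul_sub, ← Finset.sum_sub_distrib]
      exact Submodule.smul_mem _ _ (Submodule.sum_mem _ fun a _ => hs _ _)
    · rw [hdeg]
      exact ih _ _ hp.symm _ htt'

/-- The first fundamental theorem: contracting the entries of a product of matrices with an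
equivariant tensor yields an element of `A`, up to terms of lower degree. -/
theorem pairing_good (hc : SuperComm val) (hA : HasContractions val A) {N : ℕ}
    (w : Fin N → List Letter) (l : List (Fin N)) (hl : l.Perm (List.finRange N))
    (t : Matrix (Idx N) (Idx N) ℂ) (ht : IsEquivariant t) :
    pairing val w l t ∈ Good val A (∑ k, wdeg (w k)) := by
  induction N with
  | zero =>
    obtain rfl : l = [] := by simpa using hl
    simp only [pairing_apply, Finset.univ_unique, Finset.sum_singleton, entryProd, List.map_nil,
      List.prod_nil]
    refine Submodule.smul_mem _ _ (mem_good A.one_mem (hom_le_low ?_ one_mem_hom))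
    simp
  | succ N ih =>
    obtain ⟨t₁, ht₁, rfl⟩ := ht.exists_casimir N.succ_ne_zero
    simp only [map_sum]
    refine Submodule.sum_mem _ fun p _ => Submodule.sum_mem _ fun q _ => ?_
    -- exchanging the positions `0` and `p` reduces to a contraction of the first row index
    set σ := Equiv.swap 0 p with hσ
    have hlσ : (l.map σ).Perm (List.finRange (N + 1)) := by
      refine (List.perm_ext_iff_of_nodup ?_ (List.nodup_finRange _)).mpr fun k => ?_
      · exact (hl.nodup_iff.mpr (List.nodup_finRange _)).map σ.injective
      · simp only [List.mem_map, List.mem_finRange, iff_true]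
        exact ⟨σ.symm k, hl.mem_iff.mpr (List.mem_finRange _), by simp⟩
    have h := contraction_good hc hA ih (fun k => w (σ k)) (l.map σ) hlσ
      (t₁.submatrix (permIdx σ) (permIdx σ)) (ht₁.submatrix σ σ) (σ q)
    have hσp : σ p = 0 := Equiv.swap_apply_right 0 p
    rw [← hσp, ← contract_submatrix, Equiv.sum_comp σ fun k => wdeg (w k), pairing_apply] at h
    rw [pairing_apply]
    convert h using 1
    rw [← Equiv.sum_comp (permIdx σ)]
    refine Finset.sum_congr rfl fun I _ => ?_
    rw [← Equiv.sum_comp (permIdx σ)]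
    refine Finset.sum_congr rfl fun J _ => ?_
    rw [Matrix.submatrix_apply]
    congr 1
    simp [entryProd, List.map_map, Function.comp_def, permIdx, hσ]

end

/-! ### Lifting invariants to tensors -/

section

/-- Lifting of invariants along a linear map with kernel `N`, for a family of operators closed under
adjoints: the component of `t` orthogonal to `N` is invariant as soon as `t` is invariant
modulo `N`. -/
theorem exists_invariant_lift {V : Type*} [AddCommGroup V] [Module ℂ V] [FiniteDimensional ℂ V]
    (c : InnerProductSpace.Core ℂ V) (N : Submodule ℂ V) {ι : Type*} (f : ι → V →ₗ[ℂ] V)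
    (inv : ι → ι) (adj : ∀ i x y, c.inner (f i x) y = c.inner x (f (inv i) y))
    (stab : ∀ i, ∀ x ∈ N, f i x ∈ N) (t : V) (ht : ∀ i, f i t ∈ N) :
    ∃ t', t - t' ∈ N ∧ ∀ i, f i t' = 0 := by
  let _ : NormedAddCommGroup V := c.toNormedAddCommGroup
  let _ : InnerProductSpace ℂ V := InnerProductSpace.ofCore c.toCore
  obtain ⟨n, hn, t', ht', rfl⟩ := N.exists_add_mem_mem_orthogonal t
  refine ⟨t', by simpa using hn, fun i => ?_⟩
  have h1 : f i t' ∈ N := by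
    have := sub_mem (ht i) (stab i n hn)
    simpa using this
  have h2 : f i t' ∈ Nᗮ := by
    rw [Submodule.mem_orthogonal']
    intro u hu
    have := adj i t' u
    exact this.trans ((Submodule.mem_orthogonal' N t').mp ht' _ (stab _ u hu))
  exact (Submodule.disjoint_def.mp N.orthogonal_disjoint) _ h1 h2

/-- The Hilbert–Schmidt inner product on families of matrices. -/
@[reducible] noncomputable def traceCore {S : Type*} [Fintype S] (n : S → Type*)
    [∀ s, Fintype (n s)] :
    InnerProductSpace.Core ℂ (∀ s, Matrix (n s) (n s) ℂ) where
  inner t t' := ∑ s, ((t s)ᴴ * t' s).trace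
  conj_inner_symm t t' := by
    simp only [map_sum]
    refine Finset.sum_congr rfl fun s _ => ?_
    rw [starRingEnd_apply, ← Matrix.trace_conjTranspose, Matrix.conjTranspose_mul,
      Matrix.conjTranspose_conjTranspose]
  re_inner_nonneg t := by
    rw [map_sum]
    refine Finset.sum_nonneg fun s _ => ?_
    open scoped ComplexOrder in
    exact (Complex.le_def.mp (Matrix.posSemidef_conjTranspose_mul_self (t s)).trace_nonneg).1
  add_left t t' t'' := by
    simp [Matrix.conjTranspose_add, add_mul, Finset.sum_add_distrib]
  smul_left t t' r := by
    simp [Matrix.conjTranspose_smul, Finset.mul_sum]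
  definite t h := by
    open scoped ComplexOrder in
    have h' := (Finset.sum_eq_zero_iff_of_nonneg fun s _ =>
      (Matrix.posSemidef_conjTranspose_mul_self (t s)).trace_nonneg).mp h
    ext1 s
    exact Matrix.trace_conjTranspose_mul_self_eq_zero_iff.mp (h' s (Finset.mem_univ s))

variable {R : Type*} [Ring R] {val : Gen → R}

/-- The word consisting of the generators in an entry of a basic matrix. -/
def entryWord : Letter × Fin 2 × Fin 2 → List Gen
  | (.X, i, j) => [.X i j]
  | (.pair c r, i, j) => [.col c i, .row r j]

theorem length_entryWord (e : Letter × Fin 2 × Fin 2) : (entryWord e).length = e.1.deg := by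
  obtain ⟨_ | _, i, j⟩ := e <;> rfl

theorem wprod_entryWord (e : Letter × Fin 2 × Fin 2) :
    wprod val (entryWord e) = lmat val e.1 e.2.1 e.2.2 := by
  obtain ⟨_ | _, i, j⟩ := e <;> simp [wprod, entryWord, lmat]

variable [Algebra ℂ R] {A : Subalgebra ℂ R}

variable (val) in
/-- The contraction of tensors with products of basic matrices of given types. -/
def shapePairing (s : List Letter) : Matrix (Idx s.length) (Idx s.length) ℂ →ₗ[ℂ] R :=
  pairing val (fun k => [s.get k]) (List.finRange s.length)

theorem sum_wdeg_get (s : List Letter) : ∑ k, wdeg [s.get k] = wdeg s := by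
  simp only [wdeg, List.map_cons, List.map_nil, List.sum_cons, List.sum_nil, add_zero]
  rw [← List.sum_ofFn]
  congr 1
  exact List.ext_getElem (by simp) (by simp)

/-- The letters of a word can be grouped into entries of basic matrices, leaving only columns or
only rows. -/
theorem exists_perm_entryWord (l : List Gen) : ∃ (es : List (Letter × Fin 2 × Fin 2))
    (rest : List Gen), l.Perm (es.flatMap entryWord ++ rest) ∧
      ((∀ g ∈ rest, ∃ s i, g = .col s i) ∨ ∀ g ∈ rest, ∃ s i, g = .row s i) := by
  induction l with
  | nil => exact ⟨[], [], by simp, by simp⟩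
  | cons g l ih =>
    obtain ⟨es, rest, hp, hr⟩ := ih
    cases g with
    | X i j =>
      exact ⟨(.X, i, j) :: es, rest, by simpa [entryWord] using hp, hr⟩
    | col s i =>
      have h1 : (∀ g ∈ rest, ∃ s i, g = .col s i) → ∃ (es : List (Letter × Fin 2 × Fin 2))
          (rest : List Gen), (Gen.col s i :: l).Perm (es.flatMap entryWord ++ rest) ∧
          ((∀ g ∈ rest, ∃ s i, g = .col s i) ∨ ∀ g ∈ rest, ∃ s i, g = .row s i) := fun h =>
        ⟨es, .col s i :: rest, (hp.cons _).trans List.perm_middle.symm,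
          Or.inl (List.forall_mem_cons.mpr ⟨⟨s, i, rfl⟩, h⟩)⟩
      rcases hr with hr | hr
      · exact h1 hr
      · cases rest with
        | nil => exact h1 (by simp)
        | cons g rest =>
          obtain ⟨s', j, rfl⟩ := hr g (by simp)
          exact ⟨(.pair s s', i, j) :: es, rest, by
            simpa [entryWord] using hp.trans List.perm_middle,
            Or.inr fun g hg => hr g (by simp [hg])⟩
    | row s i =>
      have h1 : (∀ g ∈ rest, ∃ s i, g = .row s i) → ∃ (es : List (Letter × Fin 2 × Fin 2))
          (rest : List Gen), (Gen.row s i :: l).Perm (es.flatMap entryWord ++ rest) ∧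
          ((∀ g ∈ rest, ∃ s i, g = .col s i) ∨ ∀ g ∈ rest, ∃ s i, g = .row s i) := fun h =>
        ⟨es, .row s i :: rest, (hp.cons _).trans List.perm_middle.symm,
          Or.inr (List.forall_mem_cons.mpr ⟨⟨s, i, rfl⟩, h⟩)⟩
      rcases hr with hr | hr
      · cases rest with
        | nil => exact h1 (by simp)
        | cons g rest =>
          obtain ⟨s', j, rfl⟩ := hr g (by simp)
          refine ⟨(.pair s' s, j, i) :: es, rest, ?_, Or.inl fun g hg => hr g (by simp [hg])⟩
          have := (hp.cons (.row s i)).trans ((List.perm_middle).cons _)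
          simpa [entryWord] using this.trans (List.Perm.swap _ _ _)
      · exact h1 hr

theorem wcharge_append (l l' : List Gen) : wcharge (l ++ l') = wcharge l + wcharge l' := by
  simp [wcharge]

/-- The letters of a word of charge zero can be grouped into entries of basic matrices. -/
theorem exists_perm_entryWord_of_wcharge {l : List Gen} (hl : wcharge l = 0) :
    ∃ es : List (Letter × Fin 2 × Fin 2), l.Perm (es.flatMap entryWord) := by
  obtain ⟨es, rest, hp, hr⟩ := exists_perm_entryWord l
  have h0 : wcharge (es.flatMap entryWord) = 0 := by
    clear hp
    induction es with
    | nil => rfl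
    | cons e es ih =>
      rw [List.flatMap_cons, wcharge_append, ih]
      obtain ⟨_ | _, i, j⟩ := e <;> simp [wcharge, entryWord, Gen.charge]
  have h1 : wcharge rest = 0 := by
    have : wcharge l = wcharge (es.flatMap entryWord ++ rest) := (hp.map _).sum_eq
    rw [hl, wcharge_append, h0] at this
    omega
  have h2 : rest = [] := by
    rw [← List.length_eq_zero_iff]
    rcases hr with hr | hr
    · have : wcharge rest = rest.length := by
        clear hp h1
        induction rest with
        | nil => rfl
        | cons g rest ih =>
          obtain ⟨s, i, rfl⟩ := hr g (by simp)
          have := ih fun g hg => hr g (by simp [hg])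
          simp only [wcharge, List.map_cons, List.sum_cons, Gen.charge, List.length_cons] at *
          push_cast
          omega
      omega
    · have : wcharge rest = -rest.length := by
        clear hp h1
        induction rest with
        | nil => rfl
        | cons g rest ih =>
          obtain ⟨s, i, rfl⟩ := hr g (by simp)
          have := ih fun g hg => hr g (by simp [hg])
          simp only [wcharge, List.map_cons, List.sum_cons, Gen.charge, List.length_cons] at *
          push_cast
          omega
      omega
  exact ⟨es, by simpa [h2] using hp⟩

variable (val) in
/-- The span of the words of length less than `n` and charge zero. -/
def Balanced (n : ℕ) : Submodule ℂ R :=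
  Submodule.span ℂ {x | ∃ l : List Gen, l.length < n ∧ wcharge l = 0 ∧ wprod val l = x}

/-- Up to shorter words, words of charge zero are contractions of tensors. -/
theorem balanced_le (hc : SuperComm val) (n : ℕ) : Balanced val (n + 1) ≤
    (⨆ s : {s : List Letter // wdeg s = n}, LinearMap.range (shapePairing val s.1)) ⊔
      Low val n := by
  refine Submodule.span_le.mpr ?_
  rintro _ ⟨l, hl, h0, rfl⟩
  rcases (Nat.lt_succ_iff.mp hl).lt_or_eq with hl | hl
  · exact Submodule.mem_sup_right (wprod_mem_low hl)
  obtain ⟨es, hp⟩ := exists_perm_entryWord_of_wcharge h0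
  obtain ⟨s, hs⟩ := hc.perm (fun _ => 1) Gen.odd hp
  have h1 := hs val val_mem_hom
  rw [List.map_const', List.sum_replicate, smul_eq_mul, mul_one, hl] at h1
  have h2 : ((es.flatMap entryWord).map val).prod ∈
      ⨆ s : {s : List Letter // wdeg s = n}, LinearMap.range (shapePairing val s.1) := by
    have hdeg : wdeg (es.map (·.1)) = n := by
      rw [← hl, hp.length_eq, List.length_flatMap, wdeg, List.map_map]
      congr 2
      ext1 e
      exact (length_entryWord e).symm
    refine Submodule.mem_iSup_of_mem (⟨es.map (·.1), hdeg⟩ : {s : List Letter // wdeg s = n}) ?_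
    set I : Idx (es.map (·.1)).length := fun k => (es.get (k.cast (by simp))).2.1 with hI
    set J : Idx (es.map (·.1)).length := fun k => (es.get (k.cast (by simp))).2.2 with hJ
    refine ⟨Matrix.single I J 1, ?_⟩
    rw [shapePairing, pairing_apply, Finset.sum_eq_single I, Finset.sum_eq_single J]
    · rw [Matrix.single_apply_same, one_smul, entryProd]
      have h3 : ((es.flatMap entryWord).map val).prod =
          (es.map fun e => lmat val e.1 e.2.1 e.2.2).prod := by
        clear hp hs h1 hdeg hI hJ I J
        induction es with
        | nil => rfl
        | cons e es ih =>
          rw [List.flatMap_cons, List.map_append, List.prod_append, ih, List.map_cons,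
            List.prod_cons, ← wprod_entryWord]
          rfl
      rw [h3]
      congr 1
      refine List.ext_getElem (by simp) fun k h h' => ?_
      simp [hI, hJ, wmat]
    · intro J' _ h
      rw [Matrix.single_apply_of_ne _ _ _ _ _ (by simp [h.symm]), zero_smul]
    · simp
    · intro I' _ h
      refine Finset.sum_eq_zero fun J' _ => ?_
      rw [Matrix.single_apply_of_ne _ _ _ _ _ (by simp [h.symm]), zero_smul]
    · simp
  have h3 : wprod val l = s • ((es.flatMap entryWord).map val).prod +
      ((l.map val).prod - s • ((es.flatMap entryWord).map val).prod) := by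
    rw [wprod]; abel
  rw [h3]
  exact Submodule.add_mem_sup (Submodule.smul_mem _ _ h2) h1

/-- The criterion for `A` to contain all invariants.  The invariants in `R` are the common kernel
of the operators `φ i`; these are induced by operators `f i` on the tensors, which are closed under
adjoints and whose common kernel consists of equivariant tensors. -/
theorem mem_of_invariant (hc : SuperComm val) (hA : HasContractions val A) {ι : Type*}
    (inv : ι → ι) (φ : ι → R →ₗ[ℂ] R)
    (f : ι → ∀ N, Matrix (Idx N) (Idx N) ℂ →ₗ[ℂ] Matrix (Idx N) (Idx N) ℂ)
    (adj : ∀ i N t t', ((f i N t)ᴴ * t').trace = (tᴴ * f (inv i) N t').trace)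
    (heq : ∀ N t, (∀ i, f i N t = 0) → IsEquivariant t)
    (hφ : ∀ i s t, shapePairing val s (f i _ t) = φ i (shapePairing val s t))
    (hlow : ∀ i n, ∀ x ∈ Low val n, φ i x ∈ Low val n)
    (hφA : ∀ i, ∀ x ∈ A, φ i x = 0)
    (hbal : ∀ n, ∀ x ∈ Low val n, (∀ i, φ i x = 0) → x ∈ Balanced val n)
    {n : ℕ} {z : R} (hz : z ∈ Low val n) (h0 : ∀ i, φ i z = 0) : z ∈ A := by
  induction n generalizing z with
  | zero =>
    have : z = 0 := by simpa [Low] using hz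
    rw [this]
    exact A.zero_mem
  | succ n ih =>
    suffices hg : z ∈ Good val A n by
      obtain ⟨a, ⟨ha, -⟩, y, hy, rfl⟩ := Submodule.mem_sup.mp hg
      refine A.add_mem ha (ih hy fun i => ?_)
      simpa [hφA i a ha] using h0 i
    obtain ⟨z', hz', y, hy, rfl⟩ := Submodule.mem_sup.mp (balanced_le hc n (hbal _ z hz h0))
    refine add_mem ?_ (low_le_good hy)
    -- `z'` is a sum of contractions of tensors of finitely many shapes, which are lifted jointly
    obtain ⟨S, hS⟩ := (Submodule.mem_iSup_iff_exists_finset).mp hz'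
    rw [Submodule.mem_iSup_finset_iff_exists_sum] at hS
    obtain ⟨μ, hμ⟩ := hS
    choose t ht using fun s : {s : List Letter // wdeg s = n} => (μ s).2
    let π : (∀ s : S, Matrix (Idx s.1.1.length) (Idx s.1.1.length) ℂ) →ₗ[ℂ] R :=
      ∑ s : S, shapePairing val s.1.1 ∘ₗ LinearMap.proj s
    have hπ : ∀ t, π t = ∑ s : S, shapePairing val s.1.1 (t s) := fun t => by
      simp [π]
    let g : ι → (∀ s : S, Matrix (Idx s.1.1.length) (Idx s.1.1.length) ℂ) →ₗ[ℂ]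
        (∀ s : S, Matrix (Idx s.1.1.length) (Idx s.1.1.length) ℂ) :=
      fun i => LinearMap.pi fun s => f i _ ∘ₗ LinearMap.proj s
    have hgπ : ∀ i t, π (g i t) = φ i (π t) := by
      intro i t
      simp only [hπ, map_sum, ← hφ]
      rfl
    have ht₀ : π (fun s => t s.1) = z' := by
      rw [hπ, ← hμ, ← Finset.sum_coe_sort S]
      exact Finset.sum_congr rfl fun s _ => ht s.1
    obtain ⟨t', ht', hinv⟩ := exists_invariant_lift
      (traceCore fun s : S => Idx s.1.1.length) ((Low val n).comap π) g inv
      (fun i x y => Finset.sum_congr rfl fun s _ => adj i _ _ _)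
      (fun i x hx => by
        rw [Submodule.mem_comap] at hx ⊢
        rw [hgπ]
        exact hlow i n _ hx)
      (fun s => t s.1)
      (fun i => by
        rw [Submodule.mem_comap, hgπ, ht₀]
        have := h0 i
        rw [map_add] at this
        rw [eq_neg_of_add_eq_zero_left this]
        exact neg_mem (hlow i n _ hy))
    rw [Submodule.mem_comap, map_sub, ht₀] at ht'
    refine good_of_sub_mem ht' ?_
    rw [hπ]
    refine Submodule.sum_mem _ fun s _ => ?_
    have h1 := pairing_good hc hA (fun k => [s.1.1.get k]) _ (List.Perm.refl _) (t' s)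
      (heq _ _ fun i => congrFun (hinv i) s)
    rwa [sum_wdeg_get, s.1.2] at h1

end

/-! ### The group `K` and its Lie algebra -/

/-- The upper left `2 × 2` block of an element of `K`. -/
def blk (g : K) : Mat2 := Matrix.of fun i j => (g.1 : Mat) i.castSucc j.castSucc

/-- The lower right entry of an element of `K`. -/
def corner (g : K) : ℂ := (g.1 : Mat) 2 2

theorem coe_eq_of (g : K) : (g.1 : Mat) =
    !![blk g 0 0, blk g 0 1, 0; blk g 1 0, blk g 1 1, 0; 0, 0, corner g] := by
  obtain ⟨h, h1, h2, h3, h4⟩ := (mem_K_iff g.1).mp g.2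
  ext i j
  fin_cases i <;> fin_cases j <;> simp [blk, corner, h1, h2, h3, h4]

theorem blk_conjTranspose_mul (g : K) : (blk g)ᴴ * blk g = 1 := by
  obtain ⟨h, -⟩ := (mem_K_iff g.1).mp g.2
  rw [coe_eq_of] at h
  ext i j
  have := congrFun (congrFun h i.castSucc) j.castSucc
  fin_cases i <;> fin_cases j <;>
    simpa [Matrix.mul_apply, Fin.sum_univ_three, Fin.sum_univ_two] using this

theorem blk_mul_conjTranspose (g : K) : blk g * (blk g)ᴴ = 1 :=
  mul_eq_one_comm.mp (blk_conjTranspose_mul g)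

theorem star_corner_mul (g : K) : star (corner g) * corner g = 1 := by
  obtain ⟨h, -⟩ := (mem_K_iff g.1).mp g.2
  rw [coe_eq_of] at h
  have := congrFun (congrFun h 2) 2
  simpa [Matrix.mul_apply, Fin.sum_univ_three] using this

theorem coe_inv (g : K) : ((g.1⁻¹ : SL3) : Mat) = (g.1 : Mat)ᴴ := by
  have h1 : (g.1 : Mat) * ((g.1⁻¹ : SL3) : Mat) = 1 := by
    rw [← Matrix.SpecialLinearGroup.coe_mul, mul_inv_cancel, Matrix.SpecialLinearGroup.coe_one]
  obtain ⟨h, -⟩ := (mem_K_iff g.1).mp g.2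
  calc _ = (g.1 : Mat)ᴴ * (g.1 : Mat) * ((g.1⁻¹ : SL3) : Mat) := by rw [h, one_mul]
    _ = _ := by rw [mul_assoc, h1, mul_one]

theorem blk_inv (g : K) : blk g⁻¹ = (blk g)ᴴ := by
  ext i j
  change ((g.1⁻¹ : SL3) : Mat) _ _ = _
  rw [coe_inv]
  rfl

theorem star_det_mul_det {a : Mat2} (ha : aᴴ * a = 1) : star a.det * a.det = 1 := by
  rw [← Matrix.det_conjTranspose, ← Matrix.det_mul, ha, Matrix.det_one]

/-- The element of `K` with a given unitary upper left block. -/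
def kOf (a : Mat2) (ha : aᴴ * a = 1) : K :=
  ⟨⟨!![a 0 0, a 0 1, 0; a 1 0, a 1 1, 0; 0, 0, star a.det], by
    have h := star_det_mul_det ha
    rw [Matrix.det_fin_three]
    simp only [Matrix.of_apply, Matrix.cons_val', Matrix.cons_val_zero, Matrix.cons_val_one,
      Matrix.cons_val]
    rw [Matrix.det_fin_two] at h ⊢
    linear_combination h⟩, by
    refine (mem_K_iff _).mpr ⟨?_, rfl, rfl, rfl, rfl⟩
    have h := star_det_mul_det ha
    have h00 := congrFun (congrFun ha 0) 0
    have h01 := congrFun (congrFun ha 0) 1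
    have h10 := congrFun (congrFun ha 1) 0
    have h11 := congrFun (congrFun ha 1) 1
    simp only [Matrix.mul_apply, Fin.sum_univ_two, Matrix.conjTranspose_apply] at h00 h01 h10 h11
    ext i j
    fin_cases i <;> fin_cases j <;> simp [Matrix.mul_apply, Fin.sum_univ_three]
    · simpa using h00
    · simpa using h01
    · simpa using h10
    · simpa using h11
    · rw [mul_comm]
      simpa using h⟩

theorem blk_kOf (a : Mat2) (ha : aᴴ * a = 1) : blk (kOf a ha) = a := by
  ext i j
  fin_cases i <;> fin_cases j <;> rfl

theorem corner_kOf (a : Mat2) (ha : aᴴ * a = 1) : corner (kOf a ha) = star a.det := rfl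

/-- Differentiating a path in `U(2)` through the identity. -/
theorem tot_comm_of_path {N : ℕ} {t : Matrix (Idx N) (Idx N) ℂ}
    (ht : ∀ g : K, tens (fun _ => blk g) * t = t * tens fun _ => blk g) {a : ℝ → Mat2}
    (ha : ∀ x, (a x)ᴴ * a x = 1) (h0 : a 0 = 1) {Y : Mat2}
    (hY : ∀ i j, HasDerivAt (fun x => a x i j) (Y i j) 0) : tot N Y * t = t * tot N Y := by
  have h1 : ∀ x, tens (fun _ => a x) * t = t * tens fun _ => a x := fun x => by
    have := ht (kOf (a x) (ha x))
    rwa [blk_kOf] at this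
  have h2 : ∀ I J : Idx N, HasDerivAt (fun x => tens (fun _ => a x) I J) (tot N Y I J) 0 := by
    intro I J
    have := HasDerivAt.fun_finsetProd (u := Finset.univ) fun k (_ : k ∈ Finset.univ) =>
      hY (I k) (J k)
    have e : ∀ p, ∏ k ∈ Finset.univ.erase p, a 0 (I k) (J k) =
        if ∀ k, k ≠ p → I k = J k then 1 else 0 := fun p => by
      simp only [h0, Matrix.one_apply, Finset.prod_ite_zero, Finset.prod_const_one,
        Finset.mem_erase, Finset.mem_univ, and_true]
    have e' : tot N Y I J = ∑ p, (∏ k ∈ Finset.univ.erase p, a 0 (I k) (J k)) • Y (I p) (J p) := by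
      simp only [tot, Matrix.sum_apply, e, slot_apply, ite_smul, one_smul, zero_smul]
    rw [e']
    exact this
  ext I J
  have h3 : HasDerivAt (fun x => (tens (fun _ => a x) * t : Matrix (Idx N) (Idx N) ℂ) I J)
      ((tot N Y * t) I J) 0 := by
    simp only [Matrix.mul_apply]
    exact HasDerivAt.fun_sum fun L _ => (h2 I L).mul_const _
  have h4 : HasDerivAt (fun x => (tens (fun _ => a x) * t : Matrix (Idx N) (Idx N) ℂ) I J)
      ((t * tot N Y) I J) 0 := by
    simp only [h1]
    simp only [Matrix.mul_apply]
    exact HasDerivAt.fun_sum fun L _ => (h2 L J).const_mul _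
  exact h3.unique h4

/-- A tensor invariant under `U(2)` is invariant under its complexified Lie algebra. -/
theorem isEquivariant_of_group {N : ℕ} {t : Matrix (Idx N) (Idx N) ℂ}
    (ht : ∀ g : K, tens (fun _ => blk g) * t = t * tens fun _ => blk g) : IsEquivariant t := by
  have hexp : HasDerivAt (fun x : ℝ => Complex.exp (x * Complex.I)) Complex.I 0 := by
    have h := ((Complex.ofRealCLM.hasDerivAt (x := 0)).mul_const Complex.I).cexp
    simpa using h
  have hcos : HasDerivAt (fun x : ℝ => ((Real.cos x : ℝ) : ℂ)) 0 0 := by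
    simpa using (Real.hasDerivAt_cos 0).ofReal_comp
  have hsin : HasDerivAt (fun x : ℝ => ((Real.sin x : ℝ) : ℂ)) 1 0 := by
    simpa using (Real.hasDerivAt_sin 0).ofReal_comp
  have hee : ∀ x : ℝ, star (Complex.exp (x * Complex.I)) * Complex.exp (x * Complex.I) = 1 := by
    intro x
    rw [Complex.star_def, ← Complex.exp_conj, ← Complex.exp_add]
    simp
  have hcs : ∀ x : ℝ, ((Real.cos x : ℝ) : ℂ) * (Real.cos x : ℝ) +
      ((Real.sin x : ℝ) : ℂ) * (Real.sin x : ℝ) = 1 := by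
    intro x
    have := Real.cos_sq_add_sin_sq x
    rw [← Complex.ofReal_mul, ← Complex.ofReal_mul, ← Complex.ofReal_add, ← sq, ← sq, this]
    rfl
  have c00 : tot N !![Complex.I, 0; 0, 0] * t = t * tot N !![Complex.I, 0; 0, 0] := by
    refine tot_comm_of_path ht (a := fun x => !![Complex.exp (x * Complex.I), 0; 0, 1]) ?_ ?_ ?_
    · intro x
      ext i j
      have := hee x
      fin_cases i <;> fin_cases j <;> simp [Matrix.mul_apply]
      simpa using this
    · ext i j
      fin_cases i <;> fin_cases j <;> simp
    · intro i j
      fin_cases i <;> fin_cases j <;> simp [hasDerivAt_const, hexp]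
  have c11 : tot N !![0, 0; 0, Complex.I] * t = t * tot N !![0, 0; 0, Complex.I] := by
    refine tot_comm_of_path ht (a := fun x => !![1, 0; 0, Complex.exp (x * Complex.I)]) ?_ ?_ ?_
    · intro x
      ext i j
      have := hee x
      fin_cases i <;> fin_cases j <;> simp [Matrix.mul_apply]
      simpa using this
    · ext i j
      fin_cases i <;> fin_cases j <;> simp
    · intro i j
      fin_cases i <;> fin_cases j <;> simp [hasDerivAt_const, hexp]
  have c01 : tot N !![0, -1; 1, 0] * t = t * tot N !![0, -1; 1, 0] := by
    refine tot_comm_of_path ht (a := fun x => !![(Real.cos x : ℂ), -(Real.sin x : ℂ);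
      (Real.sin x : ℂ), (Real.cos x : ℂ)]) ?_ ?_ ?_
    · intro x
      ext i j
      have := hcs x
      fin_cases i <;> fin_cases j <;>
        simp [Matrix.mul_apply, -Complex.ofReal_cos, -Complex.ofReal_sin] <;>
        first | ring1 | linear_combination this
    · ext i j
      fin_cases i <;> fin_cases j <;> simp
    · intro i j
      fin_cases i <;> fin_cases j
      exacts [hcos, hsin.neg, hsin, hcos]
  have c10 : tot N !![0, Complex.I; Complex.I, 0] * t =
      t * tot N !![0, Complex.I; Complex.I, 0] := by
    refine tot_comm_of_path ht (a := fun x => !![(Real.cos x : ℂ), Complex.I * (Real.sin x : ℂ);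
      Complex.I * (Real.sin x : ℂ), (Real.cos x : ℂ)]) ?_ ?_ ?_
    · intro x
      ext i j
      have := hcs x
      fin_cases i <;> fin_cases j <;>
        simp [Matrix.mul_apply, -Complex.ofReal_cos, -Complex.ofReal_sin] <;>
        first | ring1 | linear_combination this - (Real.sin x : ℂ) * (Real.sin x : ℂ) * Complex.I_sq
    · ext i j
      fin_cases i <;> fin_cases j <;> simp
    · intro i j
      have h := hsin.const_mul Complex.I
      rw [mul_one] at h
      fin_cases i <;> fin_cases j
      exacts [hcos, h, h, hcos]
  -- the matrix units are complex combinations of the four skew-Hermitian matrices above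
  have key : ∀ (c d : ℂ) (Y Z : Mat2), tot N Y * t = t * tot N Y → tot N Z * t = t * tot N Z →
      tot N (c • Y + d • Z) * t = t * tot N (c • Y + d • Z) := by
    intro c d Y Z hY hZ
    simp only [tot_add, tot_smul, add_mul, mul_add, Matrix.smul_mul, Matrix.mul_smul, hY, hZ]
  intro i j
  fin_cases i <;> fin_cases j
  · convert key (-Complex.I) 0 _ _ c00 c11 using 3 <;> ext i j <;> fin_cases i <;> fin_cases j <;>
      simp [mu]
  · convert key (-1 / 2) (-Complex.I / 2) _ _ c01 c10 using 3 <;> ext i j <;> fin_cases i <;>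
      fin_cases j <;> simp [mu] <;> linear_combination (1 / 2) * Complex.I_sq
  · convert key (1 / 2) (-Complex.I / 2) _ _ c01 c10 using 3 <;> ext i j <;> fin_cases i <;>
      fin_cases j <;> simp [mu] <;> linear_combination (1 / 2) * Complex.I_sq
  · convert key 0 (-Complex.I) _ _ c00 c11 using 3 <;> ext i j <;> fin_cases i <;> fin_cases j <;>
      simp [mu]

/-! ### Invariants under the adjoint action of `K` -/

section

variable {R : Type*} [Ring R] [Algebra ℂ R] {val : Gen → R} {A : Subalgebra ℂ R}

variable (val) in
/-- The algebra endomorphisms `act g` act on the generators as the adjoint action of `K`. -/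
structure IsAdjointAction (act : K → R →ₐ[ℂ] R) : Prop where
  X : ∀ g i j, act g (val (.X i j)) =
    ∑ k, ∑ l, (blk g k i * star (blk g l j)) • val (.X k l)
  col : ∀ g s i, act g (val (.col s i)) = ∑ k, (star (corner g) * blk g k i) • val (.col s k)
  row : ∀ g s j, act g (val (.row s j)) = ∑ l, (corner g * star (blk g l j)) • val (.row s l)

theorem sum_comm₄ {κ M : Type*} [Fintype κ] [AddCommMonoid M] (f : κ → κ → κ → κ → M) :
    ∑ a, ∑ b, ∑ c, ∑ d, f a b c d = ∑ d, ∑ c, ∑ a, ∑ b, f a b c d := by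
  calc _ = ∑ a, ∑ c, ∑ b, ∑ d, f a b c d := Finset.sum_congr rfl fun a _ => Finset.sum_comm
    _ = ∑ c, ∑ a, ∑ b, ∑ d, f a b c d := Finset.sum_comm
    _ = ∑ c, ∑ a, ∑ d, ∑ b, f a b c d :=
      Finset.sum_congr rfl fun c _ => Finset.sum_congr rfl fun a _ => Finset.sum_comm
    _ = ∑ c, ∑ d, ∑ a, ∑ b, f a b c d := Finset.sum_congr rfl fun c _ => Finset.sum_comm
    _ = _ := Finset.sum_comm

theorem sum_blk_mul_star (g : K) (k l : Fin 2) :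
    ∑ i, blk g k i * star (blk g l i) = if k = l then 1 else 0 := by
  have := congrFun (congrFun (blk_mul_conjTranspose g) k) l
  rwa [Matrix.mul_apply, Matrix.one_apply] at this

theorem sum_sum_blk (g : K) (f : Fin 2 → Fin 2 → R) :
    ∑ i, ∑ k, ∑ l, (blk g k i * star (blk g l i)) • f k l = ∑ k, f k k := by
  rw [Finset.sum_comm]
  refine Finset.sum_congr rfl fun k _ => ?_
  rw [Finset.sum_comm]
  simp only [← Finset.sum_smul, sum_blk_mul_star]
  simp

namespace IsAdjointAction
variable {act : K → R →ₐ[ℂ] R} (ha : IsAdjointAction val act)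
include ha

theorem lmat (g : K) (a : Letter) (i j : Fin 2) : act g (lmat val a i j) =
    ∑ k, ∑ l, (blk g k i * star (blk g l j)) • SU21.lmat val a k l := by
  cases a with
  | X => exact ha.X g i j
  | pair c r =>
    have h := star_corner_mul g
    simp only [SU21.lmat, Matrix.of_apply, map_mul, ha.col, ha.row, Finset.sum_mul_sum,
      smul_mul_smul_comm]
    refine Finset.sum_congr rfl fun k _ => Finset.sum_congr rfl fun l _ => ?_
    congr 1
    linear_combination (blk g k i * star (blk g l j)) * h

theorem hom (g : K) {d p : ℕ} {x : R} (hx : x ∈ Hom val d p) : act g x ∈ Hom val d p := by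
  have h1 : ∀ k : Gen, act g (val k) ∈ Hom val 1 k.odd := by
    rintro (⟨i, j⟩ | ⟨s, i⟩ | ⟨s, i⟩)
    · rw [ha.X]
      exact Submodule.sum_mem _ fun k _ => Submodule.sum_mem _ fun l _ =>
        Submodule.smul_mem _ _ (X_mem_hom k l)
    · rw [ha.col]
      exact Submodule.sum_mem _ fun k _ => Submodule.smul_mem _ _ (col_mem_hom s k)
    · rw [ha.row]
      exact Submodule.sum_mem _ fun k _ => Submodule.smul_mem _ _ (row_mem_hom s k)
  induction hx using Submodule.span_induction with
  | zero => simp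
  | add x y _ _ hx hy => rw [map_add]; exact add_mem hx hy
  | smul c x _ hx => rw [map_smul]; exact Submodule.smul_mem _ _ hx
  | mem x hx =>
    obtain ⟨l, rfl, rfl, rfl⟩ := hx
    rw [wprod, map_list_prod, List.map_map]
    have := prod_mem_hom (f := act g ∘ val) (dg := fun _ => 1) h1 l
    simpa [wodd] using this

theorem low (g : K) {n : ℕ} {x : R} (hx : x ∈ Low val n) : act g x ∈ Low val n := by
  induction hx using Submodule.span_induction with
  | zero => simp
  | add x y _ _ hx hy => rw [map_add]; exact add_mem hx hy
  | smul c x _ hx => rw [map_smul]; exact Submodule.smul_mem _ _ hx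
  | mem x hx =>
    obtain ⟨l, hl, rfl⟩ := hx
    exact hom_le_low hl (ha.hom g (wprod_mem_hom l))

theorem shapePairing (g : K) (s : List Letter) (t : Matrix (Idx s.length) (Idx s.length) ℂ) :
    shapePairing val s (tens (fun _ => blk g) * t * (tens fun _ => blk g)ᴴ) =
      act g (shapePairing val s t) := by
  have h1 : ∀ I J, act g (entryProd val (fun k => [s.get k]) (List.finRange s.length) I J) =
      ∑ I', ∑ J', (tens (fun _ => blk g) I' I * star (tens (fun _ => blk g) J' J)) •
        entryProd val (fun k => [s.get k]) (List.finRange s.length) I' J' := by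
    intro I J
    have e : ∀ I J, entryProd val (fun k => [s.get k]) (List.finRange s.length) I J =
        MultilinearMap.mkPiAlgebraFin ℂ s.length R fun k =>
          SU21.lmat val (s.get k) (I k) (J k) := by
      intro I J
      simp [entryProd, MultilinearMap.mkPiAlgebraFin_apply, List.ofFn_eq_map, wmat]
    have e2 : act g (entryProd val (fun k => [s.get k]) (List.finRange s.length) I J) =
        MultilinearMap.mkPiAlgebraFin ℂ s.length R fun k =>
          ∑ c : Fin 2 × Fin 2, (blk g c.1 (I k) * star (blk g c.2 (J k))) •
            SU21.lmat val (s.get k) c.1 c.2 := by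
      rw [e, MultilinearMap.mkPiAlgebraFin_apply, MultilinearMap.mkPiAlgebraFin_apply,
        map_list_prod, List.map_ofFn]
      congr 2
      ext1 k
      rw [Fintype.sum_prod_type]
      exact ha.lmat g _ _ _
    rw [e2, MultilinearMap.map_sum, ← Fintype.sum_prod_type',
      ← (Equiv.arrowProdEquivProdArrow (Fin s.length) (fun _ => Fin 2) (fun _ => Fin 2)).sum_comp]
    refine Finset.sum_congr rfl fun c _ => ?_
    rw [MultilinearMap.map_smul_univ, Finset.prod_mul_distrib, e]
    congr 2
    simp [tens, Equiv.arrowProdEquivProdArrow]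
  rw [SU21.shapePairing, pairing_apply, pairing_apply]
  simp only [map_sum, map_smul, h1, Matrix.mul_apply, Finset.sum_mul, Finset.sum_smul,
    Finset.smul_sum, Matrix.conjTranspose_apply, smul_smul]
  rw [sum_comm₄]
  refine Finset.sum_congr rfl fun I _ => Finset.sum_congr rfl fun J _ =>
    Finset.sum_congr rfl fun I' _ => Finset.sum_congr rfl fun J' _ => ?_
  congr 1
  ring

/-- The product of an equivariant row with `X` is an equivariant row. -/
theorem contract_X {g : K} {v v' : Fin 2 → R}
    (hv : ∀ j, act g (v j) = ∑ l, star (blk g l j) • v' l) (k : Fin 2) :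
    act g (∑ j, v j * val (.X j k)) =
      ∑ m, star (blk g m k) • ∑ l, v' l * val (.X l m) := by
  have e : act g (∑ j, v j * val (.X j k)) = ∑ j, ∑ m, ∑ l, (blk g m j * star (blk g l j)) •
      ∑ n, star (blk g n k) • (v' l * val (.X m n)) := by
    rw [map_sum]
    refine Finset.sum_congr rfl fun j _ => ?_
    rw [map_mul, hv, ha.X, Finset.sum_mul_sum, Finset.sum_comm]
    refine Finset.sum_congr rfl fun m _ => Finset.sum_congr rfl fun l _ => ?_
    rw [Finset.mul_sum, Finset.smul_sum]
    refine Finset.sum_congr rfl fun n _ => ?_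
    rw [smul_mul_smul_comm, smul_smul]
    congr 1
    ring
  rw [e, sum_sum_blk, Finset.sum_comm]
  simp only [Finset.smul_sum]

theorem trX (g : K) : act g (trX val) = trX val := by
  simp only [SU21.trX, map_sum, ha.X, sum_sum_blk]

theorem trXX (g : K) : act g (trXX val) = trXX val := by
  have h : ∀ i, act g (∑ j, val (.X i j) * val (.X j i)) = _ := fun i =>
    ha.contract_X (g := g) (v := fun j => val (.X i j))
      (v' := fun l => ∑ k, blk g k i • val (.X k l)) (fun j => by
        rw [ha.X, Finset.sum_comm]
        simp only [Finset.smul_sum, smul_smul, mul_comm]) i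
  have e : ∀ i, act g (∑ j, val (.X i j) * val (.X j i)) = ∑ k, ∑ m,
      (blk g k i * star (blk g m i)) • ∑ l, val (.X k l) * val (.X l m) := by
    intro i
    rw [h, Finset.sum_comm]
    refine Finset.sum_congr rfl fun m _ => ?_
    simp only [Finset.sum_mul, Finset.smul_sum, smul_mul_assoc, smul_smul]
    rw [Finset.sum_comm]
    refine Finset.sum_congr rfl fun k _ => Finset.sum_congr rfl fun l _ => ?_
    rw [mul_comm]
  rw [SU21.trXX, map_sum]
  simp only [e, sum_sum_blk]

/-- The product of an equivariant row with a column is invariant. -/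
theorem contract_col {g : K} {v v' : Fin 2 → R}
    (hv : ∀ j, act g (v j) = ∑ l, star (blk g l j) • (corner g • v' l)) (c : Bool) :
    act g (∑ i, v i * val (.col c i)) = ∑ i, v' i * val (.col c i) := by
  have h := star_corner_mul g
  have e : act g (∑ i, v i * val (.col c i)) = ∑ i, ∑ k, ∑ l, (blk g k i * star (blk g l i)) •
      (v' l * val (.col c k)) := by
    rw [map_sum]
    refine Finset.sum_congr rfl fun i _ => ?_
    rw [map_mul, hv, ha.col, Finset.sum_mul_sum, Finset.sum_comm]
    refine Finset.sum_congr rfl fun k _ => Finset.sum_congr rfl fun l _ => ?_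
    rw [smul_smul, smul_mul_smul_comm]
    congr 1
    linear_combination (blk g k i * star (blk g l i)) * h
  rw [e, sum_sum_blk]

theorem rowCol (g : K) (r c : Bool) : act g (rowCol val r c) = rowCol val r c :=
  ha.contract_col (v := fun i => val (.row r i)) (fun j => by
    rw [ha.row]
    simp only [smul_smul, mul_comm]) c

theorem rowXCol (g : K) (r c : Bool) : act g (rowXCol val r c) = rowXCol val r c := by
  have e : SU21.rowXCol val r c = ∑ j, (∑ i, val (.row r i) * val (.X i j)) * val (.col c j) := by
    simp only [SU21.rowXCol, Finset.sum_mul]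
    exact Finset.sum_comm
  rw [e]
  refine ha.contract_col (fun j => ?_) c
  rw [ha.contract_X (v' := fun l => corner g • val (.row r l)) (fun j => by
    rw [ha.row]
    simp only [smul_smul, mul_comm])]
  simp only [Finset.smul_sum, smul_mul_assoc]

/-- An element of `K` which is central, and which acts on `𝔭⁺` by a number of infinite order. -/
theorem exists_central : ∃ (g : K) (μ : ℂ), (∀ m : ℤ, μ ^ m = 1 → m = 0) ∧
    ∀ l, act g (wprod val l) = μ ^ wcharge l • wprod val l := by
  -- `diag(e, e, e⁻²)` with `e = exp(i)` acts on `𝔭⁺` by `e ^ 3`, of infinite order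
  -- as `π` is irrational
  set e := Complex.exp Complex.I with he
  have hs : star e * e = 1 := by
    rw [he, Complex.star_def, ← Complex.exp_conj, ← Complex.exp_add]
    simp
  have hs' : star e = e⁻¹ := eq_inv_of_mul_eq_one_left hs
  have h0 : e ≠ 0 := Complex.exp_ne_zero _
  have hu : (e • (1 : Mat2))ᴴ * (e • (1 : Mat2)) = 1 := by
    rw [Matrix.conjTranspose_smul, Matrix.smul_mul, Matrix.mul_smul, smul_smul, hs]
    simp
  refine ⟨kOf (e • 1) hu, e ^ 3, ?_, ?_⟩
  · intro m hm
    rw [he, ← Complex.exp_nat_mul, ← Complex.exp_int_mul, Complex.exp_eq_one_iff] at hm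
    obtain ⟨n, hn⟩ := hm
    have h1 : (m : ℂ) * 3 = n * (2 * Real.pi) := by
      have := mul_right_cancel₀ (b := Complex.I) Complex.I_ne_zero
        (show (m : ℂ) * 3 * Complex.I = n * (2 * Real.pi) * Complex.I by
          push_cast at hn
          linear_combination hn)
      exact this
    have h2 : (m : ℝ) * 3 = n * (2 * Real.pi) := by exact_mod_cast h1
    by_contra hm0
    have hn0 : (n : ℝ) ≠ 0 := fun h => by
      rw [h, zero_mul] at h2
      have : (m : ℝ) = 0 := by linarith
      exact hm0 (by exact_mod_cast this)
    refine irrational_pi ⟨(m * 3 : ℚ) / (n * 2), ?_⟩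
    push_cast
    field_simp
    linarith
  · have hb : ∀ i j, blk (kOf (e • 1) hu) i j = if i = j then e else 0 := by
      intro i j
      rw [blk_kOf, Matrix.smul_apply, Matrix.one_apply]
      split_ifs <;> simp
    have hc : corner (kOf (e • 1) hu) = e⁻¹ ^ 2 := by
      rw [corner_kOf, Matrix.det_smul, Matrix.det_one, Fintype.card_fin, mul_one, star_pow, hs']
    have hg : ∀ k : Gen, act (kOf (e • 1) hu) (val k) = (e ^ 3) ^ k.charge • val k := by
      rintro (⟨i, j⟩ | ⟨s, i⟩ | ⟨s, i⟩)
      · rw [ha.X]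
        have : ∀ k l, (blk (kOf (e • 1) hu) k i * star (blk (kOf (e • 1) hu) l j)) • val (.X k l)
            = if l = j then (if k = i then val (.X k l) else 0) else 0 := by
          intro k l
          rw [hb, hb]
          split_ifs
          · rw [mul_comm, hs, one_smul]
          all_goals simp
        simp only [this, Gen.charge, Finset.sum_ite_eq', Finset.mem_univ, if_true, zpow_zero,
          one_smul]
      · rw [ha.col]
        simp only [hb, hc, star_pow, star_inv₀, hs', inv_inv, mul_ite, mul_zero, ite_smul,
          zero_smul, Finset.sum_ite_eq', Finset.mem_univ, if_true, Gen.charge, zpow_one]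
        rw [← pow_succ]
      · rw [ha.row]
        simp only [hb, hc, apply_ite star, star_zero, hs', mul_ite, mul_zero, ite_smul,
          zero_smul, Finset.sum_ite_eq', Finset.mem_univ, if_true, Gen.charge, zpow_neg, zpow_one]
        congr 1
        ring
    intro l
    induction l with
    | nil => simp [wprod, wcharge]
    | cons k l ih =>
      have h3 : e ^ 3 ≠ 0 := pow_ne_zero _ h0
      simp only [wprod, wcharge, List.map_cons, List.prod_cons, List.sum_cons, map_mul] at ih ⊢
      rw [ih, hg, smul_mul_smul_comm, zpow_add₀ h3]

/-- Words of different charge lie in different eigenspaces of a central element of `K`, so an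
invariant is a combination of words of charge zero. -/
theorem mem_balanced {n : ℕ} {x : R} (hx : x ∈ Low val n) (h : ∀ g, act g x = x) :
    x ∈ Balanced val n := by
  obtain ⟨g, μ, hμ, hg⟩ := ha.exists_central
  set T : Module.End ℂ R := (act g).toLinearMap with hT
  have h1 : Low val n ≤ Balanced val n ⊔
      (Low val n ⊓ ⨆ (ν : ℂ) (_ : ν ≠ 1), T.eigenspace ν) := by
    refine Submodule.span_le.mpr ?_
    rintro _ ⟨l, hl, rfl⟩
    by_cases h0 : wcharge l = 0
    · exact Submodule.mem_sup_left (Submodule.subset_span ⟨l, hl, h0, rfl⟩)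
    · refine Submodule.mem_sup_right ⟨wprod_mem_low hl, ?_⟩
      refine Submodule.mem_iSup_of_mem (μ ^ wcharge l) (Submodule.mem_iSup_of_mem
        (fun h => h0 (hμ _ h)) ?_)
      rw [Module.End.mem_eigenspace_iff]
      exact hg l
  have h2 : Balanced val n ≤ T.eigenspace 1 := by
    refine Submodule.span_le.mpr ?_
    rintro _ ⟨l, hl, h0, rfl⟩
    rw [SetLike.mem_coe, Module.End.mem_eigenspace_iff]
    exact (hg l).trans (by rw [h0, zpow_zero])
  obtain ⟨y, hy, z, ⟨-, hz⟩, rfl⟩ := Submodule.mem_sup.mp (h1 hx)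
  have h3 : y + z ∈ T.eigenspace 1 := by
    rw [Module.End.mem_eigenspace_iff, one_smul]
    exact h g
  have h4 : z ∈ T.eigenspace 1 := by simpa using sub_mem h3 (h2 hy)
  have h5 : z = 0 := Submodule.disjoint_def.mp (T.eigenspaces_iSupIndep 1) z h4 hz
  rwa [h5, add_zero]

/-- If `K` acts on an algebra by the adjoint action on its generators, then the subalgebra `A` of
invariants contains all invariants as soon as it contains the basic contractions. -/
theorem mem_of_invariant (hc : SuperComm val) (hA : HasContractions val A)
    (hAinv : ∀ x ∈ A, ∀ g, act g x = x) (htop : ∀ x : R, ∃ n, x ∈ Low val n)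
    {x : R} (hx : ∀ g, act g x = x) : x ∈ A := by
  obtain ⟨n, hn⟩ := htop x
  let f : K → ∀ N, Matrix (Idx N) (Idx N) ℂ →ₗ[ℂ] Matrix (Idx N) (Idx N) ℂ := fun g N =>
    LinearMap.mulLeft ℂ (tens fun _ => blk g) ∘ₗ LinearMap.mulRight ℂ (tens fun _ => blk g)ᴴ -
      LinearMap.id
  have hf : ∀ g N t, f g N t = tens (fun _ => blk g) * t * (tens fun _ => blk g)ᴴ - t := by
    intro g N t
    simp [f, mul_assoc]
  have hinv : ∀ (g : K) N, (tens fun _ : Fin N => blk g⁻¹) = (tens fun _ => blk g)ᴴ := by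
    intro g N
    rw [tens_conjTranspose, blk_inv]
  refine SU21.mem_of_invariant hc hA (fun g : K => g⁻¹)
    (fun g => (act g).toLinearMap - LinearMap.id) f ?_ ?_ ?_ ?_ ?_ ?_ hn ?_
  · intro g N t t'
    rw [hf, hf, hinv, Matrix.conjTranspose_conjTranspose]
    simp only [Matrix.conjTranspose_sub, Matrix.conjTranspose_mul,
      Matrix.conjTranspose_conjTranspose, sub_mul, mul_sub, Matrix.trace_sub, mul_assoc]
    rw [Matrix.trace_mul_comm]
    simp only [mul_assoc]
  · intro N t ht
    refine isEquivariant_of_group fun g => ?_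
    have h1 := ht g
    rw [hf, sub_eq_zero] at h1
    have h2 : (tens fun _ : Fin N => blk g)ᴴ * (tens fun _ => blk g) = 1 := by
      rw [tens_conjTranspose, tens_mul, ← tens_one]
      congr 1
      ext1 k
      exact blk_conjTranspose_mul g
    nth_rw 2 [← h1]
    rw [mul_assoc, h2, mul_one]
  · intro g s t
    rw [hf, map_sub, ha.shapePairing]
    simp
  · intro g n y hy
    exact sub_mem (ha.low g hy) hy
  · intro g y hy
    simp [hAinv y hy g]
  · intro n y hy h
    exact ha.mem_balanced hy fun g => sub_eq_zero.mp (h g)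
  · intro g
    simp [hx g]

end IsAdjointAction

end

/-! ### Central elements -/

section

variable {R : Type*} [Ring R] [Algebra ℂ R] {val : Gen → R} {A : Subalgebra ℂ R}

theorem sum_slot_smul {N : ℕ} {M : Type*} [AddCommGroup M] [Module ℂ M] (p : Fin N) (a b : Fin 2)
    (f : Idx N → M) (K : Idx N) :
    ∑ I, slot p (mu a b) I K • f I = if K p = b then f (Function.update K p a) else 0 := by
  rw [Finset.sum_eq_single (Function.update K p a)]
  · rw [slot_apply]
    simp +contextual [mu, Matrix.single_apply, eq_comm]
  · intro I _ hI
    rw [slot_apply]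
    split_ifs with h
    · have : I p ≠ a := fun h' => hI (by
        ext1 k
        by_cases hk : k = p
        · subst hk; simp [h']
        · simp [hk, h k hk])
      simp [mu, this.symm]
    · simp
  · simp

theorem sum_slot_smul' {N : ℕ} {M : Type*} [AddCommGroup M] [Module ℂ M] (p : Fin N) (a b : Fin 2)
    (f : Idx N → M) (K : Idx N) :
    ∑ I, slot p (mu a b) K I • f I = if K p = a then f (Function.update K p b) else 0 := by
  rw [← sum_slot_smul]
  refine Finset.sum_congr rfl fun I _ => ?_
  congr 1
  simp only [slot_apply, mu, Matrix.single_apply, eq_comm, and_comm]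

/-- The Leibniz rule for the commutator with a product. -/
theorem commutator_list_prod {N : ℕ} (x : R) (m : Fin N → R) :
    x * MultilinearMap.mkPiAlgebraFin ℂ N R m - MultilinearMap.mkPiAlgebraFin ℂ N R m * x =
      ∑ p, MultilinearMap.mkPiAlgebraFin ℂ N R (Function.update m p (x * m p - m p * x)) := by
  induction N with
  | zero => simp
  | succ N ih =>
    have h := ih fun k => m k.succ
    simp only [MultilinearMap.mkPiAlgebraFin_apply, List.ofFn_succ, List.prod_cons] at h ⊢
    rw [Fin.sum_univ_succ]
    have e : ∀ p : Fin N, (List.ofFn fun k : Fin N => Function.update m p.succ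
        (x * m p.succ - m p.succ * x) k.succ) = List.ofFn (Function.update (fun k => m k.succ) p
        (x * m p.succ - m p.succ * x)) := by
      intro p
      congr 1
      ext1 k
      by_cases hk : k = p
      · subst hk; simp
      · simp [hk]
    simp only [Function.update_self, e, Function.update_of_ne (Fin.succ_ne_zero _),
      Function.update_of_ne (Fin.succ_ne_zero _).symm, ← Finset.mul_sum, ← h]
    noncomm_ring

variable (val) in
/-- The elements `X a b` act on the basic matrices by commutators as on the matrix units. -/
def IsLieAction : Prop :=
  ∀ (a b : Fin 2) (c : Letter) (i j : Fin 2),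
    val (.X a b) * lmat val c i j - lmat val c i j * val (.X a b) =
      (if i = b then lmat val c a j else 0) - if j = a then lmat val c i b else 0

theorem IsLieAction.shapePairing (hL : IsLieAction val) (a b : Fin 2) (s : List Letter)
    (t : Matrix (Idx s.length) (Idx s.length) ℂ) :
    shapePairing val s (tot _ (mu a b) * t - t * tot _ (mu a b)) =
      val (.X a b) * shapePairing val s t - shapePairing val s t * val (.X a b) := by
  set e := entryProd val (fun k => [s.get k]) (List.finRange s.length) with he
  have e0 : ∀ I J, e I J =
      MultilinearMap.mkPiAlgebraFin ℂ s.length R fun k => lmat val (s.get k) (I k) (J k) := by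
    intro I J
    simp [he, entryProd, MultilinearMap.mkPiAlgebraFin_apply, List.ofFn_eq_map, wmat]
  have e1 : ∀ I J, val (.X a b) * e I J - e I J * val (.X a b) =
      ∑ p, ((if I p = b then e (Function.update I p a) J else 0) -
        if J p = a then e I (Function.update J p b) else 0) := by
    intro I J
    rw [e0, commutator_list_prod]
    refine Finset.sum_congr rfl fun p _ => ?_
    rw [hL, MultilinearMap.map_update_sub]
    congr 1
    · split_ifs
      · rw [e0]
        congr 1
        ext1 k
        by_cases hk : k = p
        · subst hk; simp
        · simp [hk]
      · rw [MultilinearMap.map_update_zero]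
    · split_ifs
      · rw [e0]
        congr 1
        ext1 k
        by_cases hk : k = p
        · subst hk; simp
        · simp [hk]
      · rw [MultilinearMap.map_update_zero]
  have e2 : ∀ I J, val (.X a b) * e I J - e I J * val (.X a b) =
      ∑ I', tot _ (mu a b) I' I • e I' J - ∑ J', tot _ (mu a b) J J' • e I J' := by
    intro I J
    simp only [e1, tot, Matrix.sum_apply, Finset.sum_smul, Finset.sum_sub_distrib]
    rw [Finset.sum_comm, Finset.sum_comm (γ := Idx s.length)]
    simp only [sum_slot_smul (f := fun I' => e I' J), sum_slot_smul']
  have e3 : val (.X a b) * SU21.shapePairing val s t - SU21.shapePairing val s t * val (.X a b) =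
      ∑ I, ∑ J, t I J • (val (.X a b) * e I J - e I J * val (.X a b)) := by
    simp only [SU21.shapePairing, pairing_apply, ← he, Finset.mul_sum, Finset.sum_mul,
      mul_smul_comm, smul_mul_assoc, smul_sub, Finset.sum_sub_distrib]
  rw [e3, SU21.shapePairing, pairing_apply, ← he]
  simp only [e2, smul_sub, Matrix.sub_apply, sub_smul, Finset.sum_sub_distrib, Matrix.mul_apply,
    Finset.sum_smul, Finset.smul_sum, smul_smul]
  congr 1
  · calc _ = ∑ J, ∑ I', ∑ I, (tot _ (mu a b) I' I * t I J) • e I' J := Finset.sum_comm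
      _ = ∑ J, ∑ I, ∑ I', (tot _ (mu a b) I' I * t I J) • e I' J :=
        Finset.sum_congr rfl fun J _ => Finset.sum_comm
      _ = ∑ I, ∑ J, ∑ I', (tot _ (mu a b) I' I * t I J) • e I' J := Finset.sum_comm
      _ = _ := by simp only [mul_comm (t _ _)]
  · exact Finset.sum_congr rfl fun I _ => Finset.sum_comm

/-- If the generators outside `𝔨` vanish, then the subalgebra `A` of central elements contains the
center as soon as it contains the basic contractions. -/
theorem IsLieAction.mem_of_central (hL : IsLieAction val) (hcol : ∀ s i, val (.col s i) = 0)
    (hrow : ∀ s i, val (.row s i) = 0) (hc : SuperComm val) (hA : HasContractions val A)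
    (hAcen : ∀ x ∈ A, ∀ y, y * x = x * y) (htop : ∀ x : R, ∃ n, x ∈ Low val n)
    {x : R} (hx : ∀ y, y * x = x * y) : x ∈ A := by
  obtain ⟨n, hn⟩ := htop x
  refine mem_of_invariant hc hA (fun i : Fin 2 × Fin 2 => (i.2, i.1))
    (fun i => LinearMap.mulLeft ℂ (val (.X i.1 i.2)) - LinearMap.mulRight ℂ (val (.X i.1 i.2)))
    (fun i N => LinearMap.mulLeft ℂ (tot N (mu i.1 i.2)) -
      LinearMap.mulRight ℂ (tot N (mu i.1 i.2)))
    ?_ ?_ ?_ ?_ ?_ ?_ hn ?_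
  · intro i N t t'
    have h : (tot N (mu i.1 i.2))ᴴ = tot N (mu i.2 i.1) := by
      rw [tot_conjTranspose]
      simp [mu]
    simp only [LinearMap.sub_apply, LinearMap.mulLeft_apply, LinearMap.mulRight_apply,
      Matrix.conjTranspose_sub, Matrix.conjTranspose_mul, h, sub_mul, mul_sub, Matrix.trace_sub,
      mul_assoc]
    congr 1
    rw [Matrix.trace_mul_comm, mul_assoc]
  · intro N t ht a b
    exact sub_eq_zero.mp (ht (a, b))
  · intro i s t
    exact hL.shapePairing i.1 i.2 s t
  · intro i n y hy
    induction hy using Submodule.span_induction with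
    | zero => simp
    | add x y _ _ hx hy => rw [map_add]; exact add_mem hx hy
    | smul c x _ hx => rw [map_smul]; exact Submodule.smul_mem _ _ hx
    | mem x hx =>
      obtain ⟨l, hl, rfl⟩ := hx
      have := hc.hom_comm (X_mem_hom i.1 i.2) (wprod_mem_hom l)
      rw [zero_mul, pow_zero, one_smul] at this
      exact low_mono (by omega) this
  · intro i y hy
    exact sub_eq_zero.mpr (hAcen y hy _)
  · intro n y hy _
    refine Submodule.span_le.mpr ?_ hy
    rintro _ ⟨l, hl, rfl⟩
    by_cases h : ∀ g ∈ l, ∃ i j, g = Gen.X i j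
    · refine Submodule.subset_span ⟨l, hl, ?_, rfl⟩
      refine List.sum_eq_zero fun c hc => ?_
      obtain ⟨g, hg, rfl⟩ := List.mem_map.mp hc
      obtain ⟨i, j, rfl⟩ := h g hg
      rfl
    · push Not at h
      obtain ⟨g, hg, h⟩ := h
      have h0 : wprod val l = 0 := by
        refine List.prod_eq_zero (List.mem_map.mpr ⟨g, hg, ?_⟩)
        cases g with
        | X i j => exact absurd rfl (h i j)
        | col s i => exact hcol s i
        | row s i => exact hrow s i
      rw [h0]
      exact zero_mem _
  · intro i
    exact sub_eq_zero.mpr (hx _)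

end

/-! ### Relations in `U(𝔤) ⊗ C(𝔭)` -/

section

variable {R : Type*} [Ring R]

theorem assoc_of_mul_eq {a b c : R} (h : a * b = c) (z : R) : a * (b * z) = c * z := by
  rw [← mul_assoc, h]

theorem eq_zero_of_eq_neg [Algebra ℂ R] {x : R} (h : x = -x) : x = 0 := by
  have : (2 : ℂ) • x = 0 := by rw [two_smul]; exact eq_neg_iff_add_eq_zero.mp h
  simpa using this

variable [Algebra ℂ R] {val : Gen → R} {A : Subalgebra ℂ R}

variable (val) in
/-- The relations between the generators in `U(𝔤) ⊗ C(𝔭)`. -/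
structure DiracRelations : Prop where
  X_X : ∀ a b c d, val (.X a b) * val (.X c d) = val (.X c d) * val (.X a b) +
    ((if b = c then val (.X a d) else 0) - if d = a then val (.X c b) else 0)
  X_col : ∀ a b k, val (.X a b) * val (.col false k) = val (.col false k) * val (.X a b) +
    ((if b = k then val (.col false a) else 0) + if a = b then val (.col false k) else 0)
  X_row : ∀ a b k, val (.X a b) * val (.row false k) = val (.row false k) * val (.X a b) -
    ((if k = a then val (.row false b) else 0) + if a = b then val (.row false k) else 0)
  col_col : ∀ i j, val (.col false i) * val (.col false j) = val (.col false j) * val (.col false i)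
  row_row : ∀ i j, val (.row false i) * val (.row false j) = val (.row false j) * val (.row false i)
  col_row : ∀ i j, val (.col false i) * val (.row false j) =
    val (.row false j) * val (.col false i) + val (.X i j)
  comm : ∀ g h : Gen, g.odd = 1 → h.odd = 0 → val g * val h = val h * val g
  ccol_crow : ∀ i j, val (.col true i) * val (.row true j) =
    -(val (.row true j) * val (.col true i)) - if i = j then (2 : ℂ) • (1 : R) else 0
  ccol_ccol : ∀ i j, val (.col true i) * val (.col true j) =
    -(val (.col true j) * val (.col true i))
  crow_crow : ∀ i j, val (.row true i) * val (.row true j) =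
    -(val (.row true j) * val (.row true i))

namespace DiracRelations
variable (hR : DiracRelations val)
include hR

theorem ccol_X (i a b : Fin 2) :
    val (.col true i) * val (.X a b) = val (.X a b) * val (.col true i) :=
  hR.comm _ _ rfl rfl

theorem crow_X (i a b : Fin 2) :
    val (.row true i) * val (.X a b) = val (.X a b) * val (.row true i) :=
  hR.comm _ _ rfl rfl

theorem ccol_col (i a : Fin 2) :
    val (.col true i) * val (.col false a) = val (.col false a) * val (.col true i) :=
  hR.comm _ _ rfl rfl

theorem crow_col (i a : Fin 2) :
    val (.row true i) * val (.col false a) = val (.col false a) * val (.row true i) :=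
  hR.comm _ _ rfl rfl

theorem ccol_row (i a : Fin 2) :
    val (.col true i) * val (.row false a) = val (.row false a) * val (.col true i) :=
  hR.comm _ _ rfl rfl

theorem crow_row (i a : Fin 2) :
    val (.row true i) * val (.row false a) = val (.row false a) * val (.row true i) :=
  hR.comm _ _ rfl rfl

theorem ccol_self (i : Fin 2) : val (.col true i) * val (.col true i) = 0 :=
  eq_zero_of_eq_neg (hR.ccol_ccol i i)

theorem crow_self (i : Fin 2) : val (.row true i) * val (.row true i) = 0 :=
  eq_zero_of_eq_neg (hR.crow_crow i i)

set_option linter.unusedSimpArgs false in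
/-- The exact relations between the contractions, by reduction of both sides to the normal order
in which `row false`, `col false`, `X`, `row true`, `col true` follow each other.  Here
`rowCol val true false + rowCol val false true` is the Dirac operator. -/
theorem contraction_relations :
    (rowCol val true true * rowCol val true false - rowCol val true false * rowCol val true true
      = (-2 : ℂ) • rowCol val true false) ∧
    (rowCol val true true * rowCol val false true - rowCol val false true * rowCol val true true
      = (2 : ℂ) • rowCol val false true) ∧
    (rowCol val false true * rowCol val true false + rowCol val true false * rowCol val false
      true = rowXCol val true true - (2 : ℂ) • rowCol val false false) ∧
    (rowXCol val true true * rowCol val false true - rowCol val false true * rowXCol val true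
      true = (2 : ℂ) • rowXCol val false true) ∧
    (rowXCol val true true * rowCol val true false - rowCol val true false * rowXCol val true
      true = (6 : ℂ) • rowCol val true false - rowCol val true false * (rowCol val true true +
      (4 : ℂ) • 1) + rowCol val true true * rowCol val true false - (2 : ℂ) • rowXCol val true
      false) ∧
    (rowXCol val false true * rowCol val true false + rowCol val true false * rowXCol val false
      true = (-2 : ℂ) • rowXCol val false false - rowCol val false false * rowCol val true true
      - (rowCol val true false * rowCol val false true - rowXCol val true true) + (trX val *
      rowXCol val true true + rowXCol val true true - ((1 / 2 : ℂ) • (trX val * trX val - trXX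
      val + trX val)) * rowCol val true true)) := by
  refine ⟨?_, ?_, ?_, ?_, ?_, ?_⟩ <;>
    simp only [rowCol, rowXCol, trX, trXX, Fin.sum_univ_two, mul_add, add_mul, mul_assoc,
      hR.ccol_X, assoc_of_mul_eq (hR.ccol_X _ _ _), hR.crow_X, assoc_of_mul_eq (hR.crow_X _ _
      _), hR.ccol_col, assoc_of_mul_eq (hR.ccol_col _ _), hR.crow_col, assoc_of_mul_eq
      (hR.crow_col _ _), hR.ccol_row, assoc_of_mul_eq (hR.ccol_row _ _), hR.crow_row,
      assoc_of_mul_eq (hR.crow_row _ _), hR.ccol_crow, assoc_of_mul_eq (hR.ccol_crow _ _),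
      hR.ccol_self, assoc_of_mul_eq (hR.ccol_self _), hR.crow_self, assoc_of_mul_eq
      (hR.crow_self _), hR.ccol_ccol 1 0, assoc_of_mul_eq (hR.ccol_ccol 1 0), hR.crow_crow 1 0,
      assoc_of_mul_eq (hR.crow_crow 1 0), hR.X_col, assoc_of_mul_eq (hR.X_col _ _ _), hR.X_row,
      assoc_of_mul_eq (hR.X_row _ _ _), hR.col_row, assoc_of_mul_eq (hR.col_row _ _), hR.X_X 1 1
      0 0, assoc_of_mul_eq (hR.X_X 1 1 0 0), hR.X_X 1 1 0 1, assoc_of_mul_eq (hR.X_X 1 1 0 1),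
      hR.X_X 1 1 1 0, assoc_of_mul_eq (hR.X_X 1 1 1 0), hR.X_X 1 0 0 0, assoc_of_mul_eq (hR.X_X
      1 0 0 0), hR.X_X 1 0 0 1, assoc_of_mul_eq (hR.X_X 1 0 0 1), hR.X_X 0 1 0 0,
      assoc_of_mul_eq (hR.X_X 0 1 0 0), sub_mul, neg_mul, mul_sub, mul_neg, neg_neg,
      smul_mul_assoc, mul_smul_comm, one_mul, mul_one, smul_add, smul_sub, smul_neg, if_true,
      zero_mul, mul_zero, zero_ne_one, one_ne_zero, if_false, add_zero, zero_add, sub_zero,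
      zero_sub, neg_zero, smul_zero] <;>
    module


/-- The trace of `X`, the trace of `X ^ 2`, `⟨η, ξ⟩`, the Dirac operator and `⟨η, X ξ⟩` generate all
contractions: the two halves of the Dirac operator are its eigencomponents under the commutator
with `⟨η, ξ⟩`, and the remaining contractions appear in their commutators. -/
theorem hasContractions (h1 : trX val ∈ A) (h2 : trXX val ∈ A) (h3 : rowCol val true true ∈ A)
    (h4 : rowCol val true false + rowCol val false true ∈ A) (h5 : rowXCol val true true ∈ A) :
    HasContractions val A := by
  obtain ⟨e1, e2, e3, e4, e5, e6⟩ := hR.contraction_relations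
  have aux : ∀ {c : ℂ} {x y : R}, c ≠ 0 → y ∈ A → c • x = y → x ∈ A := fun {c x y} hc hy h => by
    rw [← inv_smul_smul₀ hc x, h]
    exact A.smul_mem hy _
  have hS : ∀ (c : ℂ) {x : R}, x ∈ A → c • x ∈ A := fun c _ hx => A.smul_mem hx c
  generalize ht : trX val = t at *
  generalize hq : trXX val = q at *
  generalize hh : rowCol val true true = h at *
  generalize hXS : rowXCol val true true = S at *
  generalize hDe : rowCol val true false = De at *
  generalize hDx : rowCol val false true = Dx at *
  -- `4 De = 2 (De + Dx) - [h, De + Dx]`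
  have hDe' : De ∈ A := by
    refine aux (c := 4) (by norm_num) (A.sub_mem (hS 2 h4)
      (A.sub_mem (A.mul_mem h3 h4) (A.mul_mem h4 h3))) ?_
    have e : h * (De + Dx) - (De + Dx) * h = (-2 : ℂ) • De + (2 : ℂ) • Dx := by
      rw [← e1, ← e2]; noncomm_ring
    rw [e]; module
  have hDx' : Dx ∈ A := by simpa using A.sub_mem h4 hDe'
  have hyx : rowCol val false false ∈ A := by
    refine aux (c := 2) (by norm_num) (A.sub_mem h5
      (A.add_mem (A.mul_mem hDx' hDe') (A.mul_mem hDe' hDx'))) ?_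
    rw [e3]; module
  have hT : rowXCol val false true ∈ A :=
    aux (by norm_num) (A.sub_mem (A.mul_mem h5 hDx') (A.mul_mem hDx' h5)) e4.symm
  have hT' : rowXCol val true false ∈ A := by
    refine aux (c := 2) (by norm_num) (A.sub_mem (A.add_mem (A.sub_mem (hS 6 hDe')
      (A.mul_mem hDe' (A.add_mem h3 (hS 4 A.one_mem)))) (A.mul_mem h3 hDe'))
      (A.sub_mem (A.mul_mem h5 hDe') (A.mul_mem hDe' h5))) ?_
    rw [e5]; module
  have hyXx : rowXCol val false false ∈ A := by
    have hU := A.sub_mem (A.add_mem (A.mul_mem h1 h5) h5) (A.mul_mem (hS (1 / 2)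
      (A.add_mem (A.sub_mem (A.mul_mem h1 h1) h2) h1)) h3)
    have hV := A.sub_mem (A.mul_mem hDe' hDx') h5
    refine aux (c := 2) (by norm_num) (A.sub_mem (A.add_mem (A.sub_mem
      (A.neg_mem (A.mul_mem hyx h3)) hV) hU)
      (A.add_mem (A.mul_mem hT hDe') (A.mul_mem hDe' hT))) ?_
    rw [e6]; module
  refine ⟨ht ▸ h1, hq ▸ h2, ?_, ?_⟩
  · rintro (_ | _) (_ | _)
    exacts [hyx, hDx ▸ hDx', hDe ▸ hDe', hh ▸ h3]
  · rintro (_ | _) (_ | _)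
    exacts [hyXx, hT, hT', hXS ▸ h5]

end DiracRelations

end

/-! ### Bases of `𝔨` and `𝔭` -/

/-- The basis `e_{ij} - δ_{ij} e_{33}` of `𝔨`, which identifies `𝔨` with `𝔤𝔩(2)`. -/
noncomputable def kX (i j : Fin 2) : kk := !![(2 : ℂ) • kH1 + kH2, kE; kF, kH1 + (2 : ℂ) • kH2] i j

/-- The basis `E₁, E₂` of `𝔭⁺`. -/
noncomputable def pCol : Fin 2 → pp := ![pE1, pE2]

/-- The basis `F₁, F₂` of `𝔭⁻`. -/
noncomputable def pRow : Fin 2 → pp := ![pF1, pF2]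

theorem coe_kX (i j : Fin 2) : ((kX i j : sl3) : Mat) =
    Matrix.single i.castSucc j.castSucc 1 - if i = j then Matrix.single 2 2 1 else 0 := by
  fin_cases i <;> fin_cases j <;> ext a b <;> fin_cases a <;> fin_cases b <;>
    simp [kX, kH1, kH2, kE, kF, H1, H2, E, F] <;> norm_num

theorem coe_pCol (i : Fin 2) : ((pCol i : sl3) : Mat) = Matrix.single i.castSucc 2 1 := by
  fin_cases i <;> rfl

theorem coe_pRow (i : Fin 2) : ((pRow i : sl3) : Mat) = Matrix.single 2 i.castSucc 1 := by
  fin_cases i <;> rfl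

theorem coe_lie (X Y : sl3) :
    ((⁅X, Y⁆ : sl3) : Mat) = (X : Mat) * (Y : Mat) - (Y : Mat) * (X : Mat) := rfl

theorem lie_kX_kX (a b c d : Fin 2) :
    ⁅kX a b, kX c d⁆ = (if b = c then kX a d else 0) - if d = a then kX c b else 0 := by
  have h : ∀ i : Fin 2, (2 : Fin 3) ≠ i.castSucc := by decide
  have h' : ∀ i j : Fin 2, i.castSucc = j.castSucc ↔ i = j := by decide
  apply Subtype.ext
  apply Subtype.ext
  rw [LieSubalgebra.coe_bracket, coe_lie, coe_kX, coe_kX]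
  fin_cases a <;> fin_cases b <;> fin_cases c <;> fin_cases d <;> simp [coe_kX, sub_mul, mul_sub]

theorem lie_kX_pCol (a b k : Fin 2) : ⁅(kX a b : sl3), (pCol k : sl3)⁆ =
    (if b = k then (pCol a : sl3) else 0) + if a = b then (pCol k : sl3) else 0 := by
  apply Subtype.ext
  rw [coe_lie, coe_kX, coe_pCol]
  fin_cases a <;> fin_cases b <;> fin_cases k <;> simp [coe_pCol, sub_mul, mul_sub]

theorem lie_kX_pRow (a b k : Fin 2) : ⁅(kX a b : sl3), (pRow k : sl3)⁆ =
    -((if k = a then (pRow b : sl3) else 0) + if a = b then (pRow k : sl3) else 0) := by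
  apply Subtype.ext
  rw [coe_lie, coe_kX, coe_pRow]
  fin_cases a <;> fin_cases b <;> fin_cases k <;> simp [coe_pRow, sub_mul, mul_sub] <;>
    abel

theorem lie_pCol_pRow (i j : Fin 2) : ⁅(pCol i : sl3), (pRow j : sl3)⁆ = kX i j := by
  apply Subtype.ext
  rw [coe_lie, coe_kX, coe_pCol, coe_pRow]
  fin_cases i <;> fin_cases j <;> simp

theorem lie_pCol_pCol (i j : Fin 2) : ⁅(pCol i : sl3), (pCol j : sl3)⁆ = 0 := by
  apply Subtype.ext
  rw [coe_lie, coe_pCol, coe_pCol]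
  fin_cases i <;> fin_cases j <;> simp

theorem lie_pRow_pRow (i j : Fin 2) : ⁅(pRow i : sl3), (pRow j : sl3)⁆ = 0 := by
  apply Subtype.ext
  rw [coe_lie, coe_pRow, coe_pRow]
  fin_cases i <;> fin_cases j <;> simp

theorem B_pCol_pRow (i j : Fin 2) : B (pCol i) (pRow j) = if i = j then 1 else 0 := by
  rw [B_apply, coe_pCol, coe_pRow]
  fin_cases i <;> fin_cases j <;> simp

theorem B_pCol_pCol (i j : Fin 2) : B (pCol i) (pCol j) = 0 := by
  rw [B_apply, coe_pCol, coe_pCol]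
  fin_cases i <;> fin_cases j <;> simp

theorem B_pRow_pRow (i j : Fin 2) : B (pRow i) (pRow j) = 0 := by
  rw [B_apply, coe_pRow, coe_pRow]
  fin_cases i <;> fin_cases j <;> simp

theorem eq_sum_sl3 (X : sl3) : X =
    (∑ i : Fin 2, ∑ j : Fin 2, (X : Mat) i.castSucc j.castSucc • (kX i j : sl3)) +
      (∑ i : Fin 2, (X : Mat) i.castSucc 2 • (pCol i : sl3)) +
        ∑ i : Fin 2, (X : Mat) 2 i.castSucc • (pRow i : sl3) := by
  have htr : Matrix.trace X.1 = 0 := X.2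
  rw [Matrix.trace_fin_three] at htr
  apply Subtype.ext
  rw [Fin.sum_univ_two, Fin.sum_univ_two, Fin.sum_univ_two, Fin.sum_univ_two, Fin.sum_univ_two]
  ext a b
  fin_cases a <;> fin_cases b <;> simp [coe_kX, coe_pCol, coe_pRow]
  linear_combination htr

theorem eq_sum_kX (X : kk) :
    X = ∑ i : Fin 2, ∑ j : Fin 2, ((X : sl3) : Mat) i.castSucc j.castSucc • kX i j := by
  have hX : gam * X.1.1 * gam = X.1.1 := X.2
  have h1 : ∀ i : Fin 2, X.1.1 i.castSucc 2 = 0 := fun i => by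
    have := congrFun (congrFun hX i.castSucc) 2
    fin_cases i <;> simp [gam] at this ⊢ <;> linear_combination (-1 / 2) * this
  have h2 : ∀ i : Fin 2, X.1.1 2 i.castSucc = 0 := fun i => by
    have := congrFun (congrFun hX 2) i.castSucc
    fin_cases i <;> simp [gam] at this ⊢ <;> linear_combination (-1 / 2) * this
  apply Subtype.ext
  have := eq_sum_sl3 X
  simp only [h1, h2, zero_smul, Finset.sum_const_zero, add_zero] at this
  simpa using this

theorem eq_sum_pCol_pRow (v : pp) : v = (∑ i : Fin 2, ((v : sl3) : Mat) i.castSucc 2 • pCol i) +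
    ∑ i : Fin 2, ((v : sl3) : Mat) 2 i.castSucc • pRow i := by
  have hv : gam * v.1.1 * gam = -v.1.1 := v.2
  have h : ∀ i j : Fin 2, v.1.1 i.castSucc j.castSucc = 0 := fun i j => by
    have := congrFun (congrFun hv i.castSucc) j.castSucc
    fin_cases i <;> fin_cases j <;> simp [gam] at this ⊢ <;> linear_combination (1 / 2) * this
  apply Subtype.ext
  have := eq_sum_sl3 v
  simp only [h, zero_smul, Finset.sum_const_zero, zero_add] at this
  simpa using this

theorem coe_castSucc_two (g : K) (i : Fin 2) : (g.1 : Mat) i.castSucc 2 = 0 := by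
  obtain ⟨-, h1, h2, -⟩ := (mem_K_iff g.1).mp g.2
  fin_cases i
  exacts [h1, h2]

theorem coe_two_castSucc (g : K) (i : Fin 2) : (g.1 : Mat) 2 i.castSucc = 0 := by
  obtain ⟨-, -, -, h1, h2⟩ := (mem_K_iff g.1).mp g.2
  fin_cases i
  exacts [h1, h2]

theorem coe_castSucc (g : K) (i j : Fin 2) : (g.1 : Mat) i.castSucc j.castSucc = blk g i j := rfl

theorem coe_two_two (g : K) : (g.1 : Mat) 2 2 = corner g := rfl

theorem coe_Ad (g : K) (X : sl3) :
    ((Ad g.1 X : sl3) : Mat) = (g.1 : Mat) * (X : Mat) * (g.1 : Mat)ᴴ := by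
  rw [← coe_inv]; rfl

theorem conj_single_apply (g : Mat) (a b p q : Fin 3) :
    (g * Matrix.single a b (1 : ℂ) * gᴴ) p q = g p a * star (g q b) := by
  rw [Matrix.mul_apply, Finset.sum_eq_single b]
  · simp
  · intro c _ hc
    rw [Matrix.mul_single_apply_of_ne _ _ _ _ _ hc, zero_mul]
  · simp

theorem Ad_kX (g : K) (i j : Fin 2) : Ad g.1 (kX i j) =
    ∑ k, ∑ l, (blk g k i * star (blk g l j)) • (kX k l : sl3) := by
  have h : ∀ p q, ((Ad g.1 (kX i j) : sl3) : Mat) p q =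
      (g.1 : Mat) p i.castSucc * star ((g.1 : Mat) q j.castSucc) -
        if i = j then (g.1 : Mat) p 2 * star ((g.1 : Mat) q 2) else 0 := fun p q => by
    rw [coe_Ad, coe_kX, mul_sub, sub_mul, Matrix.sub_apply, conj_single_apply]
    split_ifs
    · rw [conj_single_apply]
    · simp
  rw [eq_sum_sl3 (Ad g.1 (kX i j))]
  simp only [h, coe_castSucc, coe_castSucc_two, coe_two_castSucc, star_zero, mul_zero, zero_mul,
    ite_self, sub_zero, zero_smul, Finset.sum_const_zero, add_zero]

theorem Ad_pCol (g : K) (i : Fin 2) : Ad g.1 (pCol i) =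
    ∑ k, (star (corner g) * blk g k i) • (pCol k : sl3) := by
  have h : ∀ p q, ((Ad g.1 (pCol i) : sl3) : Mat) p q =
      (g.1 : Mat) p i.castSucc * star ((g.1 : Mat) q 2) := fun p q => by
    rw [coe_Ad, coe_pCol, conj_single_apply]
  rw [eq_sum_sl3 (Ad g.1 (pCol i))]
  simp only [h, coe_castSucc, coe_castSucc_two, coe_two_castSucc, coe_two_two, star_zero, mul_zero,
    zero_mul, zero_smul, Finset.sum_const_zero, add_zero, zero_add, mul_comm]

theorem Ad_pRow (g : K) (i : Fin 2) : Ad g.1 (pRow i) =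
    ∑ k, (corner g * star (blk g k i)) • (pRow k : sl3) := by
  have h : ∀ p q, ((Ad g.1 (pRow i) : sl3) : Mat) p q =
      (g.1 : Mat) p 2 * star ((g.1 : Mat) q i.castSucc) := fun p q => by
    rw [coe_Ad, coe_pRow, conj_single_apply]
  rw [eq_sum_sl3 (Ad g.1 (pRow i))]
  simp only [h, coe_castSucc, coe_castSucc_two, coe_two_castSucc, coe_two_two, star_zero, mul_zero,
    zero_mul, zero_smul, Finset.sum_const_zero, zero_add]

theorem AdP_pCol (g : K) (i : Fin 2) : AdP g (pCol i) =
    ∑ k, (star (corner g) * blk g k i) • pCol k := by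
  apply Subtype.ext
  refine (Ad_pCol g i).trans ?_
  simp

theorem AdP_pRow (g : K) (i : Fin 2) : AdP g (pRow i) =
    ∑ k, (corner g * star (blk g k i)) • pRow k := by
  apply Subtype.ext
  refine (Ad_pRow g i).trans ?_
  simp

/-! ### Generators of the three algebras -/

section

section

variable {R : Type*} [Ring R] [Algebra ℂ R] {val : Gen → R}

theorem val_mem_low_two (g : Gen) : val g ∈ Low val 2 := hom_le_low one_lt_two (val_mem_hom g)

theorem one_mem_low {n : ℕ} (hn : 0 < n) : (1 : R) ∈ Low val n := hom_le_low hn one_mem_hom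

theorem ite_val_mem_low_two (p : Prop) [Decidable p] (g : Gen) :
    (if p then val g else 0) ∈ Low val 2 := by
  split_ifs
  exacts [val_mem_low_two g, zero_mem _]

/-- If the generators generate the algebra, then words exhaust it. -/
theorem exists_mem_low (h : Algebra.adjoin ℂ (Set.range val) = ⊤) (x : R) :
    ∃ n, x ∈ Low val n := by
  have hx : x ∈ Algebra.adjoin ℂ (Set.range val) := h ▸ Algebra.mem_top
  induction hx using Algebra.adjoin_induction with
  | mem x hx =>
    obtain ⟨g, rfl⟩ := hx
    exact ⟨2, val_mem_low_two g⟩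
  | algebraMap r =>
    rw [Algebra.algebraMap_eq_smul_one]
    exact ⟨1, Submodule.smul_mem _ _ (one_mem_low one_pos)⟩
  | add x y _ _ hx hy =>
    obtain ⟨m, hm⟩ := hx
    obtain ⟨n, hn⟩ := hy
    exact ⟨max m n, add_mem (low_mono (le_max_left _ _) hm) (low_mono (le_max_right _ _) hn)⟩
  | mul x y _ _ hx hy =>
    obtain ⟨m, hm⟩ := hx
    obtain ⟨n, hn⟩ := hy
    exact ⟨m + n, low_mul_low (low_mono m.le_succ hm) hn⟩

theorem DiracRelations.superComm (hR : DiracRelations val) : SuperComm val := by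
  have h2 : ∀ i j : Fin 2, (if i = j then (2 : ℂ) • (1 : R) else 0) ∈ Low val 2 := fun i j => by
    split_ifs
    exacts [Submodule.smul_mem _ _ (one_mem_low two_pos), zero_mem _]
  rintro (⟨a, b⟩ | ⟨_ | _, i⟩ | ⟨_ | _, i⟩) (⟨c, d⟩ | ⟨_ | _, j⟩ | ⟨_ | _, j⟩) <;>
    simp only [Gen.odd, Bool.toNat_false, Bool.toNat_true, mul_zero, mul_one, pow_zero,
      pow_one, one_smul, neg_smul, sub_neg_eq_add]
  · rw [hR.X_X, add_sub_cancel_left]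
    exact sub_mem (ite_val_mem_low_two _ _) (ite_val_mem_low_two _ _)
  · rw [hR.X_col, add_sub_cancel_left]
    exact add_mem (ite_val_mem_low_two _ _) (ite_val_mem_low_two _ _)
  · rw [hR.comm (.col true j) (.X a b) rfl rfl, sub_self]; exact zero_mem _
  · rw [hR.X_row, sub_sub_cancel_left]
    exact neg_mem (add_mem (ite_val_mem_low_two _ _) (ite_val_mem_low_two _ _))
  · rw [hR.comm (.row true j) (.X a b) rfl rfl, sub_self]; exact zero_mem _
  · rw [hR.X_col, sub_add_cancel_left]
    exact neg_mem (add_mem (ite_val_mem_low_two _ _) (ite_val_mem_low_two _ _))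
  · rw [hR.col_col, sub_self]; exact zero_mem _
  · rw [hR.comm (.col true j) (.col false i) rfl rfl, sub_self]; exact zero_mem _
  · rw [hR.col_row, add_sub_cancel_left]; exact val_mem_low_two _
  · rw [hR.comm (.row true j) (.col false i) rfl rfl, sub_self]; exact zero_mem _
  · rw [hR.comm (.col true i) (.X c d) rfl rfl, sub_self]; exact zero_mem _
  · rw [hR.comm (.col true i) (.col false j) rfl rfl, sub_self]; exact zero_mem _
  · rw [hR.ccol_ccol, neg_add_cancel]; exact zero_mem _
  · rw [hR.comm (.col true i) (.row false j) rfl rfl, sub_self]; exact zero_mem _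
  · rw [hR.ccol_crow, sub_add_eq_add_sub, neg_add_cancel, zero_sub]; exact neg_mem (h2 _ _)
  · rw [hR.X_row, sub_sub_self]
    exact add_mem (ite_val_mem_low_two _ _) (ite_val_mem_low_two _ _)
  · rw [hR.col_row, sub_add_cancel_left]; exact neg_mem (val_mem_low_two _)
  · rw [hR.comm (.col true j) (.row false i) rfl rfl, sub_self]; exact zero_mem _
  · rw [hR.row_row, sub_self]; exact zero_mem _
  · rw [hR.comm (.row true j) (.row false i) rfl rfl, sub_self]; exact zero_mem _
  · rw [hR.comm (.row true i) (.X c d) rfl rfl, sub_self]; exact zero_mem _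
  · rw [hR.comm (.row true i) (.col false j) rfl rfl, sub_self]; exact zero_mem _
  · rw [hR.ccol_crow, add_sub, add_neg_cancel, zero_sub]; exact neg_mem (h2 _ _)
  · rw [hR.comm (.row true i) (.row false j) rfl rfl, sub_self]; exact zero_mem _
  · rw [hR.crow_crow, neg_add_cancel]; exact zero_mem _

end

/-- The generators of `U(𝔤) ⊗ C(𝔭)`. -/
noncomputable def valUC : Gen → UC
  | .X i j => u (kX i j) ⊗ₜ 1
  | .col false i => u (pCol i) ⊗ₜ 1
  | .col true i => 1 ⊗ₜ cl (pCol i)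
  | .row false i => u (pRow i) ⊗ₜ 1
  | .row true i => 1 ⊗ₜ cl (pRow i)

/-- The generators of `C(𝔭)`; the labels of the generators of `U(𝔤)` have the value zero. -/
noncomputable def valC : Gen → Cp
  | .X _ _ => 0
  | .col false _ => 0
  | .col true i => cl (pCol i)
  | .row false _ => 0
  | .row true i => cl (pRow i)

/-- The generators of `U(𝔨)`; the other labels have the value zero. -/
noncomputable def valK : Gen → Uk
  | .X i j => uk (kX i j)
  | .col _ _ => 0
  | .row _ _ => 0

theorem u_mul_u (X Y : sl3) : u X * u Y = u Y * u X + u ⁅X, Y⁆ := by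
  rw [LieHom.map_lie, LieRing.of_associative_ring_bracket]
  abel

theorem uk_mul_uk (X Y : kk) : uk X * uk Y = uk Y * uk X + uk ⁅X, Y⁆ := by
  rw [LieHom.map_lie, LieRing.of_associative_ring_bracket]
  abel

theorem cl_mul_cl (v w : pp) : cl v * cl w = -(cl w * cl v) - (2 * B v w) • (1 : Cp) := by
  have h := cl_mul_add_mul_cl v w
  rw [Algebra.algebraMap_eq_smul_one] at h
  rw [eq_sub_of_add_eq h]
  module

theorem cl_pCol_mul_cl_pRow (i j : Fin 2) : cl (pCol i) * cl (pRow j) =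
    -(cl (pRow j) * cl (pCol i)) - if i = j then (2 : ℂ) • 1 else 0 := by
  rw [cl_mul_cl, B_pCol_pRow]
  split_ifs <;> simp

theorem cl_pCol_mul_cl_pCol (i j : Fin 2) : cl (pCol i) * cl (pCol j) =
    -(cl (pCol j) * cl (pCol i)) := by
  rw [cl_mul_cl, B_pCol_pCol, mul_zero, zero_smul, sub_zero]

theorem cl_pRow_mul_cl_pRow (i j : Fin 2) : cl (pRow i) * cl (pRow j) =
    -(cl (pRow j) * cl (pRow i)) := by
  rw [cl_mul_cl, B_pRow_pRow, mul_zero, zero_smul, sub_zero]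

theorem diracRelations_valUC : DiracRelations valUC where
  X_X a b c d := by
    simp only [valUC, Algebra.TensorProduct.tmul_mul_tmul, mul_one]
    rw [u_mul_u, ← LieSubalgebra.coe_bracket, lie_kX_kX, TensorProduct.add_tmul]
    congr 1
    split_ifs <;> simp [TensorProduct.sub_tmul, TensorProduct.neg_tmul]
  X_col a b k := by
    simp only [valUC, Algebra.TensorProduct.tmul_mul_tmul, mul_one]
    rw [u_mul_u, lie_kX_pCol, TensorProduct.add_tmul]
    congr 1
    split_ifs <;> simp [TensorProduct.add_tmul]
  X_row a b k := by
    simp only [valUC, Algebra.TensorProduct.tmul_mul_tmul, mul_one]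
    rw [u_mul_u, lie_kX_pRow, TensorProduct.add_tmul, sub_eq_add_neg]
    congr 1
    split_ifs <;> simp [TensorProduct.neg_tmul, TensorProduct.add_tmul]
  col_col i j := by
    simp only [valUC, Algebra.TensorProduct.tmul_mul_tmul, mul_one]
    rw [u_mul_u, lie_pCol_pCol, map_zero, add_zero]
  row_row i j := by
    simp only [valUC, Algebra.TensorProduct.tmul_mul_tmul, mul_one]
    rw [u_mul_u, lie_pRow_pRow, map_zero, add_zero]
  col_row i j := by
    simp only [valUC, Algebra.TensorProduct.tmul_mul_tmul, mul_one]
    rw [u_mul_u, lie_pCol_pRow, TensorProduct.add_tmul]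
  comm := by
    rintro (⟨a, b⟩ | ⟨_ | _, i⟩ | ⟨_ | _, i⟩) (⟨c, d⟩ | ⟨_ | _, j⟩ | ⟨_ | _, j⟩) hg hh <;>
      simp [Gen.odd, valUC] at hg hh ⊢
  ccol_crow i j := by
    simp only [valUC, Algebra.TensorProduct.tmul_mul_tmul, mul_one]
    rw [cl_pCol_mul_cl_pRow, TensorProduct.tmul_sub, TensorProduct.tmul_neg]
    split_ifs <;> simp [Algebra.TensorProduct.one_def]
  ccol_ccol i j := by
    simp only [valUC, Algebra.TensorProduct.tmul_mul_tmul, mul_one]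
    rw [cl_pCol_mul_cl_pCol, TensorProduct.tmul_neg]
  crow_crow i j := by
    simp only [valUC, Algebra.TensorProduct.tmul_mul_tmul, mul_one]
    rw [cl_pRow_mul_cl_pRow, TensorProduct.tmul_neg]

theorem diracRelations_valC : DiracRelations valC where
  X_X a b c d := by simp [valC]
  X_col a b k := by simp [valC]
  X_row a b k := by simp [valC]
  col_col i j := by simp [valC]
  row_row i j := by simp [valC]
  col_row i j := by simp [valC]
  comm := by
    rintro (⟨a, b⟩ | ⟨_ | _, i⟩ | ⟨_ | _, i⟩) (⟨c, d⟩ | ⟨_ | _, j⟩ | ⟨_ | _, j⟩) hg hh <;>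
      simp [Gen.odd, valC] at hg hh ⊢
  ccol_crow i j := cl_pCol_mul_cl_pRow i j
  ccol_ccol i j := cl_pCol_mul_cl_pCol i j
  crow_crow i j := cl_pRow_mul_cl_pRow i j

theorem valK_X_X (a b c d : Fin 2) : valK (.X a b) * valK (.X c d) = valK (.X c d) * valK (.X a b) +
    ((if b = c then valK (.X a d) else 0) - if d = a then valK (.X c b) else 0) := by
  simp only [valK]
  rw [uk_mul_uk, lie_kX_kX]
  congr 1
  split_ifs <;> simp

theorem superComm_valK : SuperComm valK := by
  rintro (⟨a, b⟩ | ⟨s, i⟩ | ⟨s, i⟩) (⟨c, d⟩ | ⟨t, j⟩ | ⟨t, j⟩)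
  · rw [valK_X_X]
    simp only [Gen.odd, mul_zero, pow_zero, one_smul, add_sub_cancel_left]
    exact sub_mem (ite_val_mem_low_two _ _) (ite_val_mem_low_two _ _)
  all_goals simp [valK]

theorem isLieAction_valK : IsLieAction valK := by
  rintro a b (_ | _) i j
  · change valK (.X a b) * valK (.X i j) - valK (.X i j) * valK (.X a b) = _
    rw [valK_X_X, add_sub_cancel_left]
    simp [lmat, eq_comm]
  · simp [lmat, valK]

/-- The universal enveloping algebra is generated by the Lie algebra: the inclusion lifts to the
subalgebra generated by the Lie algebra. -/
theorem adjoin_range_ι (L : Type*) [LieRing L] [LieAlgebra ℂ L] :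
    Algebra.adjoin ℂ (Set.range
      (UniversalEnvelopingAlgebra.ι ℂ : L → UniversalEnvelopingAlgebra ℂ L)) = ⊤ := by
  set S := Algebra.adjoin ℂ
    (Set.range (UniversalEnvelopingAlgebra.ι ℂ : L → UniversalEnvelopingAlgebra ℂ L)) with hS
  let f : L →ₗ⁅ℂ⁆ S :=
    { toFun := fun x => ⟨UniversalEnvelopingAlgebra.ι ℂ x, Algebra.subset_adjoin ⟨x, rfl⟩⟩
      map_add' := fun x y => Subtype.ext (map_add _ x y)
      map_smul' := fun c x => Subtype.ext (map_smul _ c x)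
      map_lie' := fun {x y} => Subtype.ext (LieHom.map_lie _ x y) }
  have h : S.val.comp (UniversalEnvelopingAlgebra.lift ℂ f) = AlgHom.id ℂ _ := by
    apply UniversalEnvelopingAlgebra.hom_ext
    ext x
    simp [f]
  refine eq_top_iff.mpr fun x _ => ?_
  have := congrArg (fun φ => φ x) h
  simp only [AlgHom.comp_apply, AlgHom.id_apply] at this
  rw [← this]
  exact (UniversalEnvelopingAlgebra.lift ℂ f x).2

theorem adjoin_valK : Algebra.adjoin ℂ (Set.range valK) = ⊤ := by
  rw [eq_top_iff, ← adjoin_range_ι]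
  refine Algebra.adjoin_le ?_
  rintro _ ⟨X, rfl⟩
  rw [eq_sum_kX X]
  simp only [map_sum, map_smul]
  exact sum_mem fun i _ => sum_mem fun j _ => Subalgebra.smul_mem _
    (Algebra.subset_adjoin (Set.mem_range_self (Gen.X i j))) _

theorem adjoin_valC : Algebra.adjoin ℂ (Set.range valC) = ⊤ := by
  rw [eq_top_iff, ← CliffordAlgebra.adjoin_range_ι]
  refine Algebra.adjoin_le ?_
  rintro _ ⟨v, rfl⟩
  rw [eq_sum_pCol_pRow v]
  simp only [map_add, map_sum, map_smul]
  exact add_mem (sum_mem fun i _ => Subalgebra.smul_mem _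
    (Algebra.subset_adjoin (Set.mem_range_self (Gen.col true i))) _)
    (sum_mem fun i _ => Subalgebra.smul_mem _
    (Algebra.subset_adjoin (Set.mem_range_self (Gen.row true i))) _)

theorem adjoin_valUC : Algebra.adjoin ℂ (Set.range valUC) = ⊤ := by
  set S := Algebra.adjoin ℂ (Set.range valUC) with hS
  have hval : ∀ g, valUC g ∈ S := fun g => Algebra.subset_adjoin ⟨g, rfl⟩
  have hU : (⊤ : Subalgebra ℂ Ug) ≤ S.comap (Algebra.TensorProduct.includeLeft : Ug →ₐ[ℂ] UC) := by
    rw [← adjoin_range_ι]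
    refine Algebra.adjoin_le ?_
    rintro _ ⟨X, rfl⟩
    rw [eq_sum_sl3 X]
    simp only [map_add, map_sum, map_smul]
    exact add_mem (add_mem (sum_mem fun i _ => sum_mem fun j _ => Subalgebra.smul_mem _
      (hval (.X i j)) _) (sum_mem fun i _ => Subalgebra.smul_mem _ (hval (.col false i)) _))
      (sum_mem fun i _ => Subalgebra.smul_mem _ (hval (.row false i)) _)
  have hC : (⊤ : Subalgebra ℂ Cp) ≤ S.comap CpToUC := by
    rw [← adjoin_valC]
    refine Algebra.adjoin_le ?_
    rintro _ ⟨⟨i, j⟩ | ⟨_ | _, i⟩ | ⟨_ | _, i⟩, rfl⟩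
    exacts [zero_mem _, zero_mem _, hval (.col true i), zero_mem _, hval (.row true i)]
  refine eq_top_iff.mpr fun x _ => ?_
  induction x using TensorProduct.induction_on with
  | zero => exact zero_mem _
  | add x y hx hy => exact add_mem (hx trivial) (hy trivial)
  | tmul a c =>
    have := S.mul_mem (hU (Algebra.mem_top (x := a))) (hC (Algebra.mem_top (x := c)))
    simpa [CpToUC] using this

theorem isAdjointAction_valUC : IsAdjointAction valUC actUC where
  X g i j := by
    have h : actUC g (valUC (.X i j)) = u (Ad g.1 (kX i j)) ⊗ₜ 1 := by
      simp [valUC, actUC, actU]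
    rw [h, Ad_kX]
    simp only [valUC, map_sum, map_smul, TensorProduct.sum_tmul, TensorProduct.smul_tmul']
  col g s i := by
    cases s with
    | false =>
      have h : actUC g (valUC (.col false i)) = u (Ad g.1 (pCol i)) ⊗ₜ 1 := by
        simp [valUC, actUC, actU]
      rw [h, Ad_pCol]
      simp only [valUC, map_sum, map_smul, TensorProduct.sum_tmul, TensorProduct.smul_tmul']
    | true =>
      have h : actUC g (valUC (.col true i)) = 1 ⊗ₜ cl (AdP g (pCol i)) := by
        simp [valUC, actUC, actC]
      rw [h, AdP_pCol]
      simp only [valUC, map_sum, map_smul, TensorProduct.tmul_sum, TensorProduct.tmul_smul]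
  row g s i := by
    cases s with
    | false =>
      have h : actUC g (valUC (.row false i)) = u (Ad g.1 (pRow i)) ⊗ₜ 1 := by
        simp [valUC, actUC, actU]
      rw [h, Ad_pRow]
      simp only [valUC, map_sum, map_smul, TensorProduct.sum_tmul, TensorProduct.smul_tmul']
    | true =>
      have h : actUC g (valUC (.row true i)) = 1 ⊗ₜ cl (AdP g (pRow i)) := by
        simp [valUC, actUC, actC]
      rw [h, AdP_pRow]
      simp only [valUC, map_sum, map_smul, TensorProduct.tmul_sum, TensorProduct.tmul_smul]

theorem isAdjointAction_valC : IsAdjointAction valC actC where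
  X g i j := by simp [valC]
  col g s i := by
    cases s with
    | false => simp [valC]
    | true =>
      have h : actC g (valC (.col true i)) = cl (AdP g (pCol i)) := by simp [valC, actC]
      rw [h, AdP_pCol]
      simp [valC]
  row g s i := by
    cases s with
    | false => simp [valC]
    | true =>
      have h : actC g (valC (.row true i)) = cl (AdP g (pRow i)) := by simp [valC, actC]
      rw [h, AdP_pRow]
      simp [valC]

end

/-! ### The generators in terms of contractions -/

theorem kH1_add_kH2 : kH1 + kH2 = (1 / 3 : ℂ) • (kX 0 0 + kX 1 1) := by
  simp only [kX, Matrix.of_apply, Matrix.cons_val', Matrix.cons_val_zero, Matrix.cons_val_one,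
    Matrix.cons_val_fin_one]
  module

theorem kH1_sub_kH2 : kH1 - kH2 = kX 0 0 - kX 1 1 := by
  simp only [kX, Matrix.of_apply, Matrix.cons_val', Matrix.cons_val_zero, Matrix.cons_val_one,
    Matrix.cons_val_fin_one]
  module

theorem H1_add_H2 : H1 + H2 = (1 / 3 : ℂ) • ((kX 0 0 : sl3) + kX 1 1) :=
  congrArg (fun X : kk => (X : sl3)) kH1_add_kH2

theorem H1_sub_H2 : H1 - H2 = (kX 0 0 : sl3) - kX 1 1 :=
  congrArg (fun X : kk => (X : sl3)) kH1_sub_kH2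

theorem trX_valK : trX valK = (3 : ℂ) • aK := by
  rw [aK, kH1_add_kH2, trX, Fin.sum_univ_two]
  simp only [valK, map_smul, map_add]
  module

theorem UkToUC_uk (X : kk) : UkToUC (uk X) = u X ⊗ₜ 1 := by
  simp [UkToUC]

theorem UkToUC_aK : UkToUC aK = aTilde := by
  rw [aK, UkToUC_uk]; rfl

theorem UkToUC_bK : UkToUC bK = bTilde := by
  have h2 : UkToUC 2 = (2 : Ug) ⊗ₜ[ℂ] (1 : Cp) := by
    rw [map_ofNat]; rfl
  rw [bK, bTilde]
  simp only [map_add, map_mul, map_pow, UkToUC_uk, h2]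
  simp only [pow_two, Algebra.TensorProduct.tmul_mul_tmul, mul_one, ← TensorProduct.add_tmul]
  rfl

theorem CpToUC_gC : CpToUC gC = gTilde := rfl

theorem trXX_valK : trXX valK = (9 / 2 : ℂ) • (aK * aK) + (1 / 2 : ℂ) • bK := by
  rw [aK, bK, kH1_add_kH2, kH1_sub_kH2]
  have h2 : (2 : Uk) = (2 : ℂ) • 1 := by rw [← Algebra.algebraMap_eq_smul_one, map_ofNat]
  have h01 : kE = kX 0 1 := rfl
  have h10 : kF = kX 1 0 := rfl
  simp only [trXX, Fin.sum_univ_two, valK, h01, h10, map_smul, map_add, map_sub, h2, pow_two,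
    smul_mul_assoc, mul_smul_comm, one_mul, add_mul, mul_add, sub_mul, mul_sub]
  module

theorem UkToUC_valK_X (i j : Fin 2) : UkToUC (valK (.X i j)) = valUC (.X i j) := UkToUC_uk _

theorem UkToUC_trX : UkToUC (trX valK) = trX valUC := by
  simp only [trX, map_sum, UkToUC_valK_X]

theorem UkToUC_trXX : UkToUC (trXX valK) = trXX valUC := by
  simp only [trXX, map_sum, map_mul, UkToUC_valK_X]

theorem trX_valUC : trX valUC = (3 : ℂ) • aTilde := by
  rw [← UkToUC_trX, trX_valK, map_smul, UkToUC_aK]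

theorem trXX_valUC :
    trXX valUC = (9 / 2 : ℂ) • (aTilde * aTilde) + (1 / 2 : ℂ) • bTilde := by
  rw [← UkToUC_trXX, trXX_valK, map_add, map_smul, map_smul, map_mul, UkToUC_aK, UkToUC_bK]

theorem rowCol_valC : rowCol valC true true = -gC - (4 : ℂ) • 1 := by
  have e : gC = cl (pCol 0) * cl (pRow 0) + cl (pCol 1) * cl (pRow 1) := rfl
  rw [e, cl_pCol_mul_cl_pRow, cl_pCol_mul_cl_pRow]
  simp only [rowCol, Fin.sum_univ_two, valC, if_true]
  module

theorem rowCol_valUC : rowCol valUC true true = -gTilde - (4 : ℂ) • 1 := by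
  have h : CpToUC (rowCol valC true true) = rowCol valUC true true := by
    simp only [rowCol, map_sum, map_mul]
    rfl
  rw [← h, rowCol_valC, map_sub, map_neg, map_smul, map_one, CpToUC_gC]

theorem D_eq : D = rowCol valUC true false + rowCol valUC false true := by
  simp only [D, rowCol, Fin.sum_univ_two, valUC, Algebra.TensorProduct.tmul_mul_tmul, mul_one,
    one_mul, add_assoc]
  rfl

theorem alpha_add (X Y : kk) : alpha (X + Y) = alpha X + alpha Y := by
  have h : ∀ v, adP (X + Y) v = adP X v + adP Y v := fun v => Subtype.ext (by simp [adP])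
  simp only [alpha, h, map_add, add_mul, mul_add, Finset.sum_add_distrib, Finset.sum_sub_distrib]
  module

theorem alpha_smul (c : ℂ) (X : kk) : alpha (c • X) = c • alpha X := by
  have h : ∀ v, adP (c • X) v = c • adP X v := fun v => Subtype.ext (by simp [adP])
  simp only [alpha, h, map_smul, smul_mul_assoc, mul_smul_comm, ← smul_sub, ← Finset.smul_sum]
  module

set_option maxHeartbeats 1000000 in
/-- The spin action of `𝔨` in terms of the bases of `𝔭⁺` and `𝔭⁻`. -/
theorem alpha_kX (a b : Fin 2) : alpha (kX a b) = (-1 / 2 : ℂ) • (cl (pCol a) * cl (pRow b) +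
    if a = b then gC + (3 : ℂ) • 1 else 0) := by
  have hc : ∀ k, adP (kX a b) (pCol k) =
      (if b = k then pCol a else 0) + if a = b then pCol k else 0 := fun k => by
    apply Subtype.ext
    refine (lie_kX_pCol a b k).trans ?_
    split_ifs <;> simp
  have hr : ∀ k, adP (kX a b) (pRow k) =
      -((if k = a then pRow b else 0) + if a = b then pRow k else 0) := fun k => by
    apply Subtype.ext
    refine (lie_kX_pRow a b k).trans ?_
    split_ifs <;> simp
  have hs : ∀ i j, cl (pRow j) * cl (pCol i) =
      -(cl (pCol i) * cl (pRow j)) - if i = j then (2 : ℂ) • 1 else 0 := fun i j => by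
    rw [cl_pCol_mul_cl_pRow]
    abel
  have e : gC = cl (pCol 0) * cl (pRow 0) + cl (pCol 1) * cl (pRow 1) := rfl
  have e0 : pBasis 0 = pCol 0 := rfl
  have e1 : pBasis 1 = pCol 1 := rfl
  have e2 : pBasis 2 = pRow 0 := rfl
  have e3 : pBasis 3 = pRow 1 := rfl
  have d0 : pDual 0 = pRow 0 := rfl
  have d1 : pDual 1 = pRow 1 := rfl
  have d2 : pDual 2 = pCol 0 := rfl
  have d3 : pDual 3 = pCol 1 := rfl
  rw [alpha, Fin.sum_univ_four, e0, e1, e2, e3, d0, d1, d2, d3, hc, hc, hr, hr, e]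
  fin_cases a <;> fin_cases b <;>
    simp only [Fin.zero_eta, Fin.mk_one, if_true, zero_ne_one, one_ne_zero, if_false, map_add,
      map_neg, map_zero, add_mul, mul_add, neg_mul, mul_neg, hs, zero_mul, mul_zero, add_zero,
      zero_add] <;>
    module

/-- The operator `D^𝔨` in terms of contractions. -/
theorem Dk_eq : Dk = (1 / 2 : ℂ) • rowXCol valUC true true + (1 / 2 : ℂ) • trX valUC := by
  have hs : ∀ i j, cl (pRow j) * cl (pCol i) =
      -(cl (pCol i) * cl (pRow j)) - if i = j then (2 : ℂ) • 1 else 0 := fun i j => by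
    rw [cl_pCol_mul_cl_pRow]
    abel
  have e : gC = cl (pCol 0) * cl (pRow 0) + cl (pCol 1) * cl (pRow 1) := rfl
  have hE : E = (kX 0 1 : sl3) := rfl
  have hF : F = (kX 1 0 : sl3) := rfl
  have hkE : kE = kX 0 1 := rfl
  have hkF : kF = kX 1 0 := rfl
  have hsub : alpha (kX 0 0 - kX 1 1) = alpha (kX 0 0) - alpha (kX 1 1) := by
    rw [sub_eq_add_neg, ← neg_one_smul ℂ, alpha_add, alpha_smul]
    module
  rw [Dk, H1_add_H2, H1_sub_H2, kH1_add_kH2, kH1_sub_kH2, hE, hF, hkE, hkF, hsub, alpha_smul,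
    alpha_add]
  simp only [alpha_kX, rowXCol, trX, Fin.sum_univ_two, valUC, Algebra.TensorProduct.tmul_mul_tmul,
    mul_one, one_mul, hs, e, if_true, zero_ne_one, one_ne_zero, if_false, map_add, map_sub,
    map_smul, TensorProduct.add_tmul, TensorProduct.tmul_add, TensorProduct.sub_tmul,
    TensorProduct.tmul_sub, TensorProduct.tmul_smul, ← TensorProduct.smul_tmul',
    TensorProduct.tmul_neg, TensorProduct.tmul_zero, smul_add, smul_sub, smul_neg, smul_zero]
  module

/-! ### The three algebras of invariants -/

theorem adjoin_eq_UCInv : Algebra.adjoin ℂ {aTilde, bTilde, gTilde, D, Dk} = UCInv := by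
  set A := Algebra.adjoin ℂ {aTilde, bTilde, gTilde, D, Dk} with hA
  have ha : aTilde ∈ A := Algebra.subset_adjoin (by simp)
  have hb : bTilde ∈ A := Algebra.subset_adjoin (by simp)
  have hg : gTilde ∈ A := Algebra.subset_adjoin (by simp)
  have hD : D ∈ A := Algebra.subset_adjoin (by simp)
  have hDk : Dk ∈ A := Algebra.subset_adjoin (by simp)
  have hact := isAdjointAction_valUC
  have htr : trX valUC ∈ A := by rw [trX_valUC]; exact A.smul_mem ha _
  have hS : rowXCol valUC true true = (2 : ℂ) • Dk - trX valUC := by rw [Dk_eq]; module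
  have hcontr : HasContractions valUC A := by
    refine diracRelations_valUC.hasContractions htr ?_ ?_ ?_ ?_
    · rw [trXX_valUC]
      exact A.add_mem (A.smul_mem (A.mul_mem ha ha) _) (A.smul_mem hb _)
    · rw [rowCol_valUC]
      exact A.sub_mem (A.neg_mem hg) (A.smul_mem A.one_mem _)
    · rw [← D_eq]
      exact hD
    · rw [hS]
      exact A.sub_mem (A.smul_mem hDk _) htr
  have ea : aTilde = (1 / 3 : ℂ) • trX valUC := by rw [trX_valUC]; module
  have eb : bTilde = (2 : ℂ) • trXX valUC - (trX valUC * trX valUC) := by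
    rw [trX_valUC, trXX_valUC, smul_mul_smul_comm]; module
  have eg : gTilde = -rowCol valUC true true - (4 : ℂ) • 1 := by rw [rowCol_valUC]; module
  have hle : A ≤ UCInv := by
    refine Algebra.adjoin_le ?_
    rintro _ (rfl | rfl | rfl | rfl | rfl) <;> refine (mem_UCInv _).mpr fun g => ?_
    · rw [ea, map_smul, hact.trX]
    · rw [eb, map_sub, map_smul, map_mul, hact.trX, hact.trXX]
    · rw [eg, map_sub, map_neg, map_smul, map_one, hact.rowCol]
    · rw [D_eq, map_add, hact.rowCol, hact.rowCol]
    · rw [Dk_eq, map_add, map_smul, map_smul, hact.rowXCol, hact.trX]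
  refine le_antisymm hle fun x hx => ?_
  exact hact.mem_of_invariant diracRelations_valUC.superComm hcontr
    (fun y hy => (mem_UCInv y).mp (hle hy)) (exists_mem_low adjoin_valUC) ((mem_UCInv x).mp hx)

theorem adjoin_eq_CpInv : Algebra.adjoin ℂ {gC} = CpInv := by
  set A := Algebra.adjoin ℂ {gC} with hA
  have hg : gC ∈ A := Algebra.subset_adjoin rfl
  have hact := isAdjointAction_valC
  have hcontr : HasContractions valC A := by
    refine ⟨?_, ?_, ?_, ?_⟩
    · simp [trX, valC]
    · simp [trXX, valC]
    · rintro (_ | _) (_ | _)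
      · simp [rowCol, valC]
      · simp [rowCol, valC]
      · simp [rowCol, valC]
      · rw [rowCol_valC]
        exact A.sub_mem (A.neg_mem hg) (A.smul_mem A.one_mem _)
    · intro r c
      simp [rowXCol, valC]
  have eg : gC = -rowCol valC true true - (4 : ℂ) • 1 := by rw [rowCol_valC]; module
  have hle : A ≤ CpInv := by
    refine Algebra.adjoin_le ?_
    rintro _ rfl
    refine (mem_CpInv _).mpr fun g => ?_
    rw [eg, map_sub, map_neg, map_smul, map_one, hact.rowCol]
  refine le_antisymm hle fun x hx => ?_
  exact hact.mem_of_invariant diracRelations_valC.superComm hcontr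
    (fun y hy => (mem_CpInv y).mp (hle hy)) (exists_mem_low adjoin_valC) ((mem_CpInv x).mp hx)

/-- An element commuting with the basis of `𝔨` is central. -/
theorem mem_center_of_comm_valK {x : Uk} (h : ∀ i j, x * valK (.X i j) = valK (.X i j) * x) :
    x ∈ Subalgebra.center ℂ Uk := by
  have hle : (⊤ : Subalgebra ℂ Uk) ≤ Subalgebra.centralizer ℂ {x} := by
    rw [← adjoin_valK]
    refine Algebra.adjoin_le ?_
    rintro _ ⟨⟨i, j⟩ | ⟨s, i⟩ | ⟨s, i⟩, rfl⟩ <;>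
      rw [SetLike.mem_coe, Subalgebra.mem_centralizer_iff] <;>
      rintro _ rfl
    · exact h i j
    · simp [valK]
    · simp [valK]
  refine Subalgebra.mem_center_iff.mpr fun y => ?_
  exact ((Subalgebra.mem_centralizer_iff ℂ).mp (hle (Algebra.mem_top (x := y))) x rfl).symm

set_option linter.unusedSimpArgs false in
/-- Both elements are central, by reduction of the commutators with the basis of `𝔨` to a normal
order. -/
theorem trX_trXX_valK_mem_center :
    trX valK ∈ Subalgebra.center ℂ Uk ∧ trXX valK ∈ Subalgebra.center ℂ Uk := by
  constructor <;> refine mem_center_of_comm_valK fun i j => ?_ <;> fin_cases i <;> fin_cases j <;>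
    simp only [trX, trXX, Fin.sum_univ_two, Fin.zero_eta, Fin.mk_one, add_mul, mul_add, sub_mul,
      mul_sub, mul_assoc, if_true, if_false, zero_ne_one, one_ne_zero, zero_mul, mul_zero, add_zero,
      zero_add, sub_zero, zero_sub, neg_mul, mul_neg,
      valK_X_X 1 1 0 0, assoc_of_mul_eq (valK_X_X 1 1 0 0),
      valK_X_X 1 1 0 1, assoc_of_mul_eq (valK_X_X 1 1 0 1),
      valK_X_X 1 1 1 0, assoc_of_mul_eq (valK_X_X 1 1 1 0),
      valK_X_X 1 0 0 0, assoc_of_mul_eq (valK_X_X 1 0 0 0),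
      valK_X_X 1 0 0 1, assoc_of_mul_eq (valK_X_X 1 0 0 1),
      valK_X_X 0 1 0 0, assoc_of_mul_eq (valK_X_X 0 1 0 0)] <;>
    abel

theorem adjoin_eq_center : Algebra.adjoin ℂ {aK, bK} = Subalgebra.center ℂ Uk := by
  set A := Algebra.adjoin ℂ {aK, bK} with hA
  have ha : aK ∈ A := Algebra.subset_adjoin (by simp)
  have hb : bK ∈ A := Algebra.subset_adjoin (by simp)
  have hcontr : HasContractions valK A := by
    refine ⟨?_, ?_, ?_, ?_⟩
    · rw [trX_valK]
      exact A.smul_mem ha _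
    · rw [trXX_valK]
      exact A.add_mem (A.smul_mem (A.mul_mem ha ha) _) (A.smul_mem hb _)
    · intro r c
      simp [rowCol, valK]
    · intro r c
      simp [rowXCol, valK]
  have ea : aK = (1 / 3 : ℂ) • trX valK := by rw [trX_valK]; module
  have eb : bK = (2 : ℂ) • trXX valK - (trX valK * trX valK) := by
    rw [trX_valK, trXX_valK, smul_mul_smul_comm]; module
  obtain ⟨h1, h2⟩ := trX_trXX_valK_mem_center
  have hle : A ≤ Subalgebra.center ℂ Uk := by
    refine Algebra.adjoin_le ?_
    rintro _ (rfl | rfl)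
    · rw [ea]
      exact Subalgebra.smul_mem _ h1 _
    · rw [eb]
      exact sub_mem (Subalgebra.smul_mem _ h2 _) (mul_mem h1 h1)
  refine le_antisymm hle fun x hx => ?_
  exact isLieAction_valK.mem_of_central (fun _ _ => rfl) (fun _ _ => rfl) superComm_valK hcontr
    (fun y hy => Subalgebra.mem_center_iff.mp (hle hy)) (exists_mem_low adjoin_valK)
    (Subalgebra.mem_center_iff.mp hx)

end SU21

/-- The algebra `(U(𝔤) ⊗ C(𝔭))^K` is generated by `ã`, `b̃`, `g̃`, `D`, `D^𝔨`, where `ã`, `b̃` come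
from generators of the center `Z(𝔨)` of `U(𝔨)` and `g̃` from a generator of `C(𝔭)^K`. -/
theorem mainTheorem1 :
    Algebra.adjoin ℂ {SU21.aTilde, SU21.bTilde, SU21.gTilde, SU21.D, SU21.Dk} = SU21.UCInv ∧
    (SU21.UkToUC SU21.aK = SU21.aTilde ∧ SU21.UkToUC SU21.bK = SU21.bTilde ∧
      Algebra.adjoin ℂ {SU21.aK, SU21.bK} = Subalgebra.center ℂ SU21.Uk) ∧
    (SU21.CpToUC SU21.gC = SU21.gTilde ∧
      Algebra.adjoin ℂ {SU21.gC} = SU21.CpInv) := by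
  exact ⟨SU21.adjoin_eq_UCInv, ⟨SU21.UkToUC_aK, SU21.UkToUC_bK, SU21.adjoin_eq_center⟩,
    SU21.CpToUC_gC, SU21.adjoin_eq_CpInv⟩
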